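/- Let $M$ be a compact complex manifold of dimension $n\ge 1$, let $\omega_0$ be a Kähler form on $M$, and let $$\mathcal H_{\omega_0}=\{\varphi\in C^\infty(M,\mathbb R):\ \omega_\varphi:=\omega_0+\sqrt{-1}\,\partial\bar\partial\varphi>0\}.$$ For $k\in\{1,\dots,n\}$ let $J_{\omega_0^k}$ be the functional on $\mathcal H_{\omega_0}$ with $J_{\omega_0^k}(0)=0$ and, along every smooth path $(\varphi_t)_{0\le t\le 1}$ in $\mathcal H_{\omega_0}$, $$\frac{d}{dt}J_{\omega_0^k}(\varphi_t)=\int_M \dot\varphi_t\,\bigl(\omega_0^k\wedge\omega_{\varphi_t}^{n-k}-c_k\,\omega_{\varphi_t}^n\bigr),\qquad c_k=\frac{\int_M\omega_0^k\wedge\omega_0^{n-k}}{\int_M\omega_0^n}=1,$$ that is, $J_{\omega_0^k}(\phi)$ is the integral over $t\in[0,1]$ of the right-hand side along any smooth path in $\mathcal H_{\omega_0}$ from $0$ to $\phi$. Let $$J(\phi)=\int_M\phi\,(\omega_0^n-\omega_\phi^n).$$ Then for every $\phi\in\mathcal H_{\omega_0}$ (and whichever paths from $0$ to $\phi$ are used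 to compute the values $J_{\omega_0^k}(\phi)$) $$J_{\omega_0^n}(\phi)\ \ge\ J_{\omega_0^{n-1}}(\phi)\ \ge\ \cdots\ \ge\ J_{\omega_0}(\phi)\ \ge\ \frac{1}{n(n+1)}\,J(\phi).$$ Equivalently, the last inequality says $n\,J_{\omega_0}(\phi)\ge\frac1{n+1}J(\phi)$, where $n\,J_{\omega_0}$ is the functional with the trace normalization $\frac{d}{dt}\,nJ_{\omega_0}(\varphi_t)=\int_M\dot\varphi_t\,(\mathrm{tr}_{\varphi_t}\omega_0-n)\,\omega_{\varphi_t}^n$. -/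

import Mathlib

open Set MeasureTheory
open scoped Manifold ContDiff Topology

/-! Conventions. A complex manifold of dimension `n` is a space `M` modelled on `Fin n → ℂ` with
`IsManifold 𝓘(ℂ, Fin n → ℂ) ∞ M` (over `ℂ`, smooth means holomorphic). In Mathlib the tangent
space `TangentSpace 𝓘(ℝ, Fin n → ℂ) x` is, by definition, the model space `Fin n → ℂ`, identified
with `T_x M` through the preferred chart `chartAt (Fin n → ℂ) x` at `x`. A differential form on `M`
is accordingly a family, indexed by `x : M`, of real alternating forms on `Fin n → ℂ`, and the
complex structure of `T_x M` is multiplication by `i` (the charts being holomorphic). -/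

/-- The real smooth manifold underlying a complex manifold. -/
instance complexManifold_isRealManifold {n : ℕ} {M : Type*} [TopologicalSpace M]
    [ChartedSpace (Fin n → ℂ) M] [IsManifold 𝓘(ℂ, Fin n → ℂ) ∞ M] :
    IsManifold 𝓘(ℝ, Fin n → ℂ) ∞ M := by
  apply isManifold_of_contDiffOn
  intro e e' he he'
  have h := (contDiffGroupoid ∞ 𝓘(ℂ, Fin n → ℂ)).compatible he he'
  rw [contDiffGroupoid, mem_groupoid_of_pregroupoid] at h
  exact h.1.restrict_scalars ℝ

namespace KahlerJ

noncomputable section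

/-- Multiplication by `i`, as a real linear map. -/
def cplxJ (n : ℕ) : (Fin n → ℂ) →L[ℝ] (Fin n → ℂ) :=
  (Complex.I • ContinuousLinearMap.id ℂ (Fin n → ℂ)).restrictScalars ℝ

/-- Real differential `2`-forms on `M` (no regularity imposed). -/
abbrev TwoForm (n : ℕ) (M : Type*) : Type _ := M → (Fin n → ℂ) [⋀^Fin 2]→L[ℝ] ℝ

/-- Real differential forms of top degree `2n` on `M`; the `2n` arguments are indexed by
`Fin n × Fin 2`, in lexicographic order. -/
abbrev TopForm (n : ℕ) (M : Type*) : Type _ := M → (Fin n → ℂ) [⋀^(Fin n × Fin 2)]→ₗ[ℝ] ℝ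

theorem prod_update {n : ℕ} (Ω : Fin n → (Fin n → ℂ) [⋀^Fin 2]→L[ℝ] ℝ)
    (v : Fin n × Fin 2 → Fin n → ℂ) (p : Fin n × Fin 2) (z : Fin n → ℂ) :
    (∏ i, Ω i (fun j => Function.update v p z (i, j))) =
      Ω p.1 (Function.update (fun j => v (p.1, j)) p.2 z) *
        ∏ i ∈ Finset.univ.erase p.1, Ω i (fun j => v (i, j)) := by
  rw [← Finset.mul_prod_erase Finset.univ _ (Finset.mem_univ p.1)]
  congr 1
  · congr 1
    funext j
    by_cases h : j = p.2
    · subst h; simp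
    · have : (p.1, j) ≠ p := fun h' => h (by rw [← h'])
      simp [Function.update_of_ne, h, this]
  · refine Finset.prod_congr rfl fun i hi => ?_
    congr 1
    funext j
    have : (i, j) ≠ p := fun h' => (Finset.ne_of_mem_erase hi) (by rw [← h'])
    simp [Function.update_of_ne, this]

/-- The multilinear map `v ↦ ∏ i, Ω i (v (i, 0), v (i, 1))`. -/
def prodTwoForms {n : ℕ} (Ω : Fin n → (Fin n → ℂ) [⋀^Fin 2]→L[ℝ] ℝ) :
    MultilinearMap ℝ (fun _ : Fin n × Fin 2 => (Fin n → ℂ)) ℝ :=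
  MultilinearMap.mk' (fun v => ∏ i, Ω i (fun j => v (i, j)))
    (by
      intro v p x y
      rw [prod_update, prod_update, prod_update, ContinuousAlternatingMap.map_update_add, add_mul])
    (by
      intro v p c x
      rw [prod_update, prod_update, ContinuousAlternatingMap.map_update_smul, smul_mul_assoc])

/-- The wedge product `Ω 0 ∧ ⋯ ∧ Ω (n-1)` of `n` two-forms,
`v ↦ 2⁻ⁿ ∑_σ sgn σ ∏_i Ω_i (v_{σ(2i)}, v_{σ(2i+1)})`. -/
def wedge {n : ℕ} (Ω : Fin n → (Fin n → ℂ) [⋀^Fin 2]→L[ℝ] ℝ) :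
    (Fin n → ℂ) [⋀^(Fin n × Fin 2)]→ₗ[ℝ] ℝ :=
  ((2 : ℝ) ^ n)⁻¹ • MultilinearMap.alternatization (prodTwoForms Ω)

/-- The top form `α ^ k ∧ β ^ (n - k)`, for `0 ≤ k ≤ n`. -/
def wedgePow {n : ℕ} {M : Type*} (k : ℕ) (α β : TwoForm n M) : TopForm n M :=
  fun x => wedge fun i : Fin n => if (i : ℕ) < k then α x else β x

/-- The real frame `e₁, i e₁, …, eₙ, i eₙ` of `ℂⁿ`, dual to `dx₁, dy₁, …, dxₙ, dyₙ`; it defines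
the orientation of a complex manifold. -/
def stdFrame (n : ℕ) (p : Fin n × Fin 2) : Fin n → ℂ :=
  Pi.single p.1 (if p.2 = 0 then 1 else Complex.I)

section Manifold

variable {n : ℕ} {M : Type*} [TopologicalSpace M] [ChartedSpace (Fin n → ℂ) M]

/-- The expression of a two-form in the chart at `c`: its pullback under the inverse chart. -/
def localRep (w : TwoForm n M) (c : M) (z : Fin n → ℂ) : (Fin n → ℂ) [⋀^Fin 2]→L[ℝ] ℝ :=
  (w ((chartAt (Fin n → ℂ) c).symm z)).compContinuousLinearMap
    (mfderiv 𝓘(ℝ, Fin n → ℂ) 𝓘(ℝ, Fin n → ℂ) (chartAt (Fin n → ℂ) c).symm z)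

/-- `w (v, i v) > 0` for every nonzero tangent vector `v`. -/
def IsPositive (w : TwoForm n M) : Prop :=
  ∀ x, ∀ v : Fin n → ℂ, v ≠ 0 → 0 < w x ![v, cplxJ n v]

/-- Kähler forms: smooth closed positive real `(1,1)`-forms. -/
structure IsKahlerForm (w : TwoForm n M) : Prop where
  smooth : ∀ c : M, ContDiffOn ℝ ∞ (localRep w c) (chartAt (Fin n → ℂ) c).target
  closed : ∀ c : M, ∀ z ∈ (chartAt (Fin n → ℂ) c).target, extDeriv (localRep w c) z = 0
  type_one_one : ∀ x, ∀ u v : Fin n → ℂ, w x ![cplxJ n u, cplxJ n v] = w x ![u, v]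
  positive : IsPositive w

/-- `√-1 ∂∂̄ f` at `z` for a function `f` on `ℂⁿ`, as half of `d dᶜ f`, where
`dᶜ f = √-1 (∂̄ - ∂) f = - df ∘ J`. -/
def ddbarModel (f : (Fin n → ℂ) → ℝ) (z : Fin n → ℂ) : (Fin n → ℂ) [⋀^Fin 2]→L[ℝ] ℝ :=
  (1 / 2 : ℝ) • extDeriv (fun y => ContinuousAlternatingMap.ofSubsingleton ℝ (Fin n → ℂ) ℝ
    (0 : Fin 1) (-(fderiv ℝ f y).comp (cplxJ n))) z

/-- The two-form `√-1 ∂∂̄ φ` of a function `φ` on `M`, computed at `x` in the preferred holomorphic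
chart at `x`, through which `T_x M` is identified with `ℂⁿ`. -/
def ddbar (φ : M → ℝ) : TwoForm n M := fun x =>
  ddbarModel (φ ∘ (chartAt (Fin n → ℂ) x).symm) (chartAt (Fin n → ℂ) x x)

/-- `w_φ = w + √-1 ∂∂̄ φ`. -/
def deform (w : TwoForm n M) (φ : M → ℝ) : TwoForm n M := fun x => w x + ddbar φ x

/-- The space of Kähler potentials `H_w`. -/
def KahlerPotentials (w : TwoForm n M) : Set (M → ℝ) :=
  {φ | ContMDiff 𝓘(ℝ, Fin n → ℂ) 𝓘(ℝ, ℝ) ∞ φ ∧ IsPositive (deform w φ)}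

/-- Smooth paths `γ t`, `0 ≤ t ≤ 1`, in `H_w` from `0` to `φ`. -/
structure IsPotentialPath (w : TwoForm n M) (φ : M → ℝ) (γ : ℝ → M → ℝ) : Prop where
  smooth : ContMDiff (𝓘(ℝ, ℝ).prod 𝓘(ℝ, Fin n → ℂ)) 𝓘(ℝ, ℝ) ∞ (fun p : ℝ × M => γ p.1 p.2)
  mem : ∀ t ∈ Icc (0 : ℝ) 1, γ t ∈ KahlerPotentials w
  zero : γ 0 = 0
  one : γ 1 = φ

variable [T2Space M] [CompactSpace M] [IsManifold 𝓘(ℂ, Fin n → ℂ) ∞ M]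

variable (n M) in
/-- A smooth partition of unity subordinate to the chart domains. -/
def partitionOfUnity : SmoothPartitionOfUnity M 𝓘(ℝ, Fin n → ℂ) M univ :=
  (SmoothPartitionOfUnity.exists_isSubordinate_chartAt_source 𝓘(ℝ, Fin n → ℂ) M).choose

variable (n M) in
theorem partitionOfUnity_isSubordinate :
    (partitionOfUnity n M).IsSubordinate (fun x => (chartAt (Fin n → ℂ) x).source) :=
  (SmoothPartitionOfUnity.exists_isSubordinate_chartAt_source 𝓘(ℝ, Fin n → ℂ) M).choose_spec

/-- The integral `∫_M T` of a top form over the (canonically oriented) compact complex manifold `M`: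
the sum over the charts `c` of the Lebesgue integrals of `ρ_c T` in the coordinates of `c`. Only
finitely many `ρ_c` are nonzero. -/
def formIntegral (T : TopForm n M) : ℝ :=
  ∑ᶠ c : M, ∫ z in (chartAt (Fin n → ℂ) c).target,
    partitionOfUnity n M c ((chartAt (Fin n → ℂ) c).symm z) *
      T ((chartAt (Fin n → ℂ) c).symm z) (fun p =>
        mfderiv 𝓘(ℝ, Fin n → ℂ) 𝓘(ℝ, Fin n → ℂ) (chartAt (Fin n → ℂ) c).symm z (stdFrame n p))

/-- `c_k = [χ]^k·[w]^(n-k) / [w]^n`. -/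
def cConst (w χ : TwoForm n M) (k : ℕ) : ℝ :=
  formIntegral (wedgePow k χ w) / formIntegral (wedgePow n w w)

/-- The variation of the functional `J_{χ^k}` at `ψ` in the direction `f`:
`∫_M f (χ^k ∧ w_ψ^(n-k) - c_k w_ψ^n)`. -/
def jVariation (w χ : TwoForm n M) (k : ℕ) (ψ f : M → ℝ) : ℝ :=
  formIntegral (fun x => f x • (wedgePow k χ (deform w ψ) x -
    cConst w χ k • wedgePow n (deform w ψ) (deform w ψ) x))

/-- The value at `γ 1` of the functional `J_{χ^k}` normalized by `J_{χ^k}(0) = 0`, obtained by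
integrating `d/dt J_{χ^k}(γ t) = ∫_M (dγ/dt) (χ^k ∧ w_{γ t}^(n-k) - c_k w_{γ t}^n)` along a path
`γ` in `H_w` that starts at `0`. -/
def jAlong (w χ : TwoForm n M) (k : ℕ) (γ : ℝ → M → ℝ) : ℝ :=
  ∫ t in (0 : ℝ)..1, jVariation w χ k (γ t) (fun x => deriv (fun s => γ s x) t)

/-- `J(φ) = ∫_M φ (w^n - w_φ^n)`. -/
def jFunctional (w : TwoForm n M) (φ : M → ℝ) : ℝ :=
  formIntegral (fun x => φ x • (wedgePow n w w x - wedgePow n (deform w φ) (deform w φ) x))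

end Manifold

end

end KahlerJ

open Set MeasureTheory
open scoped Manifold ContDiff Topology

namespace KahlerJ

noncomputable section

/-! ### Algebra of wedge products of `n` two-forms on `ℂⁿ` -/

section Wedge

variable {n : ℕ}

/-! Put a_i = ∫ φ ω₀^i ∧ ω_φ^(n-i) for 0 ≤ i ≤ n (`mixedIntegral`). The theorem reduces to two facts
about these n+1 numbers.

They compute the functionals. Along a path γ from 0 to φ let a_i now be taken at γ_t, and let b_i =
∫ γ' ω₀^i ∧ ω_γ^(n-i). The Leibniz rule, the symmetry of f, g ↦ ∫ f √-1∂∂̄g ∧ Θ for Θ a product of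
closed (1,1)-forms, and √-1∂∂̄γ = ω_γ - ω₀ give a_i' = (n+1-i) b_i - (n-i) b_{i+1}
(`SmoothFamily.hasDerivAt_mixedIntegral`). Summed over i = k, …, n this telescopes to (n+1-k) b_k,
so the time integral of b_k is the average of a_k, …, a_n at φ. Since c_k = 1, the value of J_{ω₀^k}
is avg(a_k, …, a_n) - avg(a_0, …, a_n), whatever the path (`jAlong_eq`).

They increase with i (`mixedIntegral_mono`): a_i - a_{i+1} = ∫ φ √-1∂∂̄φ ∧ ω₀^i ∧ ω_φ^(n-i-1), which
after integration by parts is minus the integral of ½ dφ ∧ dᶜφ ∧ ω₀^i ∧ ω_φ^(n-i-1), a nonnegative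
top form. Averages over shorter tails of an increasing sequence are larger, which is the chain of
inequalities. For its last member, J = a_n - a_0, and avg(a_1, …, a_n) - avg(a_0, …, a_n) is the sum
of the a_i - a_0 divided by n(n+1).

The inputs are Stokes' theorem (`formIntegral_wedge_halfDDc`), obtained by expanding wedges as
signed sums over permutations in one chart and then using a partition of unity; the positivity
`wedge_stdFrame_nonneg`, where semipositive (1,1)-forms are split into rank-one forms whose wedge is
a squared modulus of a complex determinant; and differentiation under the integral sign
(`hasDerivAt_formIntegral`). -/

theorem wedge_apply (Ω : Fin n → (Fin n → ℂ) [⋀^Fin 2]→L[ℝ] ℝ) (v : Fin n × Fin 2 → Fin n → ℂ) :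
    wedge Ω v = ((2 : ℝ) ^ n)⁻¹ * ∑ σ : Equiv.Perm (Fin n × Fin 2),
      ((Equiv.Perm.sign σ : ℤ) : ℝ) * ∏ i, Ω i (fun j => v (σ (i, j))) := by
  simp only [wedge, AlternatingMap.smul_apply, MultilinearMap.alternatization_apply, smul_eq_mul]
  congr 1
  refine Finset.sum_congr rfl fun σ _ => ?_
  rw [Units.smul_def, zsmul_eq_mul]
  rfl

/-- The wedge product as a multilinear map of its factors. -/
def wedgeMultilinear (n : ℕ) : MultilinearMap ℝ
    (fun _ : Fin n => (Fin n → ℂ) [⋀^Fin 2]→L[ℝ] ℝ)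
    ((Fin n → ℂ) [⋀^(Fin n × Fin 2)]→ₗ[ℝ] ℝ) :=
  MultilinearMap.mk' wedge
    (by
      intro Ω i x y
      ext v
      rw [AlternatingMap.add_apply, wedge_apply, wedge_apply, wedge_apply, ← mul_add,
        ← Finset.sum_add_distrib]
      congr 1
      refine Finset.sum_congr rfl fun σ _ => ?_
      rw [← mul_add]
      congr 1
      simp only [← Finset.mul_prod_erase Finset.univ _ (Finset.mem_univ i), Function.update_self,
        ContinuousAlternatingMap.add_apply, add_mul]
      congr 2 <;>
      · refine Finset.prod_congr rfl fun k hk => ?_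
        simp [Function.update_of_ne (Finset.ne_of_mem_erase hk)])
    (by
      intro Ω i c x
      ext v
      rw [AlternatingMap.smul_apply, wedge_apply, wedge_apply, smul_eq_mul, mul_left_comm]
      congr 1
      rw [Finset.mul_sum]
      refine Finset.sum_congr rfl fun σ _ => ?_
      rw [mul_left_comm]
      congr 1
      simp only [← Finset.mul_prod_erase Finset.univ _ (Finset.mem_univ i), Function.update_self,
        ContinuousAlternatingMap.smul_apply, smul_eq_mul, mul_assoc]
      congr 2
      refine Finset.prod_congr rfl fun k hk => ?_
      simp [Function.update_of_ne (Finset.ne_of_mem_erase hk)])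

theorem wedgeMultilinear_apply (Ω : Fin n → (Fin n → ℂ) [⋀^Fin 2]→L[ℝ] ℝ) :
    wedgeMultilinear n Ω = wedge Ω := rfl

theorem wedge_update_add (Ω : Fin n → (Fin n → ℂ) [⋀^Fin 2]→L[ℝ] ℝ) (i : Fin n)
    (x y : (Fin n → ℂ) [⋀^Fin 2]→L[ℝ] ℝ) :
    wedge (Function.update Ω i (x + y)) =
      wedge (Function.update Ω i x) + wedge (Function.update Ω i y) :=
  (wedgeMultilinear n).map_update_add Ω i x y

theorem wedge_update_smul (Ω : Fin n → (Fin n → ℂ) [⋀^Fin 2]→L[ℝ] ℝ) (i : Fin n) (c : ℝ)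
    (x : (Fin n → ℂ) [⋀^Fin 2]→L[ℝ] ℝ) :
    wedge (Function.update Ω i (c • x)) = c • wedge (Function.update Ω i x) :=
  (wedgeMultilinear n).map_update_smul Ω i c x

theorem wedge_update_sub (Ω : Fin n → (Fin n → ℂ) [⋀^Fin 2]→L[ℝ] ℝ) (i : Fin n)
    (x y : (Fin n → ℂ) [⋀^Fin 2]→L[ℝ] ℝ) :
    wedge (Function.update Ω i (x - y)) =
      wedge (Function.update Ω i x) - wedge (Function.update Ω i y) :=
  (wedgeMultilinear n).map_update_sub Ω i x y

/-- Two-forms commute: permuting the factors permutes the arguments by two copies of `τ`, whose sign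
is a square. -/
theorem wedge_comp_perm (Ω : Fin n → (Fin n → ℂ) [⋀^Fin 2]→L[ℝ] ℝ) (τ : Equiv.Perm (Fin n)) :
    wedge (Ω ∘ τ) = wedge Ω := by
  ext v
  rw [wedge_apply, wedge_apply]
  congr 1
  let T : Equiv.Perm (Fin n × Fin 2) := Equiv.prodCongrLeft fun _ : Fin 2 => τ
  have hT : Equiv.Perm.sign T = 1 := by
    rw [Equiv.Perm.sign_prodCongrLeft]
    simp
  refine Fintype.sum_equiv (Equiv.mulRight T⁻¹) _ _ fun σ => ?_
  have hs : Equiv.Perm.sign (Equiv.mulRight T⁻¹ σ) = Equiv.Perm.sign σ := by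
    simp [hT]
  rw [hs]
  congr 1
  refine Fintype.prod_equiv τ _ _ fun i => ?_
  have : ∀ j, T⁻¹ (τ i, j) = (i, j) := fun j => by
    rw [Equiv.Perm.inv_eq_iff_eq]; rfl
  simp only [Function.comp_apply, Equiv.coe_mulRight, Equiv.Perm.mul_apply, this]

theorem wedge_compContinuousLinearMap (Ω : Fin n → (Fin n → ℂ) [⋀^Fin 2]→L[ℝ] ℝ)
    (A : (Fin n → ℂ) →L[ℝ] (Fin n → ℂ)) (v : Fin n × Fin 2 → Fin n → ℂ) :
    wedge (fun i => (Ω i).compContinuousLinearMap A) v = wedge Ω (fun p => A (v p)) := by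
  rw [wedge_apply, wedge_apply]
  rfl

/-- The frame `stdFrame n` as a basis. -/
def stdBasis (n : ℕ) : Module.Basis (Fin n × Fin 2) ℝ (Fin n → ℂ) :=
  (Pi.basis fun _ : Fin n => Complex.basisOneI).reindex (Equiv.sigmaEquivProd _ _)

/-- Alternating forms of top degree are multiples of the determinant in a basis, and that
determinant is multiplicative. -/
theorem topForm_comp (T : (Fin n → ℂ) [⋀^(Fin n × Fin 2)]→ₗ[ℝ] ℝ)
    (A : (Fin n → ℂ) →ₗ[ℝ] (Fin n → ℂ)) (v : Fin n × Fin 2 → Fin n → ℂ) :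
    T (fun p => A (v p)) = LinearMap.det A * T v := by
  rw [T.eq_smul_basis_det (stdBasis n)]
  simp only [AlternatingMap.smul_apply, smul_eq_mul]
  have := (stdBasis n).det_comp A v
  rw [show (fun p => A (v p)) = A ∘ v from rfl, this]
  ring

/-- The real determinant is the norm from `ℂ` to `ℝ` of the complex one. Its nonnegativity is behind
both the positivity of wedges of rank-one forms and the orientation of holomorphic coordinate
changes. -/
theorem det_restrictScalars_eq_normSq (A : (Fin n → ℂ) →ₗ[ℂ] (Fin n → ℂ)) :
    LinearMap.det (A.restrictScalars ℝ) = Complex.normSq (LinearMap.det A) := by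
  rw [LinearMap.det_restrictScalars, Algebra.norm_complex_apply]

theorem det_cplxJ (n : ℕ) :
    LinearMap.det ((cplxJ n : (Fin n → ℂ) →L[ℝ] (Fin n → ℂ)) : (Fin n → ℂ) →ₗ[ℝ] (Fin n → ℂ)) = 1 := by
  have : ((cplxJ n : (Fin n → ℂ) →L[ℝ] (Fin n → ℂ)) : (Fin n → ℂ) →ₗ[ℝ] (Fin n → ℂ)) =
      (Complex.I • LinearMap.id : (Fin n → ℂ) →ₗ[ℂ] (Fin n → ℂ)).restrictScalars ℝ := rfl
  rw [this, det_restrictScalars_eq_normSq]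
  simp

theorem cplxJ_apply (v : Fin n → ℂ) : cplxJ n v = Complex.I • v := rfl

/-- Pulling back by `i` acts on top forms through det J = 1. This is used to exchange df ∧ dᶜg and
dg ∧ dᶜf under the integral. -/
theorem wedge_comp_cplxJ (Ω : Fin n → (Fin n → ℂ) [⋀^Fin 2]→L[ℝ] ℝ) :
    wedge (fun i => (Ω i).compContinuousLinearMap (cplxJ n)) = wedge Ω := by
  ext v
  rw [wedge_compContinuousLinearMap]
  have := topForm_comp (wedge Ω) (cplxJ n : (Fin n → ℂ) →ₗ[ℝ] (Fin n → ℂ)) v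
  rw [det_cplxJ, one_mul] at this
  exact this

end Wedge

/-! ### Positivity of wedge products of (1,1)-forms -/

section Positivity

variable {n : ℕ}

/-- The standard area form `dx ∧ dy` on `ℂ`. -/
def areaForm : ℂ [⋀^Fin 2]→L[ℝ] ℝ where
  toMultilinearMap := MultilinearMap.mk' (fun v => (v 0).re * (v 1).im - (v 0).im * (v 1).re)
    (by intro m i x y; fin_cases i <;> simp [Function.update] <;> ring)
    (by intro m i c x; fin_cases i <;> simp [Function.update] <;> ring)
  cont := by
    change Continuous fun v : Fin 2 → ℂ => (v 0).re * (v 1).im - (v 0).im * (v 1).re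
    have h0 : Continuous fun v : Fin 2 → ℂ => v 0 := continuous_apply 0
    have h1 : Continuous fun v : Fin 2 → ℂ => v 1 := continuous_apply 1
    exact ((Complex.continuous_re.comp h0).mul (Complex.continuous_im.comp h1)).sub
      ((Complex.continuous_im.comp h0).mul (Complex.continuous_re.comp h1))
  map_eq_zero_of_eq' := by
    intro v i j h hij
    change (v 0).re * (v 1).im - (v 0).im * (v 1).re = 0
    have : v 0 = v 1 := by
      fin_cases i <;> fin_cases j <;> simp_all
    rw [this]; ring

theorem areaForm_apply (v : Fin 2 → ℂ) :
    areaForm v = (v 0).re * (v 1).im - (v 0).im * (v 1).re := rfl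

/-- The semipositive two-form `(√-1 / 2) ξ ∧ ξ̄` of a complex covector `ξ`. -/
def rankOneForm (ξ : (Fin n → ℂ) →L[ℂ] ℂ) : (Fin n → ℂ) [⋀^Fin 2]→L[ℝ] ℝ :=
  areaForm.compContinuousLinearMap (ξ.restrictScalars ℝ)

theorem rankOneForm_apply (ξ : (Fin n → ℂ) →L[ℂ] ℂ) (v : Fin 2 → Fin n → ℂ) :
    rankOneForm ξ v = (ξ (v 0)).re * (ξ (v 1)).im - (ξ (v 0)).im * (ξ (v 1)).re := rfl

/-- Up to a positive factor this is the value of dx₁ ∧ dy₁ ∧ ⋯ ∧ dxₙ ∧ dyₙ on its dual frame. No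
term of the permutation sum is negative, and the identity contributes a positive one. -/
theorem wedge_proj_stdFrame_pos :
    0 < wedge (fun i : Fin n => rankOneForm (ContinuousLinearMap.proj i)) (stdFrame n) := by
  rw [wedge_apply]
  have key : ∀ (i : Fin n) (p q : Fin n × Fin 2),
      rankOneForm (ContinuousLinearMap.proj i) ![stdFrame n p, stdFrame n q] =
        if p.1 = i ∧ q.1 = i then (if p.2 = 0 then 1 else 0) * (if q.2 = 0 then 0 else 1) -
          (if p.2 = 0 then 0 else 1) * (if q.2 = 0 then 1 else 0) else 0 := by
    intro i p q
    simp only [rankOneForm_apply, stdFrame, Matrix.cons_val_zero, Matrix.cons_val_one,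
      ContinuousLinearMap.proj_apply, Pi.single_apply]
    by_cases hp : i = p.1 <;> by_cases hq : i = q.1 <;>
      by_cases hp2 : p.2 = 0 <;> by_cases hq2 : q.2 = 0 <;>
      simp [hp, hq, hp2, hq2, eq_comm] <;> simp_all [eq_comm]
  have hterm : ∀ σ : Equiv.Perm (Fin n × Fin 2), 0 ≤ ((Equiv.Perm.sign σ : ℤ) : ℝ) *
      ∏ i, rankOneForm (ContinuousLinearMap.proj i) (fun j => stdFrame n (σ (i, j))) := by
    intro σ
    have hv : ∀ i : Fin n, (fun j => stdFrame n (σ (i, j))) =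
        ![stdFrame n (σ (i, 0)), stdFrame n (σ (i, 1))] := fun i => by
      funext j; fin_cases j <;> rfl
    simp only [hv, key]
    -- A term survives only if `σ` preserves every pair {(i, 0), (i, 1)}; then `σ` is a product of
    -- permutations `τ i` of `Fin 2`, and both its sign and the product of forms factor over `i`.
    by_cases h : ∀ i, (σ (i, 0)).1 = i ∧ (σ (i, 1)).1 = i
    · have hfst : ∀ p, (σ p).1 = p.1 := by
        rintro ⟨i, j⟩
        fin_cases j
        · exact (h i).1
        · exact (h i).2
      have hinv : ∀ p, (σ.symm p).1 = p.1 := fun p => by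
        have := hfst (σ.symm p); simpa using this.symm
      let τ : Fin n → Equiv.Perm (Fin 2) := fun i =>
        { toFun := fun j => (σ (i, j)).2
          invFun := fun j => (σ.symm (i, j)).2
          left_inv := fun j => by
            have : (i, (σ (i, j)).2) = σ (i, j) := Prod.ext (hfst (i, j)).symm rfl
            simp [this]
          right_inv := fun j => by
            have : (i, (σ.symm (i, j)).2) = σ.symm (i, j) := Prod.ext (hinv (i, j)).symm rfl
            simp [this] }
      have hσ : σ = Equiv.prodCongrRight τ := by
        ext1 p
        exact Prod.ext (hfst p) rfl
      have hs : Equiv.Perm.sign σ = ∏ i, Equiv.Perm.sign (τ i) := by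
        rw [hσ, Equiv.Perm.sign_prodCongrRight]
      rw [hs]
      push_cast
      rw [← Finset.prod_mul_distrib]
      refine Finset.prod_nonneg fun i _ => ?_
      rw [if_pos (h i)]
      change 0 ≤ ((Equiv.Perm.sign (τ i) : ℤ) : ℝ) *
        ((if τ i 0 = 0 then 1 else 0) * (if τ i 1 = 0 then 0 else 1) -
          (if τ i 0 = 0 then 0 else 1) * (if τ i 1 = 0 then 1 else 0))
      generalize τ i = ρ
      -- The identity contributes 1 · 1 and the swap (-1) · (-1).
      have : ρ = 1 ∨ ρ = Equiv.swap 0 1 := by revert ρ; decide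
      rcases this with rfl | rfl <;> simp
    · push Not at h
      obtain ⟨i, hi⟩ := h
      rw [Finset.prod_eq_zero (Finset.mem_univ i), mul_zero]
      rw [if_neg]
      rintro ⟨h0, h1⟩
      exact hi h0 h1
  refine mul_pos (by positivity) (Finset.sum_pos' (fun σ _ => hterm σ) ⟨1, Finset.mem_univ _, ?_⟩)
  have hv : ∀ i : Fin n, (fun j => stdFrame n (i, j)) =
      ![stdFrame n (i, 0), stdFrame n (i, 1)] := fun i => by
    funext j; fin_cases j <;> rfl
  simp [hv, key]

/-- The forms of the `ξ i` are the pullbacks of the coordinate ones under the single complex linear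
map with components `ξ i`. -/
theorem wedge_rankOneForm_stdFrame (ξ : Fin n → (Fin n → ℂ) →L[ℂ] ℂ) :
    wedge (fun i => rankOneForm (ξ i)) (stdFrame n) =
      Complex.normSq (LinearMap.det (ContinuousLinearMap.pi ξ : (Fin n → ℂ) →ₗ[ℂ] (Fin n → ℂ))) *
        wedge (fun i : Fin n => rankOneForm (ContinuousLinearMap.proj i)) (stdFrame n) := by
  rw [← det_restrictScalars_eq_normSq, ← topForm_comp]
  exact wedge_compContinuousLinearMap
    (fun i : Fin n => rankOneForm (ContinuousLinearMap.proj i))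
    ((ContinuousLinearMap.pi ξ).restrictScalars ℝ) (stdFrame n)

/-- Real two-forms of type `(1,1)`. -/
def IsTypeOneOne (θ : (Fin n → ℂ) [⋀^Fin 2]→L[ℝ] ℝ) : Prop :=
  ∀ u v : Fin n → ℂ, θ ![cplxJ n u, cplxJ n v] = θ ![u, v]

theorem twoForm_swap {V : Type*} [AddCommGroup V] [TopologicalSpace V] [Module ℝ V]
    (θ : V [⋀^Fin 2]→L[ℝ] ℝ) (u v : V) : θ ![u, v] = -θ ![v, u] := by
  have := θ.map_swap ![v, u] (i := 0) (j := 1) (by decide)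
  refine Eq.trans (congrArg θ ?_) this
  funext j; fin_cases j <;> rfl

theorem twoForm_add_left {V : Type*} [AddCommGroup V] [TopologicalSpace V] [Module ℝ V]
    (θ : V [⋀^Fin 2]→L[ℝ] ℝ) (u u' v : V) : θ ![u + u', v] = θ ![u, v] + θ ![u', v] := by
  have h : ∀ x : V, Function.update ![u, v] 0 x = ![x, v] := fun x => by
    funext j; fin_cases j <;> rfl
  simpa only [h] using θ.map_update_add ![u, v] 0 u u'

theorem twoForm_smul_left {V : Type*} [AddCommGroup V] [TopologicalSpace V] [Module ℝ V]
    (θ : V [⋀^Fin 2]→L[ℝ] ℝ) (c : ℝ) (u v : V) : θ ![c • u, v] = c * θ ![u, v] := by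
  have h : ∀ x : V, Function.update ![u, v] 0 x = ![x, v] := fun x => by
    funext j; fin_cases j <;> rfl
  simpa only [h, smul_eq_mul] using θ.map_update_smul ![u, v] 0 c u

theorem twoForm_add_right {V : Type*} [AddCommGroup V] [TopologicalSpace V] [Module ℝ V]
    (θ : V [⋀^Fin 2]→L[ℝ] ℝ) (u v v' : V) : θ ![u, v + v'] = θ ![u, v] + θ ![u, v'] := by
  rw [twoForm_swap, twoForm_add_left, twoForm_swap θ u v, twoForm_swap θ u v']; ring

theorem twoForm_smul_right {V : Type*} [AddCommGroup V] [TopologicalSpace V] [Module ℝ V]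
    (θ : V [⋀^Fin 2]→L[ℝ] ℝ) (c : ℝ) (u v : V) : θ ![u, c • v] = c * θ ![u, v] := by
  rw [twoForm_swap, twoForm_smul_left, twoForm_swap θ u v]; ring

theorem cplxJ_cplxJ (v : Fin n → ℂ) : cplxJ n (cplxJ n v) = (-1 : ℝ) • v := by
  ext i
  simp [cplxJ_apply, ← mul_assoc]

theorem complex_smul_eq (c : ℂ) (v : Fin n → ℂ) : c • v = c.re • v + c.im • cplxJ n v := by
  ext i
  simp only [cplxJ_apply, Pi.smul_apply, Pi.add_apply, smul_eq_mul, Complex.real_smul]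
  conv_lhs => rw [← Complex.re_add_im c]
  ring

theorem IsTypeOneOne.apply_cplxJ_left {θ : (Fin n → ℂ) [⋀^Fin 2]→L[ℝ] ℝ} (h : IsTypeOneOne θ)
    (u v : Fin n → ℂ) : θ ![cplxJ n u, v] = -θ ![u, cplxJ n v] := by
  rw [← h (cplxJ n u) v, cplxJ_cplxJ, twoForm_smul_left]; ring

/-- The sesquilinear form whose imaginary part is a given two-form of type `(1,1)`. -/
def hermitianForm (θ : (Fin n → ℂ) [⋀^Fin 2]→L[ℝ] ℝ) (h : IsTypeOneOne θ) :
    (Fin n → ℂ) →ₗ⋆[ℂ] (Fin n → ℂ) →ₗ[ℂ] ℂ :=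
  LinearMap.mk₂'ₛₗ (starRingEnd ℂ) (RingHom.id ℂ)
    (fun u v => ⟨θ ![u, cplxJ n v], θ ![u, v]⟩)
    (fun u u' v => by apply Complex.ext <;> simp [twoForm_add_left])
    (fun c u v => by
      rw [complex_smul_eq c u]
      apply Complex.ext <;> simp only [twoForm_add_left, twoForm_smul_left,
        h.apply_cplxJ_left, cplxJ_cplxJ, twoForm_smul_right] <;> simp)
    (fun u v v' => by apply Complex.ext <;> simp [twoForm_add_right])
    (fun c u v => by
      rw [complex_smul_eq c v]
      apply Complex.ext <;> simp only [map_add, map_smul, cplxJ_cplxJ, twoForm_add_right,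
        twoForm_smul_right] <;> simp <;> ring)

theorem hermitianForm_apply (θ : (Fin n → ℂ) [⋀^Fin 2]→L[ℝ] ℝ) (h : IsTypeOneOne θ)
    (u v : Fin n → ℂ) : hermitianForm θ h u v = ⟨θ ![u, cplxJ n v], θ ![u, v]⟩ := rfl

open Matrix ComplexOrder MatrixOrder Matrix.Norms.L2Operator in
-- The Hermitian form with imaginary part `θ` has a positive semidefinite matrix `A`. Factoring `A =
-- Bᴴ * B` makes it a sum of squared moduli of the rows of `B`, which serve as the covectors `ξ`.
theorem IsTypeOneOne.exists_eq_sum_rankOneForm {θ : (Fin n → ℂ) [⋀^Fin 2]→L[ℝ] ℝ}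
    (h : IsTypeOneOne θ) (hpos : ∀ v, 0 ≤ θ ![v, cplxJ n v]) :
    ∃ ξ : Fin n → (Fin n → ℂ) →L[ℂ] ℂ, θ = ∑ k, rankOneForm (ξ k) := by
  let H := hermitianForm θ h
  let A : Matrix (Fin n) (Fin n) ℂ := Matrix.of fun a b => H (Pi.single a 1) (Pi.single b 1)
  have hA : ∀ u v, H u v = star u ⬝ᵥ (A *ᵥ v) := by
    intro u v
    conv_lhs => rw [pi_eq_sum_univ' u, pi_eq_sum_univ' v]
    simp only [map_sum, LinearMap.sum_apply, map_smulₛₗ, LinearMap.smul_apply, dotProduct, mulVec,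
      RingHom.id_apply, smul_eq_mul, Finset.mul_sum, Pi.star_apply]
    rw [Finset.sum_comm]
    refine Finset.sum_congr rfl fun a _ => Finset.sum_congr rfl fun b _ => ?_
    simp only [A, starRingEnd_apply, of_apply]
    ring
  have hskew : ∀ u, θ ![u, u] = 0 := fun u => by
    have := twoForm_swap θ u u; linarith
  have hposA : A.PosSemidef := by
    refine PosSemidef.of_dotProduct_mulVec_nonneg ?_ fun x => ?_
    · ext a b
      have hab : ∀ a b, A a b = ⟨θ ![Pi.single a 1, cplxJ n (Pi.single b 1)],
        θ ![Pi.single a 1, Pi.single b 1]⟩ := fun a b => rfl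
      rw [conjTranspose_apply, hab, hab]
      apply Complex.ext
      · simp only [Complex.star_def, Complex.conj_re]
        rw [twoForm_swap, h.apply_cplxJ_left, neg_neg]
      · simp only [Complex.star_def, Complex.conj_im]
        rw [twoForm_swap, neg_neg]
    · rw [← hA, hermitianForm_apply, Complex.nonneg_iff]
      exact ⟨hpos x, (hskew x).symm⟩
  obtain ⟨B, hB⟩ : ∃ B : Matrix (Fin n) (Fin n) ℂ, A = Bᴴ * B :=
    CStarAlgebra.nonneg_iff_eq_star_mul_self.mp hposA.nonneg
  refine ⟨fun k => LinearMap.toContinuousLinearMap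
    ((LinearMap.proj k).comp (Matrix.mulVecLin B)), ?_⟩
  ext v
  have hv : v = ![v 0, v 1] := by funext j; fin_cases j <;> rfl
  have h1 : θ v = (H (v 0) (v 1)).im := by
    conv_lhs => rw [hv]
    rfl
  rw [h1, hA, hB, ← mulVec_mulVec, dotProduct_mulVec, vecMul_conjTranspose, star_star,
    ContinuousAlternatingMap.sum_apply, dotProduct, Complex.im_sum]
  refine Finset.sum_congr rfl fun k _ => ?_
  rw [rankOneForm_apply]
  simp [Complex.mul_im]
  ring

theorem alternatingMap_sum_apply {ι κ V : Type*} [AddCommGroup V] [Module ℝ V] (s : Finset κ)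
    (T : κ → V [⋀^ι]→ₗ[ℝ] ℝ) (v : ι → V) : (∑ k ∈ s, T k) v = ∑ k ∈ s, T k v :=
  map_sum (AddMonoidHom.mk' (fun S : V [⋀^ι]→ₗ[ℝ] ℝ => S v) fun _ _ => rfl) T s

/-- Each factor is a sum of rank-one forms; by multilinearity the wedge is a sum of squared moduli
of determinants times a positive constant. -/
theorem wedge_stdFrame_nonneg {Ω : Fin n → (Fin n → ℂ) [⋀^Fin 2]→L[ℝ] ℝ}
    (h : ∀ i, IsTypeOneOne (Ω i)) (hpos : ∀ i v, 0 ≤ Ω i ![v, cplxJ n v]) :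
    0 ≤ wedge Ω (stdFrame n) := by
  choose ξ hξ using fun i => (h i).exists_eq_sum_rankOneForm (hpos i)
  have hΩ : Ω = fun i => ∑ k, rankOneForm (ξ i k) := funext hξ
  rw [hΩ, ← wedgeMultilinear_apply, MultilinearMap.map_sum, alternatingMap_sum_apply]
  refine Finset.sum_nonneg fun r _ => ?_
  rw [wedgeMultilinear_apply, wedge_rankOneForm_stdFrame]
  exact mul_nonneg (Complex.normSq_nonneg _) wedge_proj_stdFrame_pos.le

theorem wedge_const_stdFrame_pos {θ : (Fin n → ℂ) [⋀^Fin 2]→L[ℝ] ℝ}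
    (h : IsTypeOneOne θ) (hpos : ∀ v ≠ 0, 0 < θ ![v, cplxJ n v]) :
    0 < wedge (fun _ : Fin n => θ) (stdFrame n) := by
  obtain ⟨ξ, hξ⟩ := h.exists_eq_sum_rankOneForm fun v => by
    by_cases hv : v = 0
    · subst hv
      have := twoForm_smul_left θ 0 0 (cplxJ n 0)
      rw [zero_smul, zero_mul] at this
      exact this.ge
    · exact (hpos v hv).le
  rw [show (fun _ : Fin n => θ) = fun _ => ∑ k, rankOneForm (ξ k) from funext fun _ => hξ,
    ← wedgeMultilinear_apply, MultilinearMap.map_sum, alternatingMap_sum_apply]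
  -- The positive term is the one that uses each covector `ξ k` exactly once: if its determinant
  -- vanished, a nonzero `v` killed by every `ξ k` would give `θ ![v, cplxJ n v] = 0`.
  refine Finset.sum_pos' (fun r _ => ?_) ⟨fun i => i, Finset.mem_univ _, ?_⟩
  · rw [wedgeMultilinear_apply, wedge_rankOneForm_stdFrame]
    exact mul_nonneg (Complex.normSq_nonneg _) wedge_proj_stdFrame_pos.le
  · rw [wedgeMultilinear_apply, wedge_rankOneForm_stdFrame]
    refine mul_pos (Complex.normSq_pos.2 fun h0 => ?_) wedge_proj_stdFrame_pos
    obtain ⟨v, hv, hv0⟩ := Submodule.exists_mem_ne_zero_of_ne_bot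
      (LinearMap.bot_lt_ker_of_det_eq_zero h0).ne'
    have hk : ∀ k, ξ k v = 0 := fun k => congrFun (LinearMap.mem_ker.1 hv) k
    have := hpos v hv0
    rw [hξ, ContinuousAlternatingMap.sum_apply] at this
    simp [rankOneForm_apply, hk] at this

end Positivity

/-! ### Signed sums over permutations -/

section PermSums

variable {n : ℕ}

theorem sum_sign_mul_swap {ι : Type*} [Fintype ι] [DecidableEq ι] {a b : ι} (hab : a ≠ b)
    (F : Equiv.Perm ι → ℝ) :
    ∑ σ : Equiv.Perm ι, ((Equiv.Perm.sign σ : ℤ) : ℝ) * F (σ * Equiv.swap a b) =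
      -∑ σ : Equiv.Perm ι, ((Equiv.Perm.sign σ : ℤ) : ℝ) * F σ := by
  rw [← Finset.sum_neg_distrib]
  refine Fintype.sum_equiv (Equiv.mulRight (Equiv.swap a b)) _ _ fun σ => ?_
  simp [Equiv.Perm.sign_swap hab]

theorem sum_sign_mul_even {ι : Type*} [Fintype ι] [DecidableEq ι] {c : Equiv.Perm ι}
    (hc : Equiv.Perm.sign c = 1) (F : Equiv.Perm ι → ℝ) :
    ∑ σ : Equiv.Perm ι, ((Equiv.Perm.sign σ : ℤ) : ℝ) * F (σ * c) =
      ∑ σ : Equiv.Perm ι, ((Equiv.Perm.sign σ : ℤ) : ℝ) * F σ := by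
  refine Fintype.sum_equiv (Equiv.mulRight c) _ _ fun σ => ?_
  simp [hc]

/-- Exchanging the two slots of the factor `j` is a transposition, so both halves of the
antisymmetrized factor contribute equally. It lets dη be replaced by twice the unsymmetrized
derivative of η. -/
theorem sum_sign_antisymmetrize (v : Fin n × Fin 2 → Fin n → ℂ) (j : Fin n)
    (L : (Fin n → ℂ) → (Fin n → ℂ) → ℝ) (R : Fin n → (Fin n → ℂ) → (Fin n → ℂ) → ℝ) :
    ∑ σ : Equiv.Perm (Fin n × Fin 2), ((Equiv.Perm.sign σ : ℤ) : ℝ) *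
      ((L (v (σ (j, 0))) (v (σ (j, 1))) - L (v (σ (j, 1))) (v (σ (j, 0)))) *
        ∏ i ∈ Finset.univ.erase j, R i (v (σ (i, 0))) (v (σ (i, 1)))) =
    2 * ∑ σ : Equiv.Perm (Fin n × Fin 2), ((Equiv.Perm.sign σ : ℤ) : ℝ) *
      (L (v (σ (j, 0))) (v (σ (j, 1))) *
        ∏ i ∈ Finset.univ.erase j, R i (v (σ (i, 0))) (v (σ (i, 1)))) := by
  have h := sum_sign_mul_swap (a := (j, (0 : Fin 2))) (b := (j, 1)) (by simp)
    (fun σ => L (v (σ (j, 0))) (v (σ (j, 1))) *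
        ∏ i ∈ Finset.univ.erase j, R i (v (σ (i, 0))) (v (σ (i, 1))))
  have h2 : ∀ σ : Equiv.Perm (Fin n × Fin 2),
      (∏ i ∈ Finset.univ.erase j, R i (v ((σ * Equiv.swap (j, 0) (j, 1) : Equiv.Perm (Fin n × Fin 2)) (i, 0)))
        (v ((σ * Equiv.swap (j, 0) (j, 1) : Equiv.Perm (Fin n × Fin 2)) (i, 1)))) =
      ∏ i ∈ Finset.univ.erase j, R i (v (σ (i, 0))) (v (σ (i, 1))) := fun σ => by
    refine Finset.prod_congr rfl fun i hi => ?_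
    have hij := Finset.ne_of_mem_erase hi
    rw [Equiv.Perm.mul_apply, Equiv.Perm.mul_apply, Equiv.swap_apply_of_ne_of_ne,
      Equiv.swap_apply_of_ne_of_ne] <;> simp [hij]
  simp only [h2] at h
  simp only [Equiv.Perm.mul_apply, Equiv.swap_apply_left, Equiv.swap_apply_right] at h
  simp only [sub_mul, mul_sub, Finset.sum_sub_distrib, h]
  ring

/-- Rotating the three arguments of `D` is an even permutation of the slots, so the three rotated
sums agree, while they add up to zero. In the application `D` is the derivative of the `k`-th
two-form, and `hD` says that this form is closed. -/
theorem sum_sign_cyclic_eq_zero (v : Fin n × Fin 2 → Fin n → ℂ) {j k : Fin n} (hjk : k ≠ j)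
    (D : (Fin n → ℂ) → (Fin n → ℂ) → (Fin n → ℂ) → ℝ)
    (hD : ∀ x y z, D x y z + D y z x + D z x y = 0) (η : (Fin n → ℂ) → ℝ)
    (R : Fin n → (Fin n → ℂ) → (Fin n → ℂ) → ℝ) :
    ∑ σ : Equiv.Perm (Fin n × Fin 2), ((Equiv.Perm.sign σ : ℤ) : ℝ) *
      (D (v (σ (j, 0))) (v (σ (k, 0))) (v (σ (k, 1))) * (η (v (σ (j, 1))) *
        ∏ i ∈ (Finset.univ.erase j).erase k, R i (v (σ (i, 0))) (v (σ (i, 1))))) = 0 := by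
  -- The 3-cycle (j, 0) → (k, 0) → (k, 1) → (j, 0); it fixes (j, 1), the slot of `η`, and all slots
  -- of the remaining factors.
  let c : Equiv.Perm (Fin n × Fin 2) := Equiv.swap (j, 0) (k, 0) * Equiv.swap (k, 0) (k, 1)
  have hjk' := hjk.symm
  have hc : Equiv.Perm.sign c = 1 := by
    rw [Equiv.Perm.sign_mul, Equiv.Perm.sign_swap (by simp [hjk']),
      Equiv.Perm.sign_swap (by simp)]
    rfl
  have c1 : c (j, 0) = (k, 0) := by
    simp only [c, Equiv.Perm.mul_apply]
    rw [Equiv.swap_apply_of_ne_of_ne (a := (k, 0)) (b := (k, 1)) (by simp [hjk'])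
      (by simp [hjk']), Equiv.swap_apply_left]
  have c2 : c (k, 0) = (k, 1) := by
    simp only [c, Equiv.Perm.mul_apply]
    rw [Equiv.swap_apply_left, Equiv.swap_apply_of_ne_of_ne (by simp [hjk]) (by simp)]
  have c3 : c (k, 1) = (j, 0) := by
    simp only [c, Equiv.Perm.mul_apply]
    rw [Equiv.swap_apply_right, Equiv.swap_apply_right]
  have c4 : c (j, 1) = (j, 1) := by
    simp only [c, Equiv.Perm.mul_apply]
    rw [Equiv.swap_apply_of_ne_of_ne (a := (k, 0)) (b := (k, 1)) (by simp [hjk']) (by simp [hjk']),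
      Equiv.swap_apply_of_ne_of_ne (by simp) (by simp [hjk'])]
  have c5 : ∀ i ≠ j, i ≠ k → ∀ a : Fin 2, c (i, a) = (i, a) := fun i hij hik a => by
    simp only [c, Equiv.Perm.mul_apply]
    rw [Equiv.swap_apply_of_ne_of_ne (a := (k, 0)) (b := (k, 1)) (by simp [hik]) (by simp [hik]),
      Equiv.swap_apply_of_ne_of_ne (by simp [hij]) (by simp [hik])]
  let P : Equiv.Perm (Fin n × Fin 2) → ℝ := fun σ => η (v (σ (j, 1))) *
        ∏ i ∈ (Finset.univ.erase j).erase k, R i (v (σ (i, 0))) (v (σ (i, 1)))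
  have hP : ∀ σ, P (σ * c) = P σ := fun σ => by
    simp only [P, Equiv.Perm.mul_apply, c4]
    congr 1
    refine Finset.prod_congr rfl fun i hi => ?_
    have hik := Finset.ne_of_mem_erase hi
    have hij := Finset.ne_of_mem_erase (Finset.mem_of_mem_erase hi)
    rw [c5 i hij hik, c5 i hij hik]
  have e1 := sum_sign_mul_even hc
    (fun σ => D (v (σ (j, 0))) (v (σ (k, 0))) (v (σ (k, 1))) * P σ)
  have e2 := sum_sign_mul_even hc
    (fun σ => D (v (σ (k, 0))) (v (σ (k, 1))) (v (σ (j, 0))) * P σ)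
  simp only [hP, Equiv.Perm.mul_apply, c1, c2, c3] at e1 e2
  have e3 : ∑ σ : Equiv.Perm (Fin n × Fin 2), ((Equiv.Perm.sign σ : ℤ) : ℝ) *
      ((D (v (σ (j, 0))) (v (σ (k, 0))) (v (σ (k, 1))) +
        D (v (σ (k, 0))) (v (σ (k, 1))) (v (σ (j, 0))) +
        D (v (σ (k, 1))) (v (σ (j, 0))) (v (σ (k, 0)))) * P σ) = 0 := by
    refine Finset.sum_eq_zero fun σ _ => ?_
    rw [hD]; ring
  simp only [add_mul, mul_add, Finset.sum_add_distrib] at e3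
  change ∑ σ : Equiv.Perm (Fin n × Fin 2), ((Equiv.Perm.sign σ : ℤ) : ℝ) *
      (D (v (σ (j, 0))) (v (σ (k, 0))) (v (σ (k, 1))) * P σ) = 0
  linarith

end PermSums

/-! ### Calculus on `ℂⁿ`: divergence integrals and exterior derivatives in coordinates -/

section ModelCalculus

variable {n : ℕ}

/-- `U` and the complement of `K` form an open cover; on the second set the extension by zero
vanishes. -/
theorem contDiff_indicator_of_eq_zero {V F : Type*} [NormedAddCommGroup V] [NormedSpace ℝ V]
    [NormedAddCommGroup F] [NormedSpace ℝ F] {U K : Set V} (hU : IsOpen U) (hK : IsClosed K)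
    (hKU : K ⊆ U) {m : WithTop ℕ∞} {h : V → F} (hh : ContDiffOn ℝ m h U)
    (h0 : ∀ z ∈ U, z ∉ K → h z = 0) :
    ContDiff ℝ m (U.indicator h) := by
  rw [contDiff_iff_contDiffAt]
  intro x
  by_cases hx : x ∈ U
  · refine (hh.contDiffAt (hU.mem_nhds hx)).congr_of_eventuallyEq ?_
    filter_upwards [hU.mem_nhds hx] with y hy
    exact indicator_of_mem hy h
  · refine contDiffAt_const (c := (0 : F)) |>.congr_of_eventuallyEq ?_
    filter_upwards [hK.isOpen_compl.mem_nhds fun hxK => hx (hKU hxK)] with y hy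
    by_cases hyU : y ∈ U
    · rw [indicator_of_mem hyU, h0 y hyU hy]
    · exact indicator_of_notMem hyU h

theorem setIntegral_fderiv_eq_zero {V : Type*} [NormedAddCommGroup V] [NormedSpace ℝ V]
    [FiniteDimensional ℝ V] [MeasurableSpace V] [BorelSpace V] (μ : Measure V)
    [μ.IsAddHaarMeasure] {U K : Set V} (hU : IsOpen U) (hK : IsCompact K) (hKU : K ⊆ U)
    {h : V → ℝ} (hh : ContDiffOn ℝ 1 h U) (h0 : ∀ z ∈ U, z ∉ K → h z = 0) (v : V) :
    Integrable (U.indicator fun z => fderiv ℝ h z v) μ ∧ ∫ z in U, fderiv ℝ h z v ∂μ = 0 := by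
  have hc := contDiff_indicator_of_eq_zero hU hK.isClosed hKU hh h0
  set g := U.indicator h with hg
  have hz : ∀ z, z ∉ K → g z = 0 := fun z hz => by
    by_cases hzU : z ∈ U
    · rw [hg, indicator_of_mem hzU, h0 z hzU hz]
    · exact indicator_of_notMem hzU h
  have hs : HasCompactSupport g := HasCompactSupport.intro hK hz
  have hd : U.indicator (fun z => fderiv ℝ h z v) = fun z => fderiv ℝ g z v := by
    funext z
    by_cases hzU : z ∈ U
    · rw [indicator_of_mem hzU]
      have : g =ᶠ[𝓝 z] h := by
        filter_upwards [hU.mem_nhds hzU] with y hy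
        exact indicator_of_mem hy h
      rw [this.fderiv_eq]
    · rw [indicator_of_notMem hzU]
      have : g =ᶠ[𝓝 z] fun _ => 0 := by
        filter_upwards [hK.isClosed.isOpen_compl.mem_nhds fun hzK => hzU (hKU hzK)] with y hy
        exact hz y hy
      rw [this.fderiv_eq]
      simp
  have hcont : Continuous fun z => fderiv ℝ g z v :=
    (hc.continuous_fderiv one_ne_zero).clm_apply continuous_const
  have hsd : HasCompactSupport fun z => fderiv ℝ g z v := hs.fderiv_apply ℝ v
  refine ⟨hd ▸ hcont.integrable_of_hasCompactSupport hsd, ?_⟩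
  rw [← integral_indicator hU.measurableSet, hd]
  have hgi : Integrable g μ := hc.continuous.integrable_of_hasCompactSupport hs
  -- Integration by parts against the constant function 1.
  have := integral_mul_fderiv_eq_neg_fderiv_mul_of_integrable (μ := μ) (𝕜 := ℝ)
    (f := fun _ : V => (1 : ℝ)) (g := g) (v := v) (by simp)
    (by simpa using hcont.integrable_of_hasCompactSupport hsd) (by simpa using hgi)
    (fun x _ => differentiableAt_const _) (fun x _ => hc.differentiable one_ne_zero x)
  simpa using this

/-- A covector field as a one-form. -/
def oneForm (η : (Fin n → ℂ) → (Fin n → ℂ) →L[ℝ] ℝ) (y : Fin n → ℂ) :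
    (Fin n → ℂ) [⋀^Fin 1]→L[ℝ] ℝ :=
  ContinuousAlternatingMap.ofSubsingleton ℝ (Fin n → ℂ) ℝ (0 : Fin 1) (η y)

theorem ofSubsingleton_isBoundedLinear {V : Type*} [NormedAddCommGroup V] [NormedSpace ℝ V] :
    IsBoundedLinearMap ℝ (fun a : V →L[ℝ] ℝ =>
      ContinuousAlternatingMap.ofSubsingleton ℝ V ℝ (0 : Fin 1) a) :=
  (ContinuousAlternatingMap.ofSubsingletonLIE (𝕜 := ℝ) (E := V) (F := ℝ) (0 : Fin 1)).toContinuousLinearEquiv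
    |>.toContinuousLinearMap.isBoundedLinearMap

theorem extDeriv_oneForm_apply {η : (Fin n → ℂ) → (Fin n → ℂ) →L[ℝ] ℝ} {z : Fin n → ℂ}
    (hη : DifferentiableAt ℝ η z) (u v : Fin n → ℂ) :
    extDeriv (oneForm η) z ![u, v] = fderiv ℝ η z u v - fderiv ℝ η z v u := by
  have hd : DifferentiableAt ℝ (oneForm η) z :=
    ofSubsingleton_isBoundedLinear.contDiff.differentiable one_ne_zero _ |>.comp z hη
  rw [extDeriv_apply hd, Fin.sum_univ_two]
  have h : ∀ (w : Fin 1 → Fin n → ℂ), (fun x => oneForm η x w) = fun x => η x (w 0) := fun w => rfl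
  have hf : ∀ w x, fderiv ℝ (fun x => η x w) z x = fderiv ℝ η z x w := fun w x => by
    rw [fderiv_clm_apply hη (differentiableAt_const w)]
    simp
  simp only [h, hf]
  simp [Fin.removeNth, Fin.succAbove, sub_eq_add_neg]

/-- The signs are absorbed into a cyclic sum, the shape required by `sum_sign_cyclic_eq_zero`. -/
theorem extDeriv_twoForm_apply {θ : (Fin n → ℂ) → (Fin n → ℂ) [⋀^Fin 2]→L[ℝ] ℝ} {z : Fin n → ℂ}
    (u v w : Fin n → ℂ) :
    extDeriv θ z ![u, v, w] = fderiv ℝ θ z u ![v, w] + fderiv ℝ θ z v ![w, u] +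
      fderiv ℝ θ z w ![u, v] := by
  rw [extDeriv, ContinuousAlternatingMap.alternatizeUncurryFin_apply, Fin.sum_univ_three,
    twoForm_swap (fderiv ℝ θ z v) w u]
  have h0 : (0 : Fin 3).removeNth ![u, v, w] = ![v, w] := by ext i; fin_cases i <;> rfl
  have h1 : (1 : Fin 3).removeNth ![u, v, w] = ![u, w] := by ext i; fin_cases i <;> rfl
  have h2 : (2 : Fin 3).removeNth ![u, v, w] = ![u, v] := by ext i; fin_cases i <;> rfl
  rw [h0, h1, h2]
  simp

end ModelCalculus

/-! ### Stokes' theorem in one chart -/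

section LocalStokes

variable {n : ℕ}

theorem vec_two_eta {V : Type*} (w : Fin 2 → V) : w = ![w 0, w 1] := by
  funext j; fin_cases j <;> rfl

/-- Evaluation of two-forms at a pair of vectors. -/
def evalTwo (u v : Fin n → ℂ) : ((Fin n → ℂ) [⋀^Fin 2]→L[ℝ] ℝ) →L[ℝ] ℝ :=
  ContinuousAlternatingMap.apply ℝ (Fin n → ℂ) ℝ ![u, v]

theorem evalTwo_apply (u v : Fin n → ℂ) (θ : (Fin n → ℂ) [⋀^Fin 2]→L[ℝ] ℝ) :
    evalTwo u v θ = θ ![u, v] := rfl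

theorem hasFDerivAt_mul_prod {η : (Fin n → ℂ) → (Fin n → ℂ) →L[ℝ] ℝ}
    {Ω : Fin n → (Fin n → ℂ) → (Fin n → ℂ) [⋀^Fin 2]→L[ℝ] ℝ} {z : Fin n → ℂ}
    (hη : DifferentiableAt ℝ η z) (hΩ : ∀ i, DifferentiableAt ℝ (Ω i) z) (s : Finset (Fin n))
    (y u : Fin n → ℂ) (a b : Fin n → Fin n → ℂ) :
    fderiv ℝ (fun z => η z y * ∏ i ∈ s, Ω i z ![a i, b i]) z u =
      fderiv ℝ η z u y * ∏ i ∈ s, Ω i z ![a i, b i] +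
      ∑ k ∈ s, fderiv ℝ (Ω k) z u ![a k, b k] * (η z y * ∏ i ∈ s.erase k, Ω i z ![a i, b i]) := by
  have h1 : HasFDerivAt (fun z => η z y)
      ((ContinuousLinearMap.apply ℝ ℝ y).comp (fderiv ℝ η z)) z :=
    (ContinuousLinearMap.apply ℝ ℝ y).hasFDerivAt.comp z hη.hasFDerivAt
  have h2 : ∀ i ∈ s, HasFDerivAt (fun z => Ω i z ![a i, b i])
      ((evalTwo (a i) (b i)).comp (fderiv ℝ (Ω i) z)) z := fun i _ =>
    (evalTwo (a i) (b i)).hasFDerivAt.comp z (hΩ i).hasFDerivAt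
  have h3 := h1.fun_mul (HasFDerivAt.finsetProd h2)
  rw [h3.fderiv]
  simp only [_root_.add_apply, _root_.smul_apply,
    _root_.sum_apply, ContinuousLinearMap.comp_apply, smul_eq_mul, evalTwo_apply,
    ContinuousLinearMap.apply_apply, Finset.mul_sum]
  rw [add_comm]
  congr 1
  · ring
  · exact Finset.sum_congr rfl fun k _ => by ring

/-- When the Ω_i are closed, dη ∧ ⋀ Ω_i equals d(η ∧ ⋀ Ω_i). On a fixed frame this is a signed sum
of directional derivatives, each of which integrates to zero for compactly supported `η`. -/
theorem wedge_update_extDeriv {η : (Fin n → ℂ) → (Fin n → ℂ) →L[ℝ] ℝ}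
    {Ω : Fin n → (Fin n → ℂ) → (Fin n → ℂ) [⋀^Fin 2]→L[ℝ] ℝ} {z : Fin n → ℂ}
    (hη : DifferentiableAt ℝ η z) (hΩ : ∀ i, DifferentiableAt ℝ (Ω i) z)
    (hcl : ∀ i, extDeriv (Ω i) z = 0) (j : Fin n) (e : Fin n × Fin 2 → Fin n → ℂ) :
    wedge (Function.update (fun i => Ω i z) j (extDeriv (oneForm η) z)) e =
      ((2 : ℝ) ^ n)⁻¹ * (2 * ∑ σ : Equiv.Perm (Fin n × Fin 2), ((Equiv.Perm.sign σ : ℤ) : ℝ) *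
        fderiv ℝ (fun z => η z (e (σ (j, 1))) *
          ∏ i ∈ Finset.univ.erase j, Ω i z ![e (σ (i, 0)), e (σ (i, 1))]) z (e (σ (j, 0)))) := by
  rw [wedge_apply]
  congr 1
  simp only [hasFDerivAt_mul_prod hη hΩ, mul_add, Finset.sum_add_distrib]
  -- The Leibniz terms in which the derivative falls on some Ω_k cancel because Ω_k is closed.
  have hz : ∑ σ : Equiv.Perm (Fin n × Fin 2), ((Equiv.Perm.sign σ : ℤ) : ℝ) *
      ∑ k ∈ Finset.univ.erase j, fderiv ℝ (Ω k) z (e (σ (j, 0))) ![e (σ (k, 0)), e (σ (k, 1))] *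
        (η z (e (σ (j, 1))) * ∏ i ∈ (Finset.univ.erase j).erase k,
          Ω i z ![e (σ (i, 0)), e (σ (i, 1))]) = 0 := by
    simp only [Finset.mul_sum]
    rw [Finset.sum_comm]
    refine Finset.sum_eq_zero fun k hk => ?_
    refine sum_sign_cyclic_eq_zero e (Finset.ne_of_mem_erase hk)
      (fun x u v => fderiv ℝ (Ω k) z x ![u, v]) (fun x u v => ?_) (fun y => η z y)
      (fun i u v => Ω i z ![u, v])
    rw [← extDeriv_twoForm_apply, hcl]
    rfl
  rw [hz, mul_zero, add_zero, ← sum_sign_antisymmetrize e j (fun u v => fderiv ℝ η z u v)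
    (fun i u v => Ω i z ![u, v])]
  refine Finset.sum_congr rfl fun σ _ => ?_
  congr 1
  rw [← Finset.mul_prod_erase Finset.univ _ (Finset.mem_univ j), Function.update_self,
    vec_two_eta (fun a => e (σ (j, a))), extDeriv_oneForm_apply hη]
  congr 1
  refine Finset.prod_congr rfl fun i hi => ?_
  rw [Function.update_of_ne (Finset.ne_of_mem_erase hi), vec_two_eta (fun a => e (σ (i, a)))]

theorem contDiffOn_twoForm_apply {V : Type*} [NormedAddCommGroup V] [NormedSpace ℝ V]
    {m : WithTop ℕ∞} {U : Set V} {ω' : V → (Fin n → ℂ) [⋀^Fin 2]→L[ℝ] ℝ}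
    (h : ContDiffOn ℝ m ω' U) (u v : Fin n → ℂ) : ContDiffOn ℝ m (fun z => ω' z ![u, v]) U :=
  (evalTwo u v).contDiff.comp_contDiffOn h

theorem setIntegral_wedge_extDeriv_eq_zero {U K : Set (Fin n → ℂ)} (hU : IsOpen U)
    (hK : IsCompact K) (hKU : K ⊆ U) {η : (Fin n → ℂ) → (Fin n → ℂ) →L[ℝ] ℝ}
    {Ω : Fin n → (Fin n → ℂ) → (Fin n → ℂ) [⋀^Fin 2]→L[ℝ] ℝ}
    (hη : ContDiffOn ℝ 1 η U) (hη0 : ∀ z ∈ U, z ∉ K → η z = 0)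
    (hΩ : ∀ i, ContDiffOn ℝ 1 (Ω i) U)
    (hcl : ∀ i, ∀ z ∈ U, extDeriv (Ω i) z = 0) (j : Fin n) :
    ∫ z in U, wedge (Function.update (fun i => Ω i z) j (extDeriv (oneForm η) z)) (stdFrame n) =
      0 := by
  have hh : ∀ σ : Equiv.Perm (Fin n × Fin 2), ContDiffOn ℝ 1
      (fun z => η z (stdFrame n (σ (j, 1))) *
          ∏ i ∈ Finset.univ.erase j, Ω i z ![stdFrame n (σ (i, 0)), stdFrame n (σ (i, 1))]) U :=
    fun σ => (hη.clm_apply contDiffOn_const).mul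
      (contDiffOn_prod fun i _ => contDiffOn_twoForm_apply (hΩ i) _ _)
  have hmain := fun (σ : Equiv.Perm (Fin n × Fin 2)) =>
    setIntegral_fderiv_eq_zero volume hU hK hKU (hh σ)
      (fun z hz hzK => by simp [hη0 z hz hzK]) (stdFrame n (σ (j, 0)))
  have hd : ∀ {F : Type} [NormedAddCommGroup F] [NormedSpace ℝ F] {f : (Fin n → ℂ) → F},
      ContDiffOn ℝ 1 f U → ∀ z ∈ U, DifferentiableAt ℝ f z := fun hf z hz =>
    (hf.contDiffAt (hU.mem_nhds hz)).differentiableAt one_ne_zero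
  rw [setIntegral_congr_fun hU.measurableSet fun z hz =>
    wedge_update_extDeriv (hd hη z hz) (fun i => hd (hΩ i) z hz) (fun i => hcl i z hz) j
      (stdFrame n)]
  rw [integral_const_mul, integral_const_mul, integral_finsetSum]
  · simp only [integral_const_mul, (hmain _).2]
    simp
  · intro σ _
    exact ((integrable_indicator_iff hU.measurableSet).1 (hmain σ).1).const_mul _

end LocalStokes

/-! ### The operator √-1∂∂̄ on `ℂⁿ` and its holomorphic invariance -/

section DdbarModel

variable {n : ℕ}

theorem one_add_one_le_infty : (1 : WithTop ℕ∞) + 1 ≤ ∞ :=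
  (add_le_add_left (by simp : (1 : WithTop ℕ∞) ≤ ∞) 1).trans (by simp)

theorem minSmoothness_two_le_infty : minSmoothness ℝ 2 ≤ ∞ := by
  rw [minSmoothness_of_isRCLikeNormedField, ← one_add_one_eq_two]
  exact one_add_one_le_infty

theorem contDiffOn_fderiv_of_isOpen {V F : Type*} [NormedAddCommGroup V] [NormedSpace ℝ V]
    [NormedAddCommGroup F] [NormedSpace ℝ F] {U : Set V} (hU : IsOpen U) {f : V → F}
    (hf : ContDiffOn ℝ ∞ f U) : ContDiffOn ℝ ∞ (fderiv ℝ f) U :=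
  hf.fderiv_of_isOpen hU (by simp)

theorem contDiffOn_oneForm {U : Set (Fin n → ℂ)} {η : (Fin n → ℂ) → (Fin n → ℂ) →L[ℝ] ℝ}
    {m : WithTop ℕ∞} (hη : ContDiffOn ℝ m η U) : ContDiffOn ℝ m (oneForm η) U :=
  ofSubsingleton_isBoundedLinear.contDiff.comp_contDiffOn hη

theorem contDiffOn_extDeriv {k : ℕ} {U : Set (Fin n → ℂ)} (hU : IsOpen U)
    {θ : (Fin n → ℂ) → (Fin n → ℂ) [⋀^Fin k]→L[ℝ] ℝ} (hθ : ContDiffOn ℝ ∞ θ U) :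
    ContDiffOn ℝ ∞ (extDeriv θ) U := by
  have h : ContDiff ℝ ∞ (ContinuousAlternatingMap.alternatizeUncurryFinCLM ℝ (Fin n → ℂ) ℝ
      (n := k)) := ContinuousLinearMap.contDiff _
  refine (h.comp_contDiffOn (contDiffOn_fderiv_of_isOpen hU hθ)).congr fun x _ => ?_
  rw [extDeriv]
  rfl

/-- The covector field `dᶜ f = - df ∘ J`. -/
def dcModel (f : (Fin n → ℂ) → ℝ) (y : Fin n → ℂ) : (Fin n → ℂ) →L[ℝ] ℝ :=
  -(fderiv ℝ f y).comp (cplxJ n)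

theorem ddbarModel_eq (f : (Fin n → ℂ) → ℝ) (z : Fin n → ℂ) :
    ddbarModel f z = (1 / 2 : ℝ) • extDeriv (oneForm (dcModel f)) z := rfl

theorem contDiffOn_dcModel {U : Set (Fin n → ℂ)} (hU : IsOpen U) {f : (Fin n → ℂ) → ℝ}
    (hf : ContDiffOn ℝ ∞ f U) : ContDiffOn ℝ ∞ (dcModel f) U :=
  ((contDiffOn_fderiv_of_isOpen hU hf).clm_comp contDiffOn_const).neg

theorem contDiffOn_ddbarModel {U : Set (Fin n → ℂ)} (hU : IsOpen U) {f : (Fin n → ℂ) → ℝ}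
    (hf : ContDiffOn ℝ ∞ f U) : ContDiffOn ℝ ∞ (ddbarModel f) U :=
  (contDiffOn_extDeriv hU (contDiffOn_oneForm (contDiffOn_dcModel hU hf))).const_smul _

theorem extDeriv_ddbarModel {U : Set (Fin n → ℂ)} (hU : IsOpen U) {f : (Fin n → ℂ) → ℝ}
    (hf : ContDiffOn ℝ ∞ f U) {z : Fin n → ℂ} (hz : z ∈ U) : extDeriv (ddbarModel f) z = 0 := by
  rw [show ddbarModel f = (1 / 2 : ℝ) • extDeriv (oneForm (dcModel f)) from rfl, extDeriv_smul,
    extDeriv_extDeriv_apply (r := ∞)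
      ((contDiffOn_oneForm (contDiffOn_dcModel hU hf)).contDiffAt (hU.mem_nhds hz)) minSmoothness_two_le_infty,
    smul_zero]

theorem ddbarModel_apply {f : (Fin n → ℂ) → ℝ} {z : Fin n → ℂ}
    (hf : DifferentiableAt ℝ (fderiv ℝ f) z) (u v : Fin n → ℂ) :
    ddbarModel f z ![u, v] = -(1 / 2 : ℝ) * (fderiv ℝ (fderiv ℝ f) z u (cplxJ n v) -
      fderiv ℝ (fderiv ℝ f) z v (cplxJ n u)) := by
  have hd : HasFDerivAt (dcModel f)
      (-((ContinuousLinearMap.compL ℝ _ _ ℝ).flip (cplxJ n)).comp (fderiv ℝ (fderiv ℝ f) z)) z :=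
    (((ContinuousLinearMap.compL ℝ _ _ ℝ).flip (cplxJ n)).hasFDerivAt.comp z hf.hasFDerivAt).neg
  rw [ddbarModel_eq, ContinuousAlternatingMap.smul_apply, extDeriv_oneForm_apply
    hd.differentiableAt, hd.fderiv]
  simp
  ring

/-- Follows from the symmetry of the Hessian together with J² = -1. -/
theorem isTypeOneOne_ddbarModel {f : (Fin n → ℂ) → ℝ} {z : Fin n → ℂ}
    (hf : ContDiffAt ℝ ∞ f z) : IsTypeOneOne (ddbarModel f z) := by
  intro u v
  have hd : DifferentiableAt ℝ (fderiv ℝ f) z :=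
    (hf.fderiv_right (m := 1) one_add_one_le_infty).differentiableAt one_ne_zero
  have hs : IsSymmSndFDerivAt ℝ f z := hf.isSymmSndFDerivAt minSmoothness_two_le_infty
  rw [ddbarModel_apply hd, ddbarModel_apply hd, cplxJ_cplxJ, cplxJ_cplxJ, map_smul, map_smul,
    hs (cplxJ n u) v, hs (cplxJ n v) u]
  simp only [smul_eq_mul]
  ring

/-- `½ (α ∧ (- β ∘ J))`, for covectors `α` and `β`; thus `√-1 ∂f ∧ ∂̄g` antisymmetrized. -/
def crossForm (α β : (Fin n → ℂ) →L[ℝ] ℝ) : (Fin n → ℂ) [⋀^Fin 2]→L[ℝ] ℝ :=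
  (1 / 2 : ℝ) • areaForm.compContinuousLinearMap
    (α.smulRight (1 : ℂ) + (-β.comp (cplxJ n)).smulRight Complex.I)

theorem crossForm_apply (α β : (Fin n → ℂ) →L[ℝ] ℝ) (u v : Fin n → ℂ) :
    crossForm α β ![u, v] = -(1 / 2 : ℝ) * (α u * β (cplxJ n v) - α v * β (cplxJ n u)) := by
  simp [crossForm, areaForm_apply]
  ring

/-- Pulling back by `i` exchanges the two covectors; this is the pointwise source of the symmetry in
`formIntegral_smul_wedge_ddbar_comm`. -/
theorem crossForm_comp_cplxJ (α β : (Fin n → ℂ) →L[ℝ] ℝ) :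
    (crossForm α β).compContinuousLinearMap (cplxJ n) = crossForm β α := by
  ext w
  rw [vec_two_eta w]
  have : (crossForm α β).compContinuousLinearMap (cplxJ n) ![w 0, w 1] =
      crossForm α β ![cplxJ n (w 0), cplxJ n (w 1)] := by
    rw [ContinuousAlternatingMap.compContinuousLinearMap_apply]
    congr 1
    funext j; fin_cases j <;> rfl
  rw [this, crossForm_apply, crossForm_apply, cplxJ_cplxJ, cplxJ_cplxJ]
  simp only [map_smul, smul_eq_mul]
  ring

theorem isTypeOneOne_crossForm_self (α : (Fin n → ℂ) →L[ℝ] ℝ) :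
    IsTypeOneOne (crossForm α α) := by
  intro u v
  rw [crossForm_apply, crossForm_apply, cplxJ_cplxJ, cplxJ_cplxJ]
  simp only [map_smul, smul_eq_mul]
  ring

/-- The value is half of α(v)² + α(iv)². -/
theorem crossForm_self_nonneg (α : (Fin n → ℂ) →L[ℝ] ℝ) (v : Fin n → ℂ) :
    0 ≤ crossForm α α ![v, cplxJ n v] := by
  rw [crossForm_apply, cplxJ_cplxJ]
  simp only [map_smul, smul_eq_mul]
  nlinarith [sq_nonneg (α v), sq_nonneg (α (cplxJ n v))]

theorem crossForm_add_left (α α' β : (Fin n → ℂ) →L[ℝ] ℝ) :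
    crossForm (α + α') β = crossForm α β + crossForm α' β := by
  ext w
  rw [vec_two_eta w, ContinuousAlternatingMap.add_apply]
  simp only [crossForm_apply, _root_.add_apply]
  ring

theorem crossForm_compContinuousLinearMap (α β : (Fin n → ℂ) →L[ℝ] ℝ)
    {A : (Fin n → ℂ) →L[ℝ] (Fin n → ℂ)} (hA : ∀ v, A (cplxJ n v) = cplxJ n (A v)) :
    (crossForm α β).compContinuousLinearMap A = crossForm (α.comp A) (β.comp A) := by
  ext w
  rw [vec_two_eta w]
  have : (crossForm α β).compContinuousLinearMap A ![w 0, w 1] =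
      crossForm α β ![A (w 0), A (w 1)] := by
    rw [ContinuousAlternatingMap.compContinuousLinearMap_apply]
    congr 1
    funext j; fin_cases j <;> rfl
  rw [this, crossForm_apply, crossForm_apply]
  simp [hA]

theorem extDeriv_smul_dcModel {f g : (Fin n → ℂ) → ℝ} {z : Fin n → ℂ}
    (hf : ContDiffAt ℝ ∞ f z) (hg : ContDiffAt ℝ ∞ g z) :
    (1 / 2 : ℝ) • extDeriv (oneForm fun y => f y • dcModel g y) z =
      crossForm (fderiv ℝ f z) (fderiv ℝ g z) + f z • ddbarModel g z := by
  have hd : DifferentiableAt ℝ (dcModel g) z :=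
    (((hg.fderiv_right (m := 1) one_add_one_le_infty).differentiableAt one_ne_zero).clm_comp
      (differentiableAt_const _)).neg
  have hf' := hf.differentiableAt (by simp)
  ext w
  rw [vec_two_eta w, ContinuousAlternatingMap.smul_apply, extDeriv_oneForm_apply (hf'.fun_smul hd),
    fderiv_fun_smul hf' hd, ContinuousAlternatingMap.add_apply, crossForm_apply,
    ContinuousAlternatingMap.smul_apply, ddbarModel_eq, ContinuousAlternatingMap.smul_apply,
    extDeriv_oneForm_apply hd]
  simp [dcModel]
  ring

theorem ddbarModel_congr {f g : (Fin n → ℂ) → ℝ} {z : Fin n → ℂ} (h : f =ᶠ[𝓝 z] g) :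
    ddbarModel f z = ddbarModel g z := by
  rw [ddbarModel_eq, ddbarModel_eq]
  congr 1
  refine Filter.EventuallyEq.extDeriv_eq ?_
  filter_upwards [h.fderiv (𝕜 := ℝ)] with y hy
  simp only [oneForm, dcModel, hy]

theorem fderiv_cplxJ_comm {τ : (Fin n → ℂ) → Fin n → ℂ} {z : Fin n → ℂ}
    (hτ : DifferentiableAt ℂ τ z) (v : Fin n → ℂ) :
    fderiv ℝ τ z (cplxJ n v) = cplxJ n (fderiv ℝ τ z v) := by
  rw [hτ.fderiv_restrictScalars ℝ]
  simp [cplxJ_apply]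

/-- The derivative of a holomorphic map commutes with `i`, so dᶜ commutes with pullback by it; d
commutes with every pullback. -/
theorem ddbarModel_comp {f : (Fin n → ℂ) → ℝ} {τ : (Fin n → ℂ) → Fin n → ℂ} {z : Fin n → ℂ}
    (hf : ContDiffAt ℝ ∞ f (τ z)) (hτ : ContDiffAt ℂ ∞ τ z) :
    ddbarModel (f ∘ τ) z = (ddbarModel f (τ z)).compContinuousLinearMap (fderiv ℝ τ z) := by
  have hτr : ContDiffAt ℝ ∞ τ z := hτ.restrict_scalars ℝ
  have hd : DifferentiableAt ℝ (dcModel f) (τ z) :=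
    (((hf.fderiv_right (m := 1) one_add_one_le_infty).differentiableAt one_ne_zero).clm_comp
      (differentiableAt_const _)).neg
  have hdo : DifferentiableAt ℝ (oneForm (dcModel f)) (τ z) :=
    ofSubsingleton_isBoundedLinear.contDiff.differentiable one_ne_zero _ |>.comp _ hd
  have h1 := extDeriv_pullback hdo hτr minSmoothness_two_le_infty
  -- The identity of one-forms is about to be differentiated, so it is needed near `z` and not just
  -- at `z`.
  have h2 : oneForm (dcModel (f ∘ τ)) =ᶠ[𝓝 z] fun x =>
      (oneForm (dcModel f) (τ x)).compContinuousLinearMap (fderiv ℝ τ x) := by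
    have e1 : ∀ᶠ x in 𝓝 z, DifferentiableAt ℂ τ x :=
      ((hτ.of_le (m := 1) (by simp)).eventually (by simp)).mono fun x hx =>
        hx.differentiableAt one_ne_zero
    have e2 : ∀ᶠ x in 𝓝 z, DifferentiableAt ℝ f (τ x) :=
      hτr.continuousAt.eventually <| ((hf.of_le (m := 1) (by simp)).eventually (by simp)).mono
        fun x hx => hx.differentiableAt one_ne_zero
    filter_upwards [e1, e2] with x hx1 hx2
    ext w
    change dcModel (f ∘ τ) x (w 0) = dcModel f (τ x) (fderiv ℝ τ x (w 0))
    simp only [dcModel, _root_.neg_apply, ContinuousLinearMap.comp_apply]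
    rw [fderiv_comp x hx2 (hx1.restrictScalars ℝ), ContinuousLinearMap.comp_apply,
      fderiv_cplxJ_comm hx1]
  rw [ddbarModel_eq, h2.extDeriv_eq, h1, ddbarModel_eq]
  rfl

end DdbarModel

/-! ### Coordinate changes and local expressions of forms on `M` -/

section Charts

variable {n : ℕ} {M : Type*} [TopologicalSpace M] [ChartedSpace (Fin n → ℂ) M]

/-- The coordinate change from the chart at `c` to the chart at `b`. -/
def transition (n : ℕ) {M : Type*} [TopologicalSpace M] [ChartedSpace (Fin n → ℂ) M] (c b : M) :
    (Fin n → ℂ) → Fin n → ℂ :=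
  chartAt (Fin n → ℂ) b ∘ (chartAt (Fin n → ℂ) c).symm

/-- The domain of `transition n c b`. -/
def overlap (n : ℕ) {M : Type*} [TopologicalSpace M] [ChartedSpace (Fin n → ℂ) M] (c b : M) :
    Set (Fin n → ℂ) :=
  ((chartAt (Fin n → ℂ) c).symm ≫ₕ chartAt (Fin n → ℂ) b).source

theorem mem_overlap {c b : M} {z : Fin n → ℂ} : z ∈ overlap n c b ↔
    z ∈ (chartAt (Fin n → ℂ) c).target ∧
      (chartAt (Fin n → ℂ) c).symm z ∈ (chartAt (Fin n → ℂ) b).source := by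
  simp [overlap]

theorem isOpen_overlap (c b : M) : IsOpen (overlap n c b) :=
  ((chartAt (Fin n → ℂ) c).symm ≫ₕ chartAt (Fin n → ℂ) b).open_source

theorem symm_transition {c b : M} {z : Fin n → ℂ} (hz : z ∈ overlap n c b) :
    (chartAt (Fin n → ℂ) b).symm (transition n c b z) = (chartAt (Fin n → ℂ) c).symm z :=
  (chartAt (Fin n → ℂ) b).left_inv (mem_overlap.1 hz).2

theorem transition_mem_target {c b : M} {z : Fin n → ℂ} (hz : z ∈ overlap n c b) :
    transition n c b z ∈ (chartAt (Fin n → ℂ) b).target :=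
  (chartAt (Fin n → ℂ) b).map_source (mem_overlap.1 hz).2

theorem transition_mem_overlap {c b : M} {z : Fin n → ℂ} (hz : z ∈ overlap n c b) :
    transition n c b z ∈ overlap n b c := by
  rw [mem_overlap, symm_transition hz]
  exact ⟨transition_mem_target hz, (chartAt (Fin n → ℂ) c).map_target (mem_overlap.1 hz).1⟩

theorem transition_transition {c b : M} {z : Fin n → ℂ} (hz : z ∈ overlap n c b) :
    transition n b c (transition n c b z) = z := by
  change chartAt (Fin n → ℂ) c ((chartAt (Fin n → ℂ) b).symm (transition n c b z)) = z
  rw [symm_transition hz, (chartAt (Fin n → ℂ) c).right_inv (mem_overlap.1 hz).1]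

theorem mem_overlap_symm {c : M} {z : Fin n → ℂ} (hz : z ∈ (chartAt (Fin n → ℂ) c).target) :
    z ∈ overlap n c ((chartAt (Fin n → ℂ) c).symm z) :=
  mem_overlap.2 ⟨hz, mem_chart_source _ _⟩

/-- The derivative of the inverse chart at `c`, the tangent space at the image point being
identified with `ℂⁿ` through the preferred chart there. -/
def chartDeriv (c : M) (z : Fin n → ℂ) : (Fin n → ℂ) →L[ℝ] (Fin n → ℂ) :=
  fderiv ℝ (transition n c ((chartAt (Fin n → ℂ) c).symm z)) z

/-- The coefficient of a top form in the chart at `c`. -/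
def coef (T : TopForm n M) (c : M) (z : Fin n → ℂ) : ℝ :=
  T ((chartAt (Fin n → ℂ) c).symm z) fun p => chartDeriv c z (stdFrame n p)

theorem coef_eq_det_mul (T : TopForm n M) (c : M) (z : Fin n → ℂ) :
    coef T c z = (chartDeriv c z).det * T ((chartAt (Fin n → ℂ) c).symm z) (stdFrame n) :=
  topForm_comp _ (chartDeriv c z : (Fin n → ℂ) →ₗ[ℝ] (Fin n → ℂ)) _

theorem comp_chart_symm_eventuallyEq (f : M → ℝ) {c b : M} {z : Fin n → ℂ}
    (hz : z ∈ overlap n c b) :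
    f ∘ (chartAt (Fin n → ℂ) c).symm =ᶠ[𝓝 z]
      (f ∘ (chartAt (Fin n → ℂ) b).symm) ∘ transition n c b := by
  filter_upwards [(isOpen_overlap c b).mem_nhds hz] with y hy
  simp only [Function.comp_apply, symm_transition hy]

variable [IsManifold 𝓘(ℂ, Fin n → ℂ) ∞ M]

theorem contDiffOn_transition (c b : M) :
    ContDiffOn ℂ ∞ (transition n c b) (overlap n c b) := by
  have h := (contDiffGroupoid ∞ 𝓘(ℂ, Fin n → ℂ)).compatible
    (chart_mem_atlas (Fin n → ℂ) c) (chart_mem_atlas (Fin n → ℂ) b)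
  rw [contDiffGroupoid, mem_groupoid_of_pregroupoid] at h
  have h1 := h.1
  simp only [contDiffPregroupoid, modelWithCornersSelf_coe, modelWithCornersSelf_coe_symm,
    Function.id_comp, Function.comp_id, preimage_id_eq, id_eq, range_id, inter_univ] at h1
  exact h1

theorem contDiffAt_transition {c b : M} {z : Fin n → ℂ} (hz : z ∈ overlap n c b) :
    ContDiffAt ℂ ∞ (transition n c b) z :=
  (contDiffOn_transition c b).contDiffAt ((isOpen_overlap c b).mem_nhds hz)

theorem differentiableAt_transition {c b : M} {z : Fin n → ℂ} (hz : z ∈ overlap n c b) :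
    DifferentiableAt ℂ (transition n c b) z :=
  (contDiffAt_transition hz).differentiableAt (by simp)

theorem fderiv_transition_comp {c b d : M} {z : Fin n → ℂ} (hz : z ∈ overlap n c b)
    (hd : z ∈ overlap n c d) :
    fderiv ℝ (transition n c d) z =
      (fderiv ℝ (transition n b d) (transition n c b z)).comp (fderiv ℝ (transition n c b) z) := by
  have hbd : transition n c b z ∈ overlap n b d := by
    rw [mem_overlap, symm_transition hz]
    exact ⟨transition_mem_target hz, (mem_overlap.1 hd).2⟩
  rw [← fderiv_comp z ((differentiableAt_transition hbd).restrictScalars ℝ)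
    ((differentiableAt_transition hz).restrictScalars ℝ)]
  refine Filter.EventuallyEq.fderiv_eq ?_
  filter_upwards [(isOpen_overlap c b).mem_nhds hz] with y hy
  change chartAt (Fin n → ℂ) d ((chartAt (Fin n → ℂ) c).symm y) =
    chartAt (Fin n → ℂ) d ((chartAt (Fin n → ℂ) b).symm (transition n c b y))
  rw [symm_transition hy]

theorem chartDeriv_eq_comp {c b : M} {z : Fin n → ℂ} (hz : z ∈ overlap n c b) :
    chartDeriv c z = (chartDeriv b (transition n c b z)).comp (fderiv ℝ (transition n c b) z) := by
  unfold chartDeriv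
  rw [symm_transition hz]
  exact fderiv_transition_comp hz (mem_overlap_symm (mem_overlap.1 hz).1)

/-- The determinant is a squared modulus because the coordinate change is holomorphic, and it is
nonzero because the chain rule with the reverse change gives product 1. -/
theorem det_fderiv_transition_pos {c b : M} {z : Fin n → ℂ} (hz : z ∈ overlap n c b) :
    0 < (fderiv ℝ (transition n c b) z).det := by
  have h0 : 0 ≤ (fderiv ℝ (transition n c b) z).det := by
    rw [(differentiableAt_transition hz).fderiv_restrictScalars ℝ]
    change 0 ≤ LinearMap.det
      ((fderiv ℂ (transition n c b) z : (Fin n → ℂ) →ₗ[ℂ] (Fin n → ℂ)).restrictScalars ℝ)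
    rw [det_restrictScalars_eq_normSq]
    exact Complex.normSq_nonneg _
  refine lt_of_le_of_ne h0 fun h => ?_
  have hc : z ∈ overlap n c c := mem_overlap.2 ⟨(mem_overlap.1 hz).1,
    (chartAt (Fin n → ℂ) c).map_target (mem_overlap.1 hz).1⟩
  have h1 := fderiv_transition_comp hz hc
  have h2 : fderiv ℝ (transition n c c) z = ContinuousLinearMap.id ℝ _ := by
    rw [← fderiv_id (𝕜 := ℝ) (x := z)]
    refine Filter.EventuallyEq.fderiv_eq ?_
    filter_upwards [(isOpen_overlap c c).mem_nhds hc] with y hy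
    exact (chartAt (Fin n → ℂ) c).right_inv (mem_overlap.1 hy).1
  rw [h2] at h1
  have h3 := congrArg ContinuousLinearMap.det h1
  have h4 : ∀ A B : (Fin n → ℂ) →L[ℝ] (Fin n → ℂ), (A.comp B).det = A.det * B.det := fun A B =>
    LinearMap.det_comp (A : (Fin n → ℂ) →ₗ[ℝ] (Fin n → ℂ)) (B : (Fin n → ℂ) →ₗ[ℝ] (Fin n → ℂ))
  have h5 : (ContinuousLinearMap.id ℝ (Fin n → ℂ)).det = 1 := LinearMap.det_id
  rw [h4, h5, ← h, mul_zero] at h3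
  exact one_ne_zero h3

theorem det_chartDeriv_pos {c : M} {z : Fin n → ℂ} (hz : z ∈ (chartAt (Fin n → ℂ) c).target) :
    0 < (chartDeriv c z).det :=
  det_fderiv_transition_pos (mem_overlap_symm hz)

/-- The tangent space at the image point is read in the preferred chart there, so the manifold
derivative is the ordinary derivative of a coordinate change whose target chart depends on `z`. -/
theorem mfderiv_chart_symm {c : M} {z : Fin n → ℂ} (hz : z ∈ (chartAt (Fin n → ℂ) c).target) :
    mfderiv 𝓘(ℝ, Fin n → ℂ) 𝓘(ℝ, Fin n → ℂ) (chartAt (Fin n → ℂ) c).symm z = chartDeriv c z := by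
  have : IsManifold 𝓘(ℝ, Fin n → ℂ) 1 M := IsManifold.of_le (n := ∞) (by simp)
  have h : MDifferentiableAt 𝓘(ℝ, Fin n → ℂ) 𝓘(ℝ, Fin n → ℂ) (chartAt (Fin n → ℂ) c).symm z :=
    mdifferentiableAt_atlas_symm (chart_mem_atlas _ c) hz
  rw [h.mfderiv]
  simp only [writtenInExtChartAt, extChartAt, mfld_simps, fderivWithin_univ]
  rfl

theorem localRep_eq (w : TwoForm n M) {c : M} {z : Fin n → ℂ}
    (hz : z ∈ (chartAt (Fin n → ℂ) c).target) :
    localRep w c z = (w ((chartAt (Fin n → ℂ) c).symm z)).compContinuousLinearMap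
      (chartDeriv c z) := by
  rw [← mfderiv_chart_symm hz]
  rfl

/-- The transformation law that matches the Jacobian factor in the change of variables formula. -/
theorem coef_transition (T : TopForm n M) {c b : M} {z : Fin n → ℂ} (hz : z ∈ overlap n c b) :
    coef T c z = (fderiv ℝ (transition n c b) z).det * coef T b (transition n c b z) := by
  rw [coef_eq_det_mul, coef_eq_det_mul, symm_transition hz, chartDeriv_eq_comp hz]
  have h4 : ∀ A B : (Fin n → ℂ) →L[ℝ] (Fin n → ℂ), (A.comp B).det = A.det * B.det := fun A B =>
    LinearMap.det_comp (A : (Fin n → ℂ) →ₗ[ℝ] (Fin n → ℂ)) (B : (Fin n → ℂ) →ₗ[ℝ] (Fin n → ℂ))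
  rw [h4]
  ring

theorem coef_wedge (Ω : Fin n → TwoForm n M) {c : M} {z : Fin n → ℂ}
    (hz : z ∈ (chartAt (Fin n → ℂ) c).target) :
    coef (fun x => wedge fun i => Ω i x) c z =
      wedge (fun i => localRep (Ω i) c z) (stdFrame n) := by
  simp only [localRep_eq _ hz]
  exact (wedge_compContinuousLinearMap _ _ _).symm

theorem contDiffOn_comp_chart_symm {f : M → ℝ} (hf : ContMDiff 𝓘(ℝ, Fin n → ℂ) 𝓘(ℝ, ℝ) ∞ f)
    (c : M) : ContDiffOn ℝ ∞ (f ∘ (chartAt (Fin n → ℂ) c).symm) (chartAt (Fin n → ℂ) c).target :=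
  contMDiffOn_iff_contDiffOn.1
    (hf.comp_contMDiffOn (contMDiffOn_chart_symm (I := 𝓘(ℝ, Fin n → ℂ)) (n := ∞) (x := c)))

theorem contDiffAt_comp_chart_symm {f : M → ℝ} (hf : ContMDiff 𝓘(ℝ, Fin n → ℂ) 𝓘(ℝ, ℝ) ∞ f)
    {c : M} {z : Fin n → ℂ} (hz : z ∈ (chartAt (Fin n → ℂ) c).target) :
    ContDiffAt ℝ ∞ (f ∘ (chartAt (Fin n → ℂ) c).symm) z :=
  (contDiffOn_comp_chart_symm hf c).contDiffAt ((chartAt (Fin n → ℂ) c).open_target.mem_nhds hz)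

/-- `ddbar` is computed at every point in that point's own chart. Holomorphic invariance identifies
it, throughout a fixed chart, with the model operator there, which is what makes it smooth and
closed. -/
theorem localRep_ddbar {f : M → ℝ} (hf : ContMDiff 𝓘(ℝ, Fin n → ℂ) 𝓘(ℝ, ℝ) ∞ f) {c : M}
    {z : Fin n → ℂ} (hz : z ∈ (chartAt (Fin n → ℂ) c).target) :
    localRep (ddbar f) c z = ddbarModel (f ∘ (chartAt (Fin n → ℂ) c).symm) z := by
  have ho := mem_overlap_symm hz
  rw [localRep_eq _ hz, ddbarModel_congr (comp_chart_symm_eventuallyEq f ho),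
    ddbarModel_comp (contDiffAt_comp_chart_symm hf (transition_mem_target ho))
      (contDiffAt_transition ho)]
  rfl

/-- The two-form `½ df ∧ dᶜg` on `M`. -/
def cross (f g : M → ℝ) : TwoForm n M := fun x =>
  crossForm (fderiv ℝ (f ∘ (chartAt (Fin n → ℂ) x).symm) (chartAt (Fin n → ℂ) x x))
    (fderiv ℝ (g ∘ (chartAt (Fin n → ℂ) x).symm) (chartAt (Fin n → ℂ) x x))

theorem localRep_cross {f g : M → ℝ} (hf : ContMDiff 𝓘(ℝ, Fin n → ℂ) 𝓘(ℝ, ℝ) ∞ f)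
    (hg : ContMDiff 𝓘(ℝ, Fin n → ℂ) 𝓘(ℝ, ℝ) ∞ g) {c : M}
    {z : Fin n → ℂ} (hz : z ∈ (chartAt (Fin n → ℂ) c).target) :
    localRep (cross f g) c z = crossForm (fderiv ℝ (f ∘ (chartAt (Fin n → ℂ) c).symm) z)
      (fderiv ℝ (g ∘ (chartAt (Fin n → ℂ) c).symm) z) := by
  have ho := mem_overlap_symm hz
  have hd : ∀ {h : M → ℝ}, ContMDiff 𝓘(ℝ, Fin n → ℂ) 𝓘(ℝ, ℝ) ∞ h →
      fderiv ℝ (h ∘ (chartAt (Fin n → ℂ) c).symm) z =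
        (fderiv ℝ (h ∘ (chartAt (Fin n → ℂ) ((chartAt (Fin n → ℂ) c).symm z)).symm)
          (transition n c ((chartAt (Fin n → ℂ) c).symm z) z)).comp (chartDeriv c z) := fun hh => by
    rw [(comp_chart_symm_eventuallyEq _ ho).fderiv_eq]
    exact fderiv_comp z ((contDiffAt_comp_chart_symm hh (transition_mem_target ho)).differentiableAt
      (by simp)) ((differentiableAt_transition ho).restrictScalars ℝ)
  rw [localRep_eq _ hz, hd hf, hd hg]
  exact crossForm_compContinuousLinearMap _ _ (A := chartDeriv c z)
    (fderiv_cplxJ_comm (differentiableAt_transition ho))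

end Charts

/-! ### Integration of top forms over `M` -/

theorem integrableOn_of_eq_zero_off_compact {V : Type*} [NormedAddCommGroup V] [NormedSpace ℝ V]
    [MeasurableSpace V] [BorelSpace V] {μ : Measure V} [IsFiniteMeasureOnCompacts μ]
    {U K : Set V} (hU : IsOpen U) (hK : IsCompact K) (hKU : K ⊆ U) {h : V → ℝ}
    (hh : ContinuousOn h U) (h0 : ∀ z ∈ U, z ∉ K → h z = 0) : IntegrableOn h U μ := by
  have hc : Continuous (U.indicator h) := (contDiff_indicator_of_eq_zero (m := 0) hU hK.isClosed hKU
    (contDiffOn_zero.2 hh) h0).continuous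
  refine (integrable_indicator_iff hU.measurableSet).1
    (hc.integrable_of_hasCompactSupport (HasCompactSupport.intro hK fun z hz => ?_))
  by_cases hzU : z ∈ U
  · rw [indicator_of_mem hzU, h0 z hzU hz]
  · exact indicator_of_notMem hzU h

section Integral

variable {n : ℕ} {M : Type*} [TopologicalSpace M] [ChartedSpace (Fin n → ℂ) M]

theorem chart_symm_mem_of_notMem_image {c : M} {A : Set M} {z : Fin n → ℂ}
    (hz : z ∈ (chartAt (Fin n → ℂ) c).target) (hzA : z ∉ chartAt (Fin n → ℂ) c '' A) :
    (chartAt (Fin n → ℂ) c).symm z ∉ A := fun h =>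
  hzA ⟨_, h, (chartAt (Fin n → ℂ) c).right_inv hz⟩

theorem isCompact_chart_image {c : M} {A : Set M} (hA : IsCompact A)
    (hAc : A ⊆ (chartAt (Fin n → ℂ) c).source) : IsCompact (chartAt (Fin n → ℂ) c '' A) :=
  hA.image_of_continuousOn ((chartAt (Fin n → ℂ) c).continuousOn.mono hAc)

theorem chart_image_subset {c : M} {A : Set M} (hAc : A ⊆ (chartAt (Fin n → ℂ) c).source) :
    chartAt (Fin n → ℂ) c '' A ⊆ (chartAt (Fin n → ℂ) c).target :=
  (image_mono hAc).trans (chartAt (Fin n → ℂ) c).image_source_eq_target.subset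

/-- Top forms with continuous coefficients in all preferred charts. -/
def ContinuousTop (T : TopForm n M) : Prop :=
  ∀ c, ContinuousOn (coef T c) (chartAt (Fin n → ℂ) c).target

variable [T2Space M] [CompactSpace M] [IsManifold 𝓘(ℂ, Fin n → ℂ) ∞ M]

theorem tsupport_partitionOfUnity_subset (c : M) :
    tsupport (partitionOfUnity n M c) ⊆ (chartAt (Fin n → ℂ) c).source :=
  partitionOfUnity_isSubordinate n M c

theorem isCompact_tsupport_partitionOfUnity (c : M) :
    IsCompact (tsupport (partitionOfUnity n M c)) :=
  (isClosed_tsupport _).isCompact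

variable (n M) in
theorem finite_partitionOfUnity :
    {c : M | (Function.support (partitionOfUnity n M c)).Nonempty}.Finite :=
  (partitionOfUnity n M).locallyFinite.finite_nonempty_of_compact

variable (n M) in
/-- The charts that occur in the partition of unity. -/
def chartIndices : Finset M := (finite_partitionOfUnity n M).toFinset

theorem partitionOfUnity_eq_zero {c : M} (hc : c ∉ chartIndices n M) (x : M) :
    partitionOfUnity n M c x = 0 := by
  by_contra h
  exact hc ((finite_partitionOfUnity n M).mem_toFinset.2 ⟨x, h⟩)

theorem sum_partitionOfUnity (x : M) :
    ∑ c ∈ chartIndices n M, partitionOfUnity n M c x = 1 := by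
  rw [← (partitionOfUnity n M).sum_eq_one (mem_univ x)]
  refine (finsum_eq_sum_of_support_subset _ fun c hc => ?_).symm
  by_contra h
  exact hc (partitionOfUnity_eq_zero h x)

theorem formIntegral_eq_sum (T : TopForm n M) :
    formIntegral T = ∑ c ∈ chartIndices n M, ∫ z in (chartAt (Fin n → ℂ) c).target,
      partitionOfUnity n M c ((chartAt (Fin n → ℂ) c).symm z) * coef T c z := by
  have h : ∀ c : M, (∫ z in (chartAt (Fin n → ℂ) c).target,
      partitionOfUnity n M c ((chartAt (Fin n → ℂ) c).symm z) *
      T ((chartAt (Fin n → ℂ) c).symm z) (fun p =>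
        mfderiv 𝓘(ℝ, Fin n → ℂ) 𝓘(ℝ, Fin n → ℂ) (chartAt (Fin n → ℂ) c).symm z (stdFrame n p))) =
      ∫ z in (chartAt (Fin n → ℂ) c).target,
        partitionOfUnity n M c ((chartAt (Fin n → ℂ) c).symm z) * coef T c z := fun c => by
    refine setIntegral_congr_fun (chartAt (Fin n → ℂ) c).open_target.measurableSet fun z hz => ?_
    simp only [coef, ← mfderiv_chart_symm hz]
    rfl
  unfold formIntegral
  simp only [h]
  refine finsum_eq_sum_of_support_subset _ fun c hc => ?_
  by_contra hn
  refine hc ?_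
  simp [partitionOfUnity_eq_zero hn]

theorem contDiffOn_partitionOfUnity (c b : M) :
    ContDiffOn ℝ ∞ (fun z => partitionOfUnity n M c ((chartAt (Fin n → ℂ) b).symm z))
      (chartAt (Fin n → ℂ) b).target :=
  contDiffOn_comp_chart_symm (partitionOfUnity n M c).contMDiff b

theorem integrableOn_partitionOfUnity_mul {T : TopForm n M} (hT : ContinuousTop T) (c : M) :
    IntegrableOn (fun z => partitionOfUnity n M c ((chartAt (Fin n → ℂ) c).symm z) * coef T c z)
      (chartAt (Fin n → ℂ) c).target := by
  refine integrableOn_of_eq_zero_off_compact (chartAt (Fin n → ℂ) c).open_target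
    (isCompact_chart_image (isCompact_tsupport_partitionOfUnity c)
      (tsupport_partitionOfUnity_subset c))
    (chart_image_subset (tsupport_partitionOfUnity_subset c))
    ((contDiffOn_partitionOfUnity c c).continuousOn.mul (hT c)) fun z hz hzK => ?_
  rw [image_eq_zero_of_notMem_tsupport (chart_symm_mem_of_notMem_image hz hzK), zero_mul]

theorem formIntegral_add {S T : TopForm n M} (hS : ContinuousTop S) (hT : ContinuousTop T) :
    formIntegral (fun x => S x + T x) = formIntegral S + formIntegral T := by
  rw [formIntegral_eq_sum, formIntegral_eq_sum, formIntegral_eq_sum, ← Finset.sum_add_distrib]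
  refine Finset.sum_congr rfl fun c _ => ?_
  rw [← integral_add (integrableOn_partitionOfUnity_mul hS c)
    (integrableOn_partitionOfUnity_mul hT c)]
  congr 1
  funext z
  simp only [coef, AlternatingMap.add_apply]
  ring

theorem formIntegral_smul (r : ℝ) (T : TopForm n M) :
    formIntegral (fun x => r • T x) = r * formIntegral T := by
  rw [formIntegral_eq_sum, formIntegral_eq_sum, Finset.mul_sum]
  refine Finset.sum_congr rfl fun c _ => ?_
  rw [← integral_const_mul]
  congr 1
  funext z
  simp only [coef, AlternatingMap.smul_apply, smul_eq_mul]
  ring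

theorem formIntegral_sub {S T : TopForm n M} (hS : ContinuousTop S) (hT : ContinuousTop T) :
    formIntegral (fun x => S x - T x) = formIntegral S - formIntegral T := by
  have h1 : ContinuousTop fun x => (-1 : ℝ) • T x := fun c => by
    have : coef (fun x => (-1 : ℝ) • T x) c = fun z => (-1 : ℝ) * coef T c z := rfl
    rw [this]
    exact continuousOn_const.mul (hT c)
  have h2 := formIntegral_add hS h1
  rw [formIntegral_smul] at h2
  have h3 : (fun x => S x + (-1 : ℝ) • T x) = fun x => S x - T x := by
    funext x; module
  rw [h3] at h2
  linarith

theorem formIntegral_nonneg {T : TopForm n M} (h : ∀ x, 0 ≤ T x (stdFrame n)) :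
    0 ≤ formIntegral T := by
  rw [formIntegral_eq_sum]
  refine Finset.sum_nonneg fun c _ =>
    setIntegral_nonneg (chartAt (Fin n → ℂ) c).open_target.measurableSet fun z hz => ?_
  rw [coef_eq_det_mul]
  exact mul_nonneg ((partitionOfUnity n M).nonneg _ _)
    (mul_nonneg (det_chartDeriv_pos hz).le (h _))

/-- At any point some function of the partition is positive; the corresponding integrand is
continuous, nonnegative and nonzero on a nonempty open set. -/
theorem formIntegral_pos [Nonempty M] {T : TopForm n M} (hT : ContinuousTop T)
    (h : ∀ x, 0 < T x (stdFrame n)) : 0 < formIntegral T := by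
  have hnn : ∀ c : M, ∀ z ∈ (chartAt (Fin n → ℂ) c).target,
      0 ≤ partitionOfUnity n M c ((chartAt (Fin n → ℂ) c).symm z) * coef T c z := fun c z hz => by
    rw [coef_eq_det_mul]
    exact mul_nonneg ((partitionOfUnity n M).nonneg _ _)
      (mul_nonneg (det_chartDeriv_pos hz).le (h _).le)
  obtain ⟨x⟩ := ‹Nonempty M›
  obtain ⟨c, hcS, hcx⟩ : ∃ c ∈ chartIndices n M, 0 < partitionOfUnity n M c x := by
    by_contra! hn
    have := sum_partitionOfUnity (n := n) x
    linarith [Finset.sum_nonpos hn]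
  have hxs : x ∈ (chartAt (Fin n → ℂ) c).source :=
    tsupport_partitionOfUnity_subset c (subset_tsupport _ hcx.ne')
  rw [formIntegral_eq_sum]
  refine Finset.sum_pos' (fun c _ => setIntegral_nonneg
    (chartAt (Fin n → ℂ) c).open_target.measurableSet (hnn c)) ⟨c, hcS, ?_⟩
  have hcont : ContinuousOn
      (fun z => partitionOfUnity n M c ((chartAt (Fin n → ℂ) c).symm z) * coef T c z)
      (chartAt (Fin n → ℂ) c).target :=
    (contDiffOn_partitionOfUnity c c).continuousOn.mul (hT c)
  rw [setIntegral_pos_iff_support_of_nonneg_ae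
    ((ae_restrict_mem (chartAt (Fin n → ℂ) c).open_target.measurableSet).mono (hnn c))
    (integrableOn_partitionOfUnity_mul hT c)]
  have hopen : IsOpen ((chartAt (Fin n → ℂ) c).target ∩
      (fun z => partitionOfUnity n M c ((chartAt (Fin n → ℂ) c).symm z) * coef T c z) ⁻¹'
        {0}ᶜ) := hcont.isOpen_inter_preimage (chartAt (Fin n → ℂ) c).open_target
      isOpen_compl_singleton
  rw [inter_comm]
  refine hopen.measure_pos _ ⟨chartAt (Fin n → ℂ) c x,
    (chartAt (Fin n → ℂ) c).map_source hxs, ?_⟩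
  have hz := (chartAt (Fin n → ℂ) c).map_source hxs
  simp only [mem_preimage, mem_compl_iff, mem_singleton_iff, coef_eq_det_mul,
    (chartAt (Fin n → ℂ) c).left_inv hxs]
  exact (mul_pos hcx (mul_pos (det_chartDeriv_pos hz) (h _))).ne'

/-- The integral of a top form supported in one chart is computed in that chart. -/
theorem formIntegral_eq_setIntegral {T : TopForm n M} (hT : ContinuousTop T) {b : M} {K : Set M}
    (hK : IsCompact K) (hKb : K ⊆ (chartAt (Fin n → ℂ) b).source) (h0 : ∀ x ∉ K, T x = 0) :
    formIntegral T = ∫ z in (chartAt (Fin n → ℂ) b).target, coef T b z := by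
  have hcoef0 : ∀ (c : M) (z : Fin n → ℂ), (chartAt (Fin n → ℂ) c).symm z ∉ K → coef T c z = 0 :=
    fun c z hz => by simp [coef, h0 _ hz]
  -- Both integrands live on the overlap of the charts `c` and `b`: the first because `T` vanishes
  -- off `K`, which lies in the domain of `b`, the second because ρ_c is supported in the domain of
  -- `c`. Change of variables compares the two, with no absolute value since the Jacobian is
  -- positive.
  have hchange : ∀ c : M, ∫ z in (chartAt (Fin n → ℂ) c).target,
      partitionOfUnity n M c ((chartAt (Fin n → ℂ) c).symm z) * coef T c z =
      ∫ z in (chartAt (Fin n → ℂ) b).target,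
        partitionOfUnity n M c ((chartAt (Fin n → ℂ) b).symm z) * coef T b z := by
    intro c
    have himg : transition n c b '' overlap n c b = overlap n b c := by
      ext y
      constructor
      · rintro ⟨z, hz, rfl⟩
        exact transition_mem_overlap hz
      · intro hy
        exact ⟨transition n b c y, transition_mem_overlap hy, transition_transition hy⟩
    have hinj : InjOn (transition n c b) (overlap n c b) := fun y hy z hz hyz => by
      rw [← transition_transition hy, hyz, transition_transition hz]
    have hleft : ∫ z in (chartAt (Fin n → ℂ) c).target,
        partitionOfUnity n M c ((chartAt (Fin n → ℂ) c).symm z) * coef T c z =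
        ∫ z in overlap n c b,
          partitionOfUnity n M c ((chartAt (Fin n → ℂ) c).symm z) * coef T c z := by
      refine setIntegral_eq_of_subset_of_forall_sdiff_eq_zero
        (chartAt (Fin n → ℂ) c).open_target.measurableSet (fun z hz => (mem_overlap.1 hz).1)
        fun z hz => ?_
      rw [hcoef0, mul_zero]
      exact fun hzK => hz.2 (mem_overlap.2 ⟨hz.1, hKb hzK⟩)
    have hright : ∫ z in (chartAt (Fin n → ℂ) b).target,
        partitionOfUnity n M c ((chartAt (Fin n → ℂ) b).symm z) * coef T b z =
        ∫ z in overlap n b c,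
          partitionOfUnity n M c ((chartAt (Fin n → ℂ) b).symm z) * coef T b z := by
      refine setIntegral_eq_of_subset_of_forall_sdiff_eq_zero
        (chartAt (Fin n → ℂ) b).open_target.measurableSet (fun z hz => (mem_overlap.1 hz).1)
        fun z hz => ?_
      rw [show partitionOfUnity n M c ((chartAt (Fin n → ℂ) b).symm z) = 0 from
        image_eq_zero_of_notMem_tsupport fun hzc =>
          hz.2 (mem_overlap.2 ⟨hz.1, tsupport_partitionOfUnity_subset c hzc⟩), zero_mul]
    rw [hleft, hright, ← himg, integral_image_eq_integral_abs_det_fderiv_smul volume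
      (isOpen_overlap c b).measurableSet
      (fun z hz => ((differentiableAt_transition hz).restrictScalars ℝ).hasFDerivAt.hasFDerivWithinAt)
      hinj]
    refine setIntegral_congr_fun (isOpen_overlap c b).measurableSet fun z hz => ?_
    simp only [symm_transition hz, coef_transition T hz, smul_eq_mul,
      abs_of_pos (det_fderiv_transition_pos hz)]
    ring
  rw [formIntegral_eq_sum]
  simp only [hchange]
  -- All terms now live in the chart `b`, where the ρ_c add up to 1.
  rw [← integral_finsetSum]
  · simp only [← Finset.sum_mul, sum_partitionOfUnity, one_mul]
  · intro c _
    refine integrableOn_of_eq_zero_off_compact (chartAt (Fin n → ℂ) b).open_target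
      (isCompact_chart_image hK hKb) (chart_image_subset hKb)
      ((contDiffOn_partitionOfUnity c b).continuousOn.mul (hT b)) fun z hz hzK => ?_
    rw [hcoef0 _ _ (chart_symm_mem_of_notMem_image hz hzK), mul_zero]

end Integral

/-! ### Stokes' theorem and integration by parts on `M` -/

section Stokes

variable {n : ℕ} {M : Type*} [TopologicalSpace M] [ChartedSpace (Fin n → ℂ) M]

theorem contDiffOn_wedge_apply {V : Type*} [NormedAddCommGroup V] [NormedSpace ℝ V]
    {m : WithTop ℕ∞} {U : Set V} {Ω : Fin n → V → (Fin n → ℂ) [⋀^Fin 2]→L[ℝ] ℝ}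
    (h : ∀ i u v, ContDiffOn ℝ m (fun z => Ω i z ![u, v]) U) (e : Fin n × Fin 2 → Fin n → ℂ) :
    ContDiffOn ℝ m (fun z => wedge (fun i => Ω i z) e) U := by
  simp only [wedge_apply]
  refine contDiffOn_const.mul (ContDiffOn.sum fun σ _ => contDiffOn_const.mul
    (contDiffOn_prod fun i _ => ?_))
  simp only [vec_two_eta (fun j => e (σ (i, j)))]
  exact h i _ _

/-- The wedge product of `n` two-forms on `M`. -/
def wedgeForm {N : Type*} (Ω : Fin n → TwoForm n N) : TopForm n N := fun x => wedge fun i => Ω i x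

theorem wedgeForm_update {N : Type*} (Ω : Fin n → TwoForm n N) (j : Fin n) (θ : TwoForm n N)
    (x : N) :
    wedgeForm (Function.update Ω j θ) x = wedge (Function.update (fun i => Ω i x) j (θ x)) := by
  unfold wedgeForm
  congr 1
  funext i
  by_cases h : i = j
  · subst h; simp
  · simp [Function.update_of_ne h]

/-- Two-forms with smooth coefficients in all preferred charts. -/
def SmoothTwo (θ : TwoForm n M) : Prop :=
  ∀ (c : M) (u v : Fin n → ℂ),
    ContDiffOn ℝ ∞ (fun z => localRep θ c z ![u, v]) (chartAt (Fin n → ℂ) c).target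

/-- Smooth closed two-forms. -/
structure IsSmoothClosed (θ : TwoForm n M) : Prop where
  smooth : ∀ c : M, ContDiffOn ℝ ∞ (localRep θ c) (chartAt (Fin n → ℂ) c).target
  closed : ∀ c : M, ∀ z ∈ (chartAt (Fin n → ℂ) c).target, extDeriv (localRep θ c) z = 0

theorem IsKahlerForm.isSmoothClosed {w : TwoForm n M} (h : IsKahlerForm w) : IsSmoothClosed w :=
  ⟨h.smooth, h.closed⟩

theorem IsSmoothClosed.smoothTwo {θ : TwoForm n M} (h : IsSmoothClosed θ) : SmoothTwo θ :=
  fun c u v => contDiffOn_twoForm_apply (h.smooth c) u v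

theorem ContinuousTop.smul {T : TopForm n M} (hT : ContinuousTop T) {f : M → ℝ}
    (hf : Continuous f) : ContinuousTop fun x => f x • T x := fun c =>
  (hf.comp_continuousOn (chartAt (Fin n → ℂ) c).continuousOn_symm).mul (hT c)

theorem SmoothTwo.add {θ θ' : TwoForm n M} (h : SmoothTwo θ) (h' : SmoothTwo θ') :
    SmoothTwo fun x => θ x + θ' x := fun c u v => (h c u v).add (h' c u v)

theorem IsSmoothClosed.add {θ θ' : TwoForm n M} (h : IsSmoothClosed θ) (h' : IsSmoothClosed θ') :
    IsSmoothClosed fun x => θ x + θ' x where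
  smooth c := (h.smooth c).add (h'.smooth c)
  closed c z hz := by
    have hd : ∀ {η : TwoForm n M}, IsSmoothClosed η → DifferentiableAt ℝ (localRep η c) z :=
      fun hη => ((hη.smooth c).contDiffAt
        ((chartAt (Fin n → ℂ) c).open_target.mem_nhds hz)).differentiableAt (by simp)
    have : localRep (fun x => θ x + θ' x) c = localRep θ c + localRep θ' c := rfl
    rw [this, extDeriv_add (hd h) (hd h'), h.closed c z hz, h'.closed c z hz, add_zero]

theorem cross_eq_zero_of_notMem_tsupport {f : M → ℝ} (g : M → ℝ) {x : M} (hx : x ∉ tsupport f) :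
    (cross f g x : (Fin n → ℂ) [⋀^Fin 2]→L[ℝ] ℝ) = 0 := by
  have h0 : f ∘ (chartAt (Fin n → ℂ) x).symm =ᶠ[𝓝 (chartAt (Fin n → ℂ) x x)] fun _ => 0 := by
    have h1 : f =ᶠ[𝓝 x] 0 := notMem_tsupport_iff_eventuallyEq.1 hx
    have h2 : ContinuousAt (chartAt (Fin n → ℂ) x).symm (chartAt (Fin n → ℂ) x x) :=
      (chartAt (Fin n → ℂ) x).continuousAt_symm (mem_chart_target _ x)
    have h3 : Filter.Tendsto (chartAt (Fin n → ℂ) x).symm (𝓝 (chartAt (Fin n → ℂ) x x)) (𝓝 x) := by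
      have h4 := h2.tendsto
      rwa [(chartAt (Fin n → ℂ) x).left_inv (mem_chart_source _ x)] at h4
    exact h3.eventually h1
  unfold cross
  rw [h0.fderiv_eq]
  ext u
  rw [vec_two_eta u, crossForm_apply]
  simp

theorem SmoothTwo.update {Ω : Fin n → TwoForm n M} (hΩ : ∀ i, SmoothTwo (Ω i)) {j : Fin n}
    {θ : TwoForm n M} (hθ : SmoothTwo θ) (i : Fin n) : SmoothTwo (Function.update Ω j θ i) := by
  by_cases h : i = j
  · subst h; simpa using hθ
  · simpa [Function.update_of_ne h] using hΩ i

variable [IsManifold 𝓘(ℂ, Fin n → ℂ) ∞ M]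

theorem continuousTop_wedgeForm {Ω : Fin n → TwoForm n M} (hΩ : ∀ i, SmoothTwo (Ω i)) :
    ContinuousTop (wedgeForm Ω) := fun c =>
  (contDiffOn_wedge_apply (fun i u v => hΩ i c u v) (stdFrame n)).continuousOn.congr
    fun _ hz => coef_wedge Ω hz

theorem SmoothTwo.smul {θ : TwoForm n M} (h : SmoothTwo θ) {f : M → ℝ}
    (hf : ContMDiff 𝓘(ℝ, Fin n → ℂ) 𝓘(ℝ, ℝ) ∞ f) : SmoothTwo fun x => f x • θ x := fun c u v =>
  (contDiffOn_comp_chart_symm hf c).mul (h c u v)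

theorem isSmoothClosed_ddbar {f : M → ℝ} (hf : ContMDiff 𝓘(ℝ, Fin n → ℂ) 𝓘(ℝ, ℝ) ∞ f) :
    IsSmoothClosed (ddbar f : TwoForm n M) where
  smooth c := (contDiffOn_ddbarModel (chartAt (Fin n → ℂ) c).open_target
    (contDiffOn_comp_chart_symm hf c)).congr fun _ hz => localRep_ddbar hf hz
  closed c z hz := by
    have : localRep (ddbar f) c =ᶠ[𝓝 z] ddbarModel (f ∘ (chartAt (Fin n → ℂ) c).symm) := by
      filter_upwards [(chartAt (Fin n → ℂ) c).open_target.mem_nhds hz] with y hy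
      exact localRep_ddbar hf hy
    rw [this.extDeriv_eq, extDeriv_ddbarModel (chartAt (Fin n → ℂ) c).open_target
      (contDiffOn_comp_chart_symm hf c) hz]

theorem IsSmoothClosed.deform {w : TwoForm n M} (h : IsSmoothClosed w) {f : M → ℝ}
    (hf : ContMDiff 𝓘(ℝ, Fin n → ℂ) 𝓘(ℝ, ℝ) ∞ f) : IsSmoothClosed (deform w f) :=
  h.add (isSmoothClosed_ddbar hf)

theorem isTypeOneOne_ddbar {f : M → ℝ} (hf : ContMDiff 𝓘(ℝ, Fin n → ℂ) 𝓘(ℝ, ℝ) ∞ f) (x : M) :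
    IsTypeOneOne (ddbar f x : (Fin n → ℂ) [⋀^Fin 2]→L[ℝ] ℝ) :=
  isTypeOneOne_ddbarModel (contDiffAt_comp_chart_symm hf (mem_chart_target _ x))

theorem isTypeOneOne_deform {w : TwoForm n M} (h : ∀ x, IsTypeOneOne (w x)) {f : M → ℝ}
    (hf : ContMDiff 𝓘(ℝ, Fin n → ℂ) 𝓘(ℝ, ℝ) ∞ f) (x : M) : IsTypeOneOne (deform w f x) :=
  fun u v => congrArg₂ (· + ·) (h x u v) (isTypeOneOne_ddbar hf x u v)

theorem smoothTwo_cross {f g : M → ℝ} (hf : ContMDiff 𝓘(ℝ, Fin n → ℂ) 𝓘(ℝ, ℝ) ∞ f)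
    (hg : ContMDiff 𝓘(ℝ, Fin n → ℂ) 𝓘(ℝ, ℝ) ∞ g) : SmoothTwo (cross f g : TwoForm n M) := by
  intro c u v
  have hd : ∀ {h : M → ℝ}, ContMDiff 𝓘(ℝ, Fin n → ℂ) 𝓘(ℝ, ℝ) ∞ h → ∀ a : Fin n → ℂ,
      ContDiffOn ℝ ∞ (fun z => fderiv ℝ (h ∘ (chartAt (Fin n → ℂ) c).symm) z a)
        (chartAt (Fin n → ℂ) c).target := fun hh a =>
    (contDiffOn_fderiv_of_isOpen (chartAt (Fin n → ℂ) c).open_target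
      (contDiffOn_comp_chart_symm hh c)).clm_apply contDiffOn_const
  refine ContDiffOn.congr (f := fun z => -(1 / 2 : ℝ) *
    (fderiv ℝ (f ∘ (chartAt (Fin n → ℂ) c).symm) z u *
      fderiv ℝ (g ∘ (chartAt (Fin n → ℂ) c).symm) z (cplxJ n v) -
    fderiv ℝ (f ∘ (chartAt (Fin n → ℂ) c).symm) z v *
      fderiv ℝ (g ∘ (chartAt (Fin n → ℂ) c).symm) z (cplxJ n u))) ?_ fun z hz => ?_
  · exact contDiffOn_const.mul (((hd hf u).mul (hd hg _)).sub ((hd hf v).mul (hd hg _)))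
  · rw [localRep_cross hf hg hz, crossForm_apply]

theorem cross_add_left {f f' : M → ℝ} (hf : ContMDiff 𝓘(ℝ, Fin n → ℂ) 𝓘(ℝ, ℝ) ∞ f)
    (hf' : ContMDiff 𝓘(ℝ, Fin n → ℂ) 𝓘(ℝ, ℝ) ∞ f') (g : M → ℝ) (x : M) :
    (cross (f + f') g x : (Fin n → ℂ) [⋀^Fin 2]→L[ℝ] ℝ) = cross f g x + cross f' g x := by
  have hd : ∀ {h : M → ℝ}, ContMDiff 𝓘(ℝ, Fin n → ℂ) 𝓘(ℝ, ℝ) ∞ h →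
      DifferentiableAt ℝ (h ∘ (chartAt (Fin n → ℂ) x).symm) (chartAt (Fin n → ℂ) x x) := fun hh =>
    (contDiffAt_comp_chart_symm hh (mem_chart_target _ x)).differentiableAt (by simp)
  unfold cross
  rw [← crossForm_add_left, ← fderiv_add (hd hf) (hd hf')]
  rfl

/-- `½ d(f dᶜg)`. -/
def halfDDc (f g : M → ℝ) : TwoForm n M := fun x => cross f g x + f x • ddbar g x

theorem smoothTwo_halfDDc {f g : M → ℝ} (hf : ContMDiff 𝓘(ℝ, Fin n → ℂ) 𝓘(ℝ, ℝ) ∞ f)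
    (hg : ContMDiff 𝓘(ℝ, Fin n → ℂ) 𝓘(ℝ, ℝ) ∞ g) : SmoothTwo (halfDDc f g : TwoForm n M) :=
  (smoothTwo_cross hf hg).add ((isSmoothClosed_ddbar hg).smoothTwo.smul hf)

variable [T2Space M] [CompactSpace M]

/-- The integral can be computed in the chart containing the support of `f`, where `halfDDc f g` is
half of an exact form d(f dᶜg) with compactly supported primitive. -/
theorem formIntegral_wedge_halfDDc_of_tsupport {Ω : Fin n → TwoForm n M}
    (hΩ : ∀ i, IsSmoothClosed (Ω i)) (j : Fin n) {f g : M → ℝ}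
    (hf : ContMDiff 𝓘(ℝ, Fin n → ℂ) 𝓘(ℝ, ℝ) ∞ f)
    (hg : ContMDiff 𝓘(ℝ, Fin n → ℂ) 𝓘(ℝ, ℝ) ∞ g) {b : M}
    (hb : tsupport f ⊆ (chartAt (Fin n → ℂ) b).source) :
    formIntegral (wedgeForm (Function.update Ω j (halfDDc f g))) = 0 := by
  have hK : IsCompact (tsupport f) := (isClosed_tsupport f).isCompact
  rw [formIntegral_eq_setIntegral (continuousTop_wedgeForm
    (SmoothTwo.update (fun i => (hΩ i).smoothTwo) (smoothTwo_halfDDc hf hg))) hK hb]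
  · have hopen := (chartAt (Fin n → ℂ) b).open_target
    have hfb := contDiffOn_comp_chart_symm hf b
    have hgb := contDiffOn_comp_chart_symm hg b
    have hη : ContDiffOn ℝ ∞ (fun y => (f ∘ (chartAt (Fin n → ℂ) b).symm) y •
        dcModel (g ∘ (chartAt (Fin n → ℂ) b).symm) y) (chartAt (Fin n → ℂ) b).target :=
      hfb.smul (contDiffOn_dcModel hopen hgb)
    have hcoef : ∀ z ∈ (chartAt (Fin n → ℂ) b).target,
        coef (wedgeForm (Function.update Ω j (halfDDc f g))) b z =
        (1 / 2 : ℝ) * wedge (Function.update (fun i => localRep (Ω i) b z) j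
          (extDeriv (oneForm fun y => (f ∘ (chartAt (Fin n → ℂ) b).symm) y •
            dcModel (g ∘ (chartAt (Fin n → ℂ) b).symm) y) z)) (stdFrame n) := by
      intro z hz
      have hloc : localRep (halfDDc f g) b z = (1 / 2 : ℝ) • extDeriv (oneForm fun y =>
          (f ∘ (chartAt (Fin n → ℂ) b).symm) y •
            dcModel (g ∘ (chartAt (Fin n → ℂ) b).symm) y) z := by
        rw [extDeriv_smul_dcModel (contDiffAt_comp_chart_symm hf hz)
          (contDiffAt_comp_chart_symm hg hz), ← localRep_cross hf hg hz, ← localRep_ddbar hg hz]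
        rfl
      refine (coef_wedge _ hz).trans ?_
      have : (fun i => localRep (Function.update Ω j (halfDDc f g) i) b z) =
          Function.update (fun i => localRep (Ω i) b z) j (localRep (halfDDc f g) b z) := by
        funext i
        by_cases h : i = j
        · subst h; simp
        · simp [Function.update_of_ne h]
      rw [this, hloc, wedge_update_smul]
      rfl
    rw [setIntegral_congr_fun hopen.measurableSet hcoef, integral_const_mul,
      setIntegral_wedge_extDeriv_eq_zero hopen (isCompact_chart_image hK hb)
        (chart_image_subset hb) (hη.of_le (by simp)) (fun z hz hzK => ?_)
        (fun i => ((hΩ i).smooth b).of_le (by simp)) (fun i => (hΩ i).closed b) j, mul_zero]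
    have h0 : f ((chartAt (Fin n → ℂ) b).symm z) = 0 :=
      image_eq_zero_of_notMem_tsupport (chart_symm_mem_of_notMem_image hz hzK)
    simp [h0]
  · intro x hx
    have h0 : (halfDDc f g : TwoForm n M) x = (0 : ℝ) • halfDDc f g x := by
      rw [zero_smul]
      simp only [halfDDc, cross_eq_zero_of_notMem_tsupport g hx,
        image_eq_zero_of_notMem_tsupport hx, zero_smul, add_zero]
    rw [wedgeForm_update, h0, wedge_update_smul, zero_smul]

/-- Stokes' theorem for `f dᶜg ∧ ⋀_{i ≠ j} Ω_i`. -/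
theorem formIntegral_wedge_halfDDc {Ω : Fin n → TwoForm n M}
    (hΩ : ∀ i, IsSmoothClosed (Ω i)) (j : Fin n) {f g : M → ℝ}
    (hf : ContMDiff 𝓘(ℝ, Fin n → ℂ) 𝓘(ℝ, ℝ) ∞ f)
    (hg : ContMDiff 𝓘(ℝ, Fin n → ℂ) 𝓘(ℝ, ℝ) ∞ g) :
    formIntegral (wedgeForm (Function.update Ω j (halfDDc f g))) = 0 := by
  let P : (M → ℝ) → Prop := fun h => ContMDiff 𝓘(ℝ, Fin n → ℂ) 𝓘(ℝ, ℝ) ∞ h ∧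
    formIntegral (wedgeForm (Function.update Ω j (halfDDc h g))) = 0
  have hcont : ∀ {h : M → ℝ}, ContMDiff 𝓘(ℝ, Fin n → ℂ) 𝓘(ℝ, ℝ) ∞ h →
      ContinuousTop (wedgeForm (Function.update Ω j (halfDDc h g))) := fun hh =>
    continuousTop_wedgeForm
      (SmoothTwo.update (fun i => (hΩ i).smoothTwo) (smoothTwo_halfDDc hh hg))
  have hadd : ∀ h h', P h → P h' → P (h + h') := by
    rintro h h' ⟨h1, h2⟩ ⟨h1', h2'⟩
    refine ⟨h1.add h1', ?_⟩
    have h3 : wedgeForm (Function.update Ω j (halfDDc (h + h') g)) = fun x =>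
        wedgeForm (Function.update Ω j (halfDDc h g)) x +
          wedgeForm (Function.update Ω j (halfDDc h' g)) x := by
      funext x
      rw [wedgeForm_update, wedgeForm_update, wedgeForm_update, ← wedge_update_add]
      congr 2
      simp only [halfDDc, cross_add_left h1 h1', Pi.add_apply, add_smul]
      abel
    rw [h3, formIntegral_add (hcont h1) (hcont h1'), h2, h2', add_zero]
  -- The statement is additive in `f`, so it is enough to prove it for each ρ_b f, which is
  -- supported in one chart.
  have hsum : f = ∑ b ∈ chartIndices n M, fun x => partitionOfUnity n M b x * f x := by
    funext x
    rw [Finset.sum_apply, ← Finset.sum_mul, sum_partitionOfUnity, one_mul]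
  have hb : ∀ b : M, P fun x => partitionOfUnity n M b x * f x := fun b => by
    have hs : ContMDiff 𝓘(ℝ, Fin n → ℂ) 𝓘(ℝ, ℝ) ∞ fun x => partitionOfUnity n M b x * f x :=
      (partitionOfUnity n M b).contMDiff.mul hf
    exact ⟨hs, formIntegral_wedge_halfDDc_of_tsupport hΩ j hs hg
      ((tsupport_mul_subset_left).trans (tsupport_partitionOfUnity_subset b))⟩
  have hzero : P 0 := by
    have hs : ContMDiff 𝓘(ℝ, Fin n → ℂ) 𝓘(ℝ, ℝ) ∞ (0 : M → ℝ) := contMDiff_const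
    refine ⟨hs, ?_⟩
    have h3 : wedgeForm (Function.update Ω j (halfDDc (0 : M → ℝ) g)) = fun x =>
        (0 : ℝ) • wedgeForm (Function.update Ω j (halfDDc (0 : M → ℝ) g)) x := by
      funext x
      rw [wedgeForm_update, ← wedge_update_smul]
      congr 2
      rw [zero_smul]
      simp only [halfDDc, cross_eq_zero_of_notMem_tsupport g
        (show x ∉ tsupport (0 : M → ℝ) by simp [tsupport]), Pi.zero_apply, zero_smul, add_zero]
    rw [h3, formIntegral_smul, zero_mul]
  have := Finset.sum_induction (s := chartIndices n M)
    (fun b => fun x => partitionOfUnity n M b x * f x) P hadd hzero fun b _ => hb b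
  rw [← hsum] at this
  exact this.2

/-- Integration by parts: `∫ f √-1∂∂̄g ∧ Θ = - ∫ ½ df ∧ dᶜg ∧ Θ`. -/
theorem formIntegral_smul_wedge_ddbar {Ω : Fin n → TwoForm n M}
    (hΩ : ∀ i, IsSmoothClosed (Ω i)) (j : Fin n) {f g : M → ℝ}
    (hf : ContMDiff 𝓘(ℝ, Fin n → ℂ) 𝓘(ℝ, ℝ) ∞ f)
    (hg : ContMDiff 𝓘(ℝ, Fin n → ℂ) 𝓘(ℝ, ℝ) ∞ g) :
    formIntegral (fun x => f x • wedgeForm (Function.update Ω j (ddbar g)) x) =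
      -formIntegral (wedgeForm (Function.update Ω j (cross f g))) := by
  have h := formIntegral_wedge_halfDDc hΩ j hf hg
  have h3 : wedgeForm (Function.update Ω j (halfDDc f g)) = fun x =>
      wedgeForm (Function.update Ω j (cross f g)) x +
        f x • wedgeForm (Function.update Ω j (ddbar g)) x := by
    funext x
    rw [wedgeForm_update, wedgeForm_update, wedgeForm_update, ← wedge_update_smul,
      ← wedge_update_add]
    rfl
  rw [h3, formIntegral_add
    (continuousTop_wedgeForm (SmoothTwo.update (fun i => (hΩ i).smoothTwo) (smoothTwo_cross hf hg)))
    ((continuousTop_wedgeForm (SmoothTwo.update (fun i => (hΩ i).smoothTwo)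
      (isSmoothClosed_ddbar hg).smoothTwo)).smul hf.continuous)] at h
  linarith

/-- After integration by parts both sides involve ½ df ∧ dᶜg and ½ dg ∧ dᶜf. Pulling back by `i`
exchanges these two forms and fixes the (1,1)-forms Ω_i as well as all top forms. -/
theorem formIntegral_smul_wedge_ddbar_comm {Ω : Fin n → TwoForm n M}
    (hΩ : ∀ i, IsSmoothClosed (Ω i)) (h11 : ∀ i x, IsTypeOneOne (Ω i x)) (j : Fin n) {f g : M → ℝ}
    (hf : ContMDiff 𝓘(ℝ, Fin n → ℂ) 𝓘(ℝ, ℝ) ∞ f)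
    (hg : ContMDiff 𝓘(ℝ, Fin n → ℂ) 𝓘(ℝ, ℝ) ∞ g) :
    formIntegral (fun x => f x • wedgeForm (Function.update Ω j (ddbar g)) x) =
      formIntegral (fun x => g x • wedgeForm (Function.update Ω j (ddbar f)) x) := by
  rw [formIntegral_smul_wedge_ddbar hΩ j hf hg, formIntegral_smul_wedge_ddbar hΩ j hg hf]
  congr 2
  funext x
  rw [wedgeForm_update, wedgeForm_update, ← wedge_comp_cplxJ]
  congr 1
  funext i
  by_cases h : i = j
  · subst h
    simp only [Function.update_self]
    exact crossForm_comp_cplxJ _ _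
  · simp only [Function.update_of_ne h]
    ext u
    rw [vec_two_eta u, ← h11 i x]
    rw [ContinuousAlternatingMap.compContinuousLinearMap_apply]
    congr 1
    funext a; fin_cases a <;> rfl

/-- By parts this is minus the integral of ½ df ∧ dᶜf ∧ ⋀ Ω_i, a wedge of semipositive (1,1)-forms.
-/
theorem formIntegral_smul_wedge_ddbar_self_nonpos {Ω : Fin n → TwoForm n M}
    (hΩ : ∀ i, IsSmoothClosed (Ω i)) (h11 : ∀ i x, IsTypeOneOne (Ω i x))
    (hpos : ∀ i, IsPositive (Ω i)) (j : Fin n) {f : M → ℝ}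
    (hf : ContMDiff 𝓘(ℝ, Fin n → ℂ) 𝓘(ℝ, ℝ) ∞ f) :
    formIntegral (fun x => f x • wedgeForm (Function.update Ω j (ddbar f)) x) ≤ 0 := by
  rw [formIntegral_smul_wedge_ddbar hΩ j hf hf, neg_nonpos]
  refine formIntegral_nonneg fun x => wedge_stdFrame_nonneg (fun i => ?_) fun i v => ?_
  · by_cases h : i = j
    · subst h
      simp only [Function.update_self]
      exact isTypeOneOne_crossForm_self _
    · simp only [Function.update_of_ne h]
      exact h11 i x
  · by_cases h : i = j
    · subst h
      simp only [Function.update_self]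
      exact crossForm_self_nonneg _ v
    · simp only [Function.update_of_ne h]
      by_cases hv : v = 0
      · subst hv
        have h0 := twoForm_smul_left (Ω i x) 0 0 (cplxJ n 0)
        rw [zero_smul, zero_mul] at h0
        exact h0.ge
      · exact (hpos i x v hv).le

end Stokes

/-! ### Differentiation in a real parameter, pointwise and under the integral -/

section Slices

variable {V F : Type*} [NormedAddCommGroup V] [NormedSpace ℝ V]

theorem fderiv_slice_right {h : ℝ × V → ℝ} {t : ℝ} {z : V} (hh : DifferentiableAt ℝ h (t, z))
    (u : V) : fderiv ℝ (fun y => h (t, y)) z u = fderiv ℝ h (t, z) (0, u) := by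
  have := hh.hasFDerivAt.comp z (hasFDerivAt_prodMk_right (𝕜 := ℝ) t z)
  rw [show (fun y => h (t, y)) = h ∘ fun y => (t, y) from rfl, this.fderiv]
  rfl

theorem hasDerivAt_slice_left {h : ℝ × V → ℝ} {t : ℝ} {z : V} (hh : DifferentiableAt ℝ h (t, z)) :
    HasDerivAt (fun s => h (s, z)) (fderiv ℝ h (t, z) (1, 0)) t := by
  have h1 := hh.hasFDerivAt.comp t (hasFDerivAt_prodMk_left (𝕜 := ℝ) t z)
  exact h1.hasDerivAt

theorem fderiv_fderiv_comm {h : V → ℝ} {p : V} (hh : ContDiffAt ℝ ∞ h p) (a b : V) :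
    fderiv ℝ (fun q => fderiv ℝ h q a) p b = fderiv ℝ (fun q => fderiv ℝ h q b) p a := by
  have hd : DifferentiableAt ℝ (fderiv ℝ h) p :=
    (hh.fderiv_right (m := 1) one_add_one_le_infty).differentiableAt one_ne_zero
  have key : ∀ a b, fderiv ℝ (fun q => fderiv ℝ h q a) p b = fderiv ℝ (fderiv ℝ h) p b a :=
    fun a b => by
      rw [fderiv_clm_apply hd (differentiableAt_const a)]
      simp
  rw [key, key]
  exact hh.isSymmSndFDerivAt minSmoothness_two_le_infty b a

variable {U : Set V} {G : ℝ × V → ℝ}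

theorem contDiffOn_fderiv_apply {O : Set V} (hO : IsOpen O) {h : V → ℝ}
    (hh : ContDiffOn ℝ ∞ h O) (a : V) : ContDiffOn ℝ ∞ (fun q => fderiv ℝ h q a) O :=
  (contDiffOn_fderiv_of_isOpen hO hh).clm_apply contDiffOn_const

theorem fderiv_fderiv_slice (hU : IsOpen U) (hG : ContDiffOn ℝ ∞ G (univ ×ˢ U)) (t : ℝ) {z : V}
    (hz : z ∈ U) (u w : V) :
    fderiv ℝ (fderiv ℝ fun y => G (t, y)) z u w =
      fderiv ℝ (fun q => fderiv ℝ G q (0, w)) (t, z) (0, u) := by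
  have hO : IsOpen ((univ : Set ℝ) ×ˢ U) := isOpen_univ.prod hU
  have hsm : ContDiffOn ℝ ∞ (fun y => G (t, y)) U :=
    hG.comp (contDiff_prodMk_right t).contDiffOn fun y hy => ⟨mem_univ _, hy⟩
  have hd : DifferentiableAt ℝ (fderiv ℝ fun y => G (t, y)) z :=
    ((contDiffOn_fderiv_of_isOpen hU hsm).contDiffAt (hU.mem_nhds hz)).differentiableAt (by simp)
  have h1 : fderiv ℝ (fun y => fderiv ℝ (fun y => G (t, y)) y w) z u =
      fderiv ℝ (fderiv ℝ fun y => G (t, y)) z u w := by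
    rw [fderiv_clm_apply hd (differentiableAt_const w)]
    simp
  have h2 : (fun y => fderiv ℝ (fun y => G (t, y)) y w) =ᶠ[𝓝 z]
      fun y => fderiv ℝ G (t, y) (0, w) := by
    filter_upwards [hU.mem_nhds hz] with y hy
    exact fderiv_slice_right ((hG.contDiffAt (hO.mem_nhds ⟨mem_univ _, hy⟩)).differentiableAt
      (by simp)) w
  rw [← h1, h2.fderiv_eq]
  exact fderiv_slice_right (h := fun q => fderiv ℝ G q (0, w))
    (((contDiffOn_fderiv_apply hO hG _).contDiffAt
      (hO.mem_nhds ⟨mem_univ _, hz⟩)).differentiableAt (by simp)) u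

/-- The parameter derivative commutes with the spatial Hessian: both are iterated partial
derivatives of the jointly smooth function `G`. -/
theorem hasDerivAt_fderiv_fderiv_slice (hU : IsOpen U) (hG : ContDiffOn ℝ ∞ G (univ ×ˢ U)) (t : ℝ)
    {z : V} (hz : z ∈ U) (u w : V) :
    HasDerivAt (fun s => fderiv ℝ (fderiv ℝ fun y => G (s, y)) z u w)
      (fderiv ℝ (fderiv ℝ fun y => fderiv ℝ G (t, y) (1, 0)) z u w) t := by
  have hO : IsOpen ((univ : Set ℝ) ×ˢ U) := isOpen_univ.prod hU
  have hp : ((t, z) : ℝ × V) ∈ (univ : Set ℝ) ×ˢ U := ⟨mem_univ _, hz⟩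
  have hw := contDiffOn_fderiv_apply hO hG (0, w)
  have hwu := contDiffOn_fderiv_apply hO hw (0, u)
  have h1 := hasDerivAt_slice_left (h := fun p => fderiv ℝ (fun q => fderiv ℝ G q (0, w)) p (0, u))
    (t := t) (z := z) ((hwu.contDiffAt (hO.mem_nhds hp)).differentiableAt (by simp))
  have h2 : (fun s => fderiv ℝ (fderiv ℝ fun y => G (s, y)) z u w) =
      fun s => fderiv ℝ (fun q => fderiv ℝ G q (0, w)) (s, z) (0, u) :=
    funext fun s => fderiv_fderiv_slice hU hG s hz u w
  rw [h2, fderiv_fderiv_slice (G := fun q => fderiv ℝ G q (1, 0)) hU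
    (contDiffOn_fderiv_apply hO hG (1, 0)) t hz u w]
  convert h1 using 1
  -- The parameter direction (1, 0) is moved past the spatial directions one at a time, first (0,
  -- u), then (0, w).
  rw [fderiv_fderiv_comm (hw.contDiffAt (hO.mem_nhds hp))]
  have h3 : (fun q => fderiv ℝ (fun q => fderiv ℝ G q (0, w)) q (1, 0)) =ᶠ[𝓝 (t, z)]
      fun q => fderiv ℝ (fun q => fderiv ℝ G q (1, 0)) q (0, w) := by
    filter_upwards [hO.mem_nhds hp] with q hq
    exact fderiv_fderiv_comm (hG.contDiffAt (hO.mem_nhds hq)) _ _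
  rw [h3.fderiv_eq]

end Slices

section DdbarSlices

variable {n : ℕ} {U : Set (Fin n → ℂ)} {G : ℝ × (Fin n → ℂ) → ℝ}

theorem ddbarModel_slice (hU : IsOpen U) (hG : ContDiffOn ℝ ∞ G (univ ×ˢ U)) (t : ℝ)
    {z : Fin n → ℂ} (hz : z ∈ U) (u v : Fin n → ℂ) :
    ddbarModel (fun y => G (t, y)) z ![u, v] = -(1 / 2 : ℝ) *
      (fderiv ℝ (fderiv ℝ fun y => G (t, y)) z u (cplxJ n v) -
        fderiv ℝ (fderiv ℝ fun y => G (t, y)) z v (cplxJ n u)) := by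
  have hsm : ContDiffOn ℝ ∞ (fun y => G (t, y)) U :=
    hG.comp (contDiff_prodMk_right t).contDiffOn fun y hy => ⟨mem_univ _, hy⟩
  exact ddbarModel_apply (((contDiffOn_fderiv_of_isOpen hU hsm).contDiffAt
    (hU.mem_nhds hz)).differentiableAt (by simp)) u v

theorem contDiffOn_ddbarModel_slice (hU : IsOpen U) (hG : ContDiffOn ℝ ∞ G (univ ×ˢ U))
    (u v : Fin n → ℂ) :
    ContDiffOn ℝ ∞ (fun p : ℝ × (Fin n → ℂ) => ddbarModel (fun y => G (p.1, y)) p.2 ![u, v])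
      (univ ×ˢ U) := by
  have hO : IsOpen ((univ : Set ℝ) ×ˢ U) := isOpen_univ.prod hU
  have hQ : ∀ a b : Fin n → ℂ, ContDiffOn ℝ ∞
      (fun p => fderiv ℝ (fun q => fderiv ℝ G q (0, b)) p (0, a)) ((univ : Set ℝ) ×ˢ U) :=
    fun a b => contDiffOn_fderiv_apply hO (contDiffOn_fderiv_apply hO hG _) _
  refine (contDiffOn_const (c := -(1 / 2 : ℝ)).mul
    ((hQ u (cplxJ n v)).sub (hQ v (cplxJ n u)))).congr fun p hp => ?_
  rw [ddbarModel_slice hU hG p.1 hp.2, fderiv_fderiv_slice hU hG p.1 hp.2,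
    fderiv_fderiv_slice hU hG p.1 hp.2]

theorem hasDerivAt_ddbarModel_slice (hU : IsOpen U) (hG : ContDiffOn ℝ ∞ G (univ ×ˢ U)) (t : ℝ)
    {z : Fin n → ℂ} (hz : z ∈ U) (u v : Fin n → ℂ) :
    HasDerivAt (fun s => ddbarModel (fun y => G (s, y)) z ![u, v])
      (ddbarModel (fun y => fderiv ℝ G (t, y) (1, 0)) z ![u, v]) t := by
  have hO : IsOpen ((univ : Set ℝ) ×ˢ U) := isOpen_univ.prod hU
  have h2 : (fun s => ddbarModel (fun y => G (s, y)) z ![u, v]) = fun s => -(1 / 2 : ℝ) *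
      (fderiv ℝ (fderiv ℝ fun y => G (s, y)) z u (cplxJ n v) -
        fderiv ℝ (fderiv ℝ fun y => G (s, y)) z v (cplxJ n u)) :=
    funext fun s => ddbarModel_slice hU hG s hz u v
  rw [h2, ddbarModel_slice (G := fun q => fderiv ℝ G q (1, 0)) hU
    (contDiffOn_fderiv_apply hO hG (1, 0)) t hz]
  exact ((hasDerivAt_fderiv_fderiv_slice hU hG t hz u _).sub
    (hasDerivAt_fderiv_fderiv_slice hU hG t hz v _)).const_mul _

end DdbarSlices

/-- The extension of `P` by zero is C¹ on the whole product. Over the compact set `K` and for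
parameters in [t-1, t+1] its parameter derivative is bounded by a constant, which serves as
dominating function. -/
theorem hasDerivAt_setIntegral_slice {V : Type*} [NormedAddCommGroup V] [NormedSpace ℝ V]
    [MeasurableSpace V] [BorelSpace V] {μ : Measure V} [IsFiniteMeasureOnCompacts μ]
    {U K : Set V} (hU : IsOpen U) (hK : IsCompact K) (hKU : K ⊆ U) {P P' : ℝ × V → ℝ}
    (hP : ContDiffOn ℝ 1 P (univ ×ˢ U)) (h0 : ∀ t, ∀ z ∈ U, z ∉ K → P (t, z) = 0)
    (hP' : ∀ t, ∀ z ∈ U, HasDerivAt (fun s => P (s, z)) (P' (t, z)) t) (t : ℝ) :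
    HasDerivAt (fun s => ∫ z in U, P (s, z) ∂μ) (∫ z in U, P' (t, z) ∂μ) t := by
  have hO : IsOpen ((univ : Set ℝ) ×ˢ U) := isOpen_univ.prod hU
  have hg : ContDiff ℝ 1 (((univ : Set ℝ) ×ˢ U).indicator P) :=
    contDiff_indicator_of_eq_zero (K := univ ×ˢ K) hO (isClosed_univ.prod hK.isClosed)
      (prod_mono subset_rfl hKU) hP fun p hp hpK =>
        h0 p.1 p.2 hp.2 fun h => hpK ⟨mem_univ _, h⟩
  set g := ((univ : Set ℝ) ×ˢ U).indicator P with hgdef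
  have hgU : ∀ s, ∀ z ∈ U, g (s, z) = P (s, z) := fun s z hz =>
    indicator_of_mem (s := (univ : Set ℝ) ×ˢ U) ⟨mem_univ s, hz⟩ P
  have hderiv : ∀ s z, HasDerivAt (fun s => g (s, z)) (fderiv ℝ g (s, z) (1, 0)) s := fun s z =>
    hasDerivAt_slice_left (hg.differentiable one_ne_zero _)
  have hd : ∀ s, ∀ z ∈ U, fderiv ℝ g (s, z) (1, 0) = P' (s, z) := fun s z hz => by
    refine (hderiv s z).unique ?_
    simp only [hgU _ z hz]
    exact hP' s z hz
  have hP0 : ∀ s, ∀ z ∈ U, z ∉ K → P' (s, z) = 0 := fun s z hz hzK => by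
    refine (hP' s z hz).unique ?_
    simp only [h0 _ z hz hzK]
    exact hasDerivAt_const _ _
  have hKm : MeasurableSet K := hK.isClosed.measurableSet
  have hres : ∀ s, ∫ z in U, P (s, z) ∂μ = ∫ z in K, g (s, z) ∂μ := fun s => by
    rw [setIntegral_eq_of_subset_of_forall_sdiff_eq_zero hU.measurableSet hKU
      fun z hz => h0 s z hz.1 hz.2]
    exact setIntegral_congr_fun hKm fun z hz => (hgU s z (hKU hz)).symm
  have hres' : ∫ z in U, P' (t, z) ∂μ = ∫ z in K, fderiv ℝ g (t, z) (1, 0) ∂μ := by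
    rw [setIntegral_eq_of_subset_of_forall_sdiff_eq_zero hU.measurableSet hKU
      fun z hz => hP0 t z hz.1 hz.2]
    exact setIntegral_congr_fun hKm fun z hz => (hd t z (hKU hz)).symm
  have hcd : Continuous fun p => fderiv ℝ g p (1, 0) :=
    (hg.continuous_fderiv one_ne_zero).clm_apply continuous_const
  obtain ⟨C, hC⟩ := ((isCompact_Icc (a := t - 1) (b := t + 1)).prod hK).exists_bound_of_continuousOn
    hcd.continuousOn
  have hmu : IsFiniteMeasure (μ.restrict K) := ⟨by
    rw [Measure.restrict_apply_univ]; exact hK.measure_lt_top⟩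
  have hslice : ∀ s, Continuous fun z => g (s, z) := fun s =>
    hg.continuous.comp (Continuous.prodMk_right s)
  rw [hres']
  simp only [hres]
  refine (hasDerivAt_integral_of_dominated_loc_of_deriv_le (F := fun s z => g (s, z))
    (F' := fun s z => fderiv ℝ g (s, z) (1, 0)) (bound := fun _ => C) (s := Icc (t - 1) (t + 1))
    (Icc_mem_nhds (by linarith) (by linarith)) ?_ ?_ ?_ ?_ ?_ ?_).2
  · exact Filter.Eventually.of_forall fun s =>
      ((hslice s).continuousOn.integrableOn_compact hK).aestronglyMeasurable
  · exact (hslice t).continuousOn.integrableOn_compact hK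
  · exact ((hcd.comp (Continuous.prodMk_right t)).continuousOn.integrableOn_compact
      hK).aestronglyMeasurable
  · exact (ae_restrict_mem hKm).mono fun z hz s hs => hC (s, z) ⟨hs, hz⟩
  · exact integrable_const C
  · exact Filter.Eventually.of_forall fun z s _ => hderiv s z

theorem continuous_setIntegral_slice {V : Type*} [NormedAddCommGroup V] [NormedSpace ℝ V]
    [MeasurableSpace V] [BorelSpace V] {μ : Measure V} [IsLocallyFiniteMeasure μ]
    {U K : Set V} (hU : IsOpen U) (hK : IsCompact K) (hKU : K ⊆ U) {P : ℝ × V → ℝ}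
    (hP : ContinuousOn P (univ ×ˢ U)) (h0 : ∀ t, ∀ z ∈ U, z ∉ K → P (t, z) = 0) :
    Continuous fun s => ∫ z in U, P (s, z) ∂μ := by
  have hO : IsOpen ((univ : Set ℝ) ×ˢ U) := isOpen_univ.prod hU
  have hg : Continuous (((univ : Set ℝ) ×ˢ U).indicator P) :=
    (contDiff_indicator_of_eq_zero (m := 0) (K := univ ×ˢ K) hO (isClosed_univ.prod hK.isClosed)
      (prod_mono subset_rfl hKU) (contDiffOn_zero.2 hP) fun p hp hpK =>
        h0 p.1 p.2 hp.2 fun h => hpK ⟨mem_univ _, h⟩).continuous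
  have hres : ∀ s, ∫ z in U, P (s, z) ∂μ =
      ∫ z in K, ((univ : Set ℝ) ×ˢ U).indicator P (s, z) ∂μ := fun s => by
    rw [setIntegral_eq_of_subset_of_forall_sdiff_eq_zero hU.measurableSet hKU
      fun z hz => h0 s z hz.1 hz.2]
    exact setIntegral_congr_fun hK.isClosed.measurableSet fun z hz =>
      (indicator_of_mem (s := (univ : Set ℝ) ×ˢ U) ⟨mem_univ s, hKU hz⟩ P).symm
  simp only [hres]
  exact continuous_parametric_integral_of_continuous
    (f := fun s z => ((univ : Set ℝ) ×ˢ U).indicator P (s, z)) hg hK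

theorem hasDerivAt_wedge {n : ℕ} {Ω : Fin n → ℝ → (Fin n → ℂ) [⋀^Fin 2]→L[ℝ] ℝ}
    {Ω' : Fin n → (Fin n → ℂ) [⋀^Fin 2]→L[ℝ] ℝ} {t : ℝ}
    (h : ∀ i u v, HasDerivAt (fun s => Ω i s ![u, v]) (Ω' i ![u, v]) t)
    (e : Fin n × Fin 2 → Fin n → ℂ) :
    HasDerivAt (fun s => wedge (fun i => Ω i s) e)
      (∑ l, wedge (Function.update (fun i => Ω i t) l (Ω' l)) e) t := by
  simp only [wedge_apply]
  have h1 : ∀ σ : Equiv.Perm (Fin n × Fin 2),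
      HasDerivAt (fun s => ∏ i, Ω i s (fun j => e (σ (i, j))))
        (∑ l, ∏ i, Function.update (fun i => Ω i t) l (Ω' l) i (fun j => e (σ (i, j)))) t := by
    intro σ
    have h2 := HasDerivAt.fun_finsetProd (u := Finset.univ) (x := t)
      (f := fun i s => Ω i s (fun j => e (σ (i, j))))
      (f' := fun i => Ω' i (fun j => e (σ (i, j)))) fun i _ => by
        rw [vec_two_eta fun j => e (σ (i, j))]
        exact h i _ _
    refine h2.congr_deriv ?_
    refine Finset.sum_congr rfl fun l _ => ?_
    rw [← Finset.prod_erase_mul Finset.univ _ (Finset.mem_univ l), Function.update_self,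
      smul_eq_mul]
    congr 1
    exact Finset.prod_congr rfl fun i hi => by
      rw [Function.update_of_ne (Finset.ne_of_mem_erase hi)]
  have h3 := (HasDerivAt.fun_sum (u := Finset.univ) fun σ _ =>
    (h1 σ).const_mul (((Equiv.Perm.sign σ : ℤ) : ℝ))).const_mul ((2 : ℝ) ^ n)⁻¹
  refine h3.congr_deriv ?_
  rw [← Finset.mul_sum]
  congr 1
  simp only [Finset.mul_sum]
  rw [Finset.sum_comm]

/-! ### Smooth families of potentials and mixed powers -/

section Families

variable {n : ℕ} {M : Type*} [TopologicalSpace M] [ChartedSpace (Fin n → ℂ) M]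

variable (n) in
/-- Families of functions on `M` that depend smoothly on the point and on a real parameter. -/
def SmoothFamily (F : ℝ → M → ℝ) : Prop :=
  ∀ c : M, ContDiffOn ℝ ∞ (fun p : ℝ × (Fin n → ℂ) => F p.1 ((chartAt (Fin n → ℂ) c).symm p.2))
    (univ ×ˢ (chartAt (Fin n → ℂ) c).target)

/-- The derivative of a family of functions with respect to the parameter. -/
def velocity {N : Type*} (F : ℝ → N → ℝ) (t : ℝ) (x : N) : ℝ := deriv (fun s => F s x) t

theorem isOpen_univ_prod_target (c : M) :
    IsOpen ((univ : Set ℝ) ×ˢ (chartAt (Fin n → ℂ) c).target) :=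
  isOpen_univ.prod (chartAt (Fin n → ℂ) c).open_target

theorem SmoothFamily.hasDerivAt_chart {F : ℝ → M → ℝ} (hF : SmoothFamily n F) (c : M) (t : ℝ)
    {z : Fin n → ℂ} (hz : z ∈ (chartAt (Fin n → ℂ) c).target) :
    HasDerivAt (fun s => F s ((chartAt (Fin n → ℂ) c).symm z))
      (fderiv ℝ (fun p : ℝ × (Fin n → ℂ) => F p.1 ((chartAt (Fin n → ℂ) c).symm p.2))
        (t, z) (1, 0)) t :=
  hasDerivAt_slice_left
    (h := fun p : ℝ × (Fin n → ℂ) => F p.1 ((chartAt (Fin n → ℂ) c).symm p.2))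
    (((hF c).contDiffAt ((isOpen_univ_prod_target c).mem_nhds ⟨mem_univ _, hz⟩)).differentiableAt
      (by simp))

theorem SmoothFamily.velocity_chart {F : ℝ → M → ℝ} (hF : SmoothFamily n F) (c : M) (t : ℝ)
    {z : Fin n → ℂ} (hz : z ∈ (chartAt (Fin n → ℂ) c).target) :
    velocity F t ((chartAt (Fin n → ℂ) c).symm z) =
      fderiv ℝ (fun p : ℝ × (Fin n → ℂ) => F p.1 ((chartAt (Fin n → ℂ) c).symm p.2))
        (t, z) (1, 0) :=
  (hF.hasDerivAt_chart c t hz).deriv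

theorem SmoothFamily.velocity {F : ℝ → M → ℝ} (hF : SmoothFamily n F) :
    SmoothFamily n (velocity F) := fun c =>
  (contDiffOn_fderiv_apply (isOpen_univ_prod_target c) (hF c) (1, 0)).congr fun p hp =>
    hF.velocity_chart c p.1 hp.2

theorem SmoothFamily.hasDerivAt {F : ℝ → M → ℝ} (hF : SmoothFamily n F) (x : M) (t : ℝ) :
    HasDerivAt (fun s => F s x) (KahlerJ.velocity F t x) t := by
  have h := hF.hasDerivAt_chart x t (mem_chart_target (Fin n → ℂ) x)
  rw [← hF.velocity_chart x t (mem_chart_target (Fin n → ℂ) x)] at h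
  simpa only [(chartAt (Fin n → ℂ) x).left_inv (mem_chart_source (Fin n → ℂ) x)] using h

theorem SmoothFamily.hasDerivAt_ddbar {F : ℝ → M → ℝ} (hF : SmoothFamily n F) (x : M) (t : ℝ)
    (u v : Fin n → ℂ) : HasDerivAt (fun s => (ddbar (F s) : TwoForm n M) x ![u, v])
      ((ddbar (KahlerJ.velocity F t) : TwoForm n M) x ![u, v]) t := by
  have h := hasDerivAt_ddbarModel_slice (chartAt (Fin n → ℂ) x).open_target (hF x) t
    (mem_chart_target (Fin n → ℂ) x) u v
  refine h.congr_deriv ?_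
  unfold ddbar
  congr 1
  refine ddbarModel_congr ?_
  filter_upwards [(chartAt (Fin n → ℂ) x).open_target.mem_nhds (mem_chart_target _ x)] with z hz
  exact (hF.velocity_chart x t hz).symm

theorem wedgePow_self_left {N : Type*} (w : TwoForm n N) (k : ℕ) : wedgePow k w w = wedgePow n w w := by
  funext x
  simp [wedgePow]

theorem wedgePow_top_right {N : Type*} (α β : TwoForm n N) : wedgePow n β β = wedgePow 0 α β := by
  funext x
  simp [wedgePow]

/-- The factors of `w ^ i ∧ w_ψ ^ (n - i)`. -/
def mixedFactors (w : TwoForm n M) (i : ℕ) (ψ : M → ℝ) (l : Fin n) : TwoForm n M :=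
  if (l : ℕ) < i then w else deform w ψ

theorem wedgePow_eq_wedgeForm (w : TwoForm n M) (i : ℕ) (ψ : M → ℝ) :
    wedgePow i w (deform w ψ) = wedgeForm (mixedFactors w i ψ) := by
  funext x
  unfold wedgePow wedgeForm mixedFactors
  congr 1
  funext l
  split_ifs <;> rfl

/-- Slot `i` is the first one occupied by w_ψ. Putting the new copy of `w` in slot `l` instead
changes only the order of the factors, which `wedge` does not see. -/
theorem mixedFactors_update_perm (w : TwoForm n M) {i : ℕ} (ψ : M → ℝ) {l : Fin n}
    (hl : i ≤ (l : ℕ)) :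
    Function.update (mixedFactors w i ψ) l w =
      mixedFactors w (i + 1) ψ ∘ Equiv.swap (⟨i, hl.trans_lt l.isLt⟩ : Fin n) l := by
  funext m
  rw [Function.comp_apply]
  by_cases hm : m = l
  · subst hm
    simp [mixedFactors]
  · rw [Function.update_of_ne hm]
    by_cases hmi : m = ⟨i, hl.trans_lt l.isLt⟩
    · subst hmi
      have h1 : i ≠ (l : ℕ) := fun h => hm (Fin.ext h)
      have h2 : ¬ (l : ℕ) < i + 1 := by omega
      simp [mixedFactors, h2]
    · rw [Equiv.swap_apply_of_ne_of_ne hmi hm]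
      have h1 : (m : ℕ) ≠ i := fun h => hmi (Fin.ext h)
      have h2 : (m : ℕ) < i ↔ (m : ℕ) < i + 1 := by omega
      simp only [mixedFactors, h2]

/-- Expands √-1∂∂̄ψ = w_ψ - w in the slot `l`. Both the derivative formula and the monotonicity of
the mixed integrals rest on this identity. -/
theorem wedgeForm_update_ddbar_eq_sub (w : TwoForm n M) {i : ℕ} (ψ : M → ℝ) {l : Fin n}
    (hl : i ≤ (l : ℕ)) (x : M) :
    wedgeForm (Function.update (mixedFactors w i ψ) l (ddbar ψ)) x =
      wedgePow i w (deform w ψ) x - wedgePow (i + 1) w (deform w ψ) x := by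
  have h1 : mixedFactors w i ψ = Function.update (mixedFactors w i ψ) l (deform w ψ) := by
    have : mixedFactors w i ψ l = deform w ψ := if_neg (by omega)
    rw [← this, Function.update_eq_self]
  have h2 : wedgeForm (mixedFactors w (i + 1) ψ) x =
      wedgeForm (Function.update (mixedFactors w i ψ) l w) x := by
    rw [mixedFactors_update_perm w ψ hl]
    exact (wedge_comp_perm (fun m => mixedFactors w (i + 1) ψ m x) _).symm
  have h3 : ddbar ψ x = deform w ψ x - w x := by simp [deform]
  have h4 : wedgeForm (mixedFactors w i ψ) x =
      wedgeForm (Function.update (mixedFactors w i ψ) l (deform w ψ)) x := by rw [← h1]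
  rw [wedgePow_eq_wedgeForm, wedgePow_eq_wedgeForm, h2, h4, wedgeForm_update, wedgeForm_update,
    wedgeForm_update, ← wedge_update_sub, h3]

theorem SmoothFamily.hasDerivAt_smul_wedgePow {γ : ℝ → M → ℝ} (hγ : SmoothFamily n γ)
    (w : TwoForm n M) (i : ℕ) (t : ℝ) (x : M) (v : Fin n × Fin 2 → Fin n → ℂ) :
    HasDerivAt (fun s => (γ s x • wedgePow i w (deform w (γ s)) x) v)
      ((KahlerJ.velocity γ t x • wedgePow i w (deform w (γ t)) x +
        ∑ l ∈ Finset.univ.filter (fun l : Fin n => ¬ (l : ℕ) < i), γ t x • wedgeForm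
          (Function.update (mixedFactors w i (γ t)) l (ddbar (KahlerJ.velocity γ t))) x) v) t := by
  have h1 := hasDerivAt_wedge (t := t) (Ω := fun l s => mixedFactors w i (γ s) l x)
    -- The first `i` factors are constant in the parameter; each of the others varies by √-1∂∂̄ of
    -- the velocity.
    (Ω' := fun l => if (l : ℕ) < i then 0 else ddbar (KahlerJ.velocity γ t) x) (fun l a b => by
      by_cases h : (l : ℕ) < i
      · simp only [mixedFactors, h, if_true]
        exact hasDerivAt_const _ _
      · simp only [mixedFactors, h, if_false]
        exact (hγ.hasDerivAt_ddbar x t a b).const_add _) v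
  have h2 := (hγ.hasDerivAt x t).fun_mul h1
  simp only [wedgePow_eq_wedgeForm]
  refine h2.congr_deriv ?_
  rw [AlternatingMap.add_apply, alternatingMap_sum_apply, Finset.sum_filter, Finset.mul_sum]
  congr 1
  refine Finset.sum_congr rfl fun l _ => ?_
  by_cases h : (l : ℕ) < i
  · have h0 : wedge (Function.update (fun m => mixedFactors w i (γ t) m x) l 0) = 0 := by
      have := wedge_update_smul (fun m => mixedFactors w i (γ t) m x) l 0 0
      rwa [zero_smul, zero_smul] at this
    simp [h, h0]
  · rw [if_pos h, AlternatingMap.smul_apply, wedgeForm_update, smul_eq_mul, if_neg h]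

variable [IsManifold 𝓘(ℂ, Fin n → ℂ) ∞ M]

theorem smoothFamily_of_contMDiff {F : ℝ → M → ℝ}
    (hF : ContMDiff (𝓘(ℝ, ℝ).prod 𝓘(ℝ, Fin n → ℂ)) 𝓘(ℝ, ℝ) ∞ (fun p : ℝ × M => F p.1 p.2)) :
    SmoothFamily n F := fun c => by
  have h1 : ContMDiffOn 𝓘(ℝ, ℝ × (Fin n → ℂ)) 𝓘(ℝ, Fin n → ℂ) ∞
      (fun p : ℝ × (Fin n → ℂ) => (chartAt (Fin n → ℂ) c).symm p.2)
      (univ ×ˢ (chartAt (Fin n → ℂ) c).target) :=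
    (contMDiffOn_chart_symm (I := 𝓘(ℝ, Fin n → ℂ)) (n := ∞) (x := c)).comp
      (contDiff_snd.contMDiff.contMDiffOn) fun p hp => hp.2
  have h2 : ContMDiffOn 𝓘(ℝ, ℝ × (Fin n → ℂ)) 𝓘(ℝ, ℝ) ∞
      (fun p : ℝ × (Fin n → ℂ) => p.1) (univ ×ˢ (chartAt (Fin n → ℂ) c).target) :=
    contDiff_fst.contMDiff.contMDiffOn
  exact contMDiffOn_iff_contDiffOn.1 (hF.comp_contMDiffOn (h2.prodMk h1))

theorem SmoothFamily.contMDiff {F : ℝ → M → ℝ} (hF : SmoothFamily n F) (t : ℝ) :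
    ContMDiff 𝓘(ℝ, Fin n → ℂ) 𝓘(ℝ, ℝ) ∞ (F t) := fun x => by
  have h1 : ContDiffOn ℝ ∞ (F t ∘ (chartAt (Fin n → ℂ) x).symm)
      (chartAt (Fin n → ℂ) x).target :=
    (hF x).comp (contDiff_prodMk_right t).contDiffOn fun y hy => ⟨mem_univ _, hy⟩
  have h2 : ContMDiffAt 𝓘(ℝ, Fin n → ℂ) 𝓘(ℝ, ℝ) ∞ (F t ∘ (chartAt (Fin n → ℂ) x).symm)
      (chartAt (Fin n → ℂ) x x) :=
    (h1.contDiffAt ((chartAt (Fin n → ℂ) x).open_target.mem_nhds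
      (mem_chart_target _ x))).contMDiffAt
  have h3 : ContMDiffAt 𝓘(ℝ, Fin n → ℂ) 𝓘(ℝ, Fin n → ℂ) ∞ (chartAt (Fin n → ℂ) x) x :=
    (contMDiffOn_chart (I := 𝓘(ℝ, Fin n → ℂ)) (n := ∞) (x := x)).contMDiffAt
      ((chartAt (Fin n → ℂ) x).open_source.mem_nhds (mem_chart_source _ x))
  refine (h2.comp x h3).congr_of_eventuallyEq ?_
  filter_upwards [(chartAt (Fin n → ℂ) x).open_source.mem_nhds (mem_chart_source _ x)] with y hy
  simp only [Function.comp_apply, (chartAt (Fin n → ℂ) x).left_inv hy]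

theorem SmoothFamily.contDiffOn_localRep_deform {F : ℝ → M → ℝ} (hF : SmoothFamily n F)
    {w : TwoForm n M} (hw : SmoothTwo w) (c : M) (u v : Fin n → ℂ) :
    ContDiffOn ℝ ∞ (fun p : ℝ × (Fin n → ℂ) => localRep (deform w (F p.1)) c p.2 ![u, v])
      (univ ×ˢ (chartAt (Fin n → ℂ) c).target) := by
  refine (((hw c u v).comp contDiff_snd.contDiffOn fun p hp => hp.2).add
    (contDiffOn_ddbarModel_slice (chartAt (Fin n → ℂ) c).open_target (hF c) u v)).congr
    fun p hp => ?_
  have : localRep (deform w (F p.1)) c p.2 =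
      localRep w c p.2 + localRep (ddbar (F p.1)) c p.2 := rfl
  rw [this, localRep_ddbar (hF.contMDiff p.1) hp.2]
  rfl

theorem contDiffOn_coef_smul_wedgePow {F G : ℝ → M → ℝ} (hF : SmoothFamily n F)
    (hG : SmoothFamily n G) {w : TwoForm n M} (hw : SmoothTwo w) (i : ℕ) (c : M) :
    ContDiffOn ℝ ∞ (fun p : ℝ × (Fin n → ℂ) =>
      coef (fun x => F p.1 x • wedgePow i w (deform w (G p.1)) x) c p.2)
      (univ ×ˢ (chartAt (Fin n → ℂ) c).target) := by
  have h1 : ContDiffOn ℝ ∞ (fun p : ℝ × (Fin n → ℂ) =>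
      wedge (fun l => localRep (mixedFactors w i (G p.1) l) c p.2) (stdFrame n))
      (univ ×ˢ (chartAt (Fin n → ℂ) c).target) := by
    refine contDiffOn_wedge_apply (fun l u v => ?_) _
    by_cases h : (l : ℕ) < i
    · simp only [mixedFactors, h, if_true]
      exact (hw c u v).comp contDiff_snd.contDiffOn fun p hp => hp.2
    · simp only [mixedFactors, h, if_false]
      exact hG.contDiffOn_localRep_deform hw c u v
  refine ((hF c).mul h1).congr fun p hp => ?_
  rw [← coef_wedge _ hp.2, wedgePow_eq_wedgeForm]
  rfl

theorem isSmoothClosed_mixedFactors {w : TwoForm n M} (hw : IsKahlerForm w) (i : ℕ) {ψ : M → ℝ}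
    (hψ : ContMDiff 𝓘(ℝ, Fin n → ℂ) 𝓘(ℝ, ℝ) ∞ ψ) (l : Fin n) :
    IsSmoothClosed (mixedFactors w i ψ l) := by
  unfold mixedFactors
  split_ifs
  · exact hw.isSmoothClosed
  · exact hw.isSmoothClosed.deform hψ

theorem isTypeOneOne_mixedFactors {w : TwoForm n M} (hw : IsKahlerForm w) (i : ℕ) {ψ : M → ℝ}
    (hψ : ContMDiff 𝓘(ℝ, Fin n → ℂ) 𝓘(ℝ, ℝ) ∞ ψ) (l : Fin n) (x : M) :
    IsTypeOneOne (mixedFactors w i ψ l x) := by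
  unfold mixedFactors
  split_ifs
  · exact hw.type_one_one x
  · exact isTypeOneOne_deform hw.type_one_one hψ x

theorem continuousTop_wedgePow {w : TwoForm n M} (hw : IsKahlerForm w) (i : ℕ) {ψ : M → ℝ}
    (hψ : ContMDiff 𝓘(ℝ, Fin n → ℂ) 𝓘(ℝ, ℝ) ∞ ψ) : ContinuousTop (wedgePow i w (deform w ψ)) := by
  rw [wedgePow_eq_wedgeForm]
  exact continuousTop_wedgeForm fun l => (isSmoothClosed_mixedFactors hw i hψ l).smoothTwo

variable [T2Space M] [CompactSpace M]

theorem hasDerivAt_formIntegral {T T' : ℝ → TopForm n M}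
    (hT : ∀ c : M, ContDiffOn ℝ 1 (fun p : ℝ × (Fin n → ℂ) => coef (T p.1) c p.2)
      (univ ×ˢ (chartAt (Fin n → ℂ) c).target))
    (hT' : ∀ t x v, HasDerivAt (fun s => T s x v) (T' t x v) t) (t : ℝ) :
    HasDerivAt (fun s => formIntegral (T s)) (formIntegral (T' t)) t := by
  simp only [formIntegral_eq_sum]
  refine HasDerivAt.fun_sum fun c _ => ?_
  refine hasDerivAt_setIntegral_slice (chartAt (Fin n → ℂ) c).open_target
    (isCompact_chart_image (isCompact_tsupport_partitionOfUnity c)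
      (tsupport_partitionOfUnity_subset c))
    (chart_image_subset (tsupport_partitionOfUnity_subset c))
    (P := fun p => partitionOfUnity n M c ((chartAt (Fin n → ℂ) c).symm p.2) * coef (T p.1) c p.2)
    (P' := fun p => partitionOfUnity n M c ((chartAt (Fin n → ℂ) c).symm p.2) *
      coef (T' p.1) c p.2) ?_ ?_ ?_ t
  · exact (((contDiffOn_partitionOfUnity c c).of_le (by simp)).comp contDiff_snd.contDiffOn
      fun p hp => hp.2).mul (hT c)
  · intro t z hz hzK
    simp only
    rw [image_eq_zero_of_notMem_tsupport (chart_symm_mem_of_notMem_image hz hzK), zero_mul]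
  · intro t z _
    have h := (hT' t ((chartAt (Fin n → ℂ) c).symm z)
      fun p => chartDeriv c z (stdFrame n p)).const_mul
        (partitionOfUnity n M c ((chartAt (Fin n → ℂ) c).symm z))
    exact h

theorem continuous_formIntegral {T : ℝ → TopForm n M}
    (hT : ∀ c : M, ContinuousOn (fun p : ℝ × (Fin n → ℂ) => coef (T p.1) c p.2)
      (univ ×ˢ (chartAt (Fin n → ℂ) c).target)) :
    Continuous fun s => formIntegral (T s) := by
  simp only [formIntegral_eq_sum]
  refine continuous_finsetSum _ fun c _ => ?_
  refine continuous_setIntegral_slice (chartAt (Fin n → ℂ) c).open_target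
    (isCompact_chart_image (isCompact_tsupport_partitionOfUnity c)
      (tsupport_partitionOfUnity_subset c))
    (chart_image_subset (tsupport_partitionOfUnity_subset c))
    (P := fun p => partitionOfUnity n M c ((chartAt (Fin n → ℂ) c).symm p.2) * coef (T p.1) c p.2)
    ?_ ?_
  · exact ((contDiffOn_partitionOfUnity c c).continuousOn.comp continuous_snd.continuousOn
      fun p hp => hp.2).mul (hT c)
  · intro t z hz hzK
    simp only
    rw [image_eq_zero_of_notMem_tsupport (chart_symm_mem_of_notMem_image hz hzK), zero_mul]

/-! ### Mixed integrals and the values of the functionals -/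

/-- `∫ f w ^ i ∧ w_ψ ^ (n - i)`. -/
def mixedIntegral (w : TwoForm n M) (i : ℕ) (f ψ : M → ℝ) : ℝ :=
  formIntegral fun x => f x • wedgePow i w (deform w ψ) x

theorem formIntegral_sum {κ : Type*} (s : Finset κ) {T : κ → TopForm n M}
    (hT : ∀ k ∈ s, ContinuousTop (T k)) :
    formIntegral (fun x => ∑ k ∈ s, T k x) = ∑ k ∈ s, formIntegral (T k) ∧
      ContinuousTop fun x => ∑ k ∈ s, T k x := by
  classical
  induction s using Finset.induction_on with
  | empty =>
    refine ⟨?_, fun c => ?_⟩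
    · simpa using formIntegral_smul 0 (fun _ => 0 : TopForm n M)
    · have : coef (fun x => ∑ k ∈ (∅ : Finset κ), T k x) c = fun _ => 0 := by
        funext z; simp [coef]
      rw [this]
      exact continuousOn_const
  | insert k s hk ih =>
    obtain ⟨ih1, ih2⟩ := ih fun k hk => hT k (Finset.mem_insert_of_mem hk)
    have hk' := hT k (Finset.mem_insert_self _ _)
    have h : (fun x => ∑ k ∈ insert k s, T k x) = fun x => T k x + ∑ k ∈ s, T k x := by
      funext x; rw [Finset.sum_insert hk]
    rw [h, Finset.sum_insert hk, formIntegral_add hk' ih2, ih1]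
    exact ⟨rfl, fun c => (hk' c).add (ih2 c)⟩

/-- Let b_i = ∫ γ' w^i ∧ w_γ^(n-i). Differentiating the factor γ gives b_i; each of the n - i
factors w_γ gives ∫ γ √-1∂∂̄γ' ∧ ⋯, which by symmetry is ∫ γ' √-1∂∂̄γ ∧ ⋯ = b_i - b_{i+1}. The
coefficient n - i is written as n + 1 - (i + 1) so that sums over `i` telescope. -/
theorem SmoothFamily.hasDerivAt_mixedIntegral {γ : ℝ → M → ℝ} (hγ : SmoothFamily n γ)
    {w : TwoForm n M} (hw : IsKahlerForm w) {i : ℕ} (hi : i ≤ n) (t : ℝ) :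
    HasDerivAt (fun s => mixedIntegral w i (γ s) (γ s))
      (((n : ℝ) + 1 - i) * mixedIntegral w i (KahlerJ.velocity γ t) (γ t) -
        ((n : ℝ) + 1 - (i + 1 : ℕ)) * mixedIntegral w (i + 1) (KahlerJ.velocity γ t) (γ t)) t := by
  have hsγ := hγ.contMDiff t
  have hsv := hγ.velocity.contMDiff t
  have h := hasDerivAt_formIntegral
    (fun c => (contDiffOn_coef_smul_wedgePow hγ hγ hw.isSmoothClosed.smoothTwo i c).of_le (by simp))
    (fun t x v => hγ.hasDerivAt_smul_wedgePow w i t x v) t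
  refine h.congr_deriv ?_
  have hsc := isSmoothClosed_mixedFactors hw i hsγ
  have hcont : ∀ l : Fin n, ContinuousTop fun x => γ t x • wedgeForm
      (Function.update (mixedFactors w i (γ t)) l (ddbar (KahlerJ.velocity γ t))) x := fun l =>
    (continuousTop_wedgeForm (SmoothTwo.update (fun m => (hsc m).smoothTwo)
      (isSmoothClosed_ddbar hsv).smoothTwo)).smul hsγ.continuous
  have hpow : ∀ m, ContinuousTop fun x =>
      KahlerJ.velocity γ t x • wedgePow m w (deform w (γ t)) x := fun m =>
    (continuousTop_wedgePow hw m hsγ).smul hsv.continuous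
  obtain ⟨hs1, hs2⟩ := formIntegral_sum
    (Finset.univ.filter (fun l : Fin n => ¬ (l : ℕ) < i)) fun l _ => hcont l
  rw [formIntegral_add (hpow i) hs2, hs1]
  have hterm : ∀ l ∈ Finset.univ.filter (fun l : Fin n => ¬ (l : ℕ) < i),
      formIntegral (fun x => γ t x • wedgeForm (Function.update (mixedFactors w i (γ t)) l
        (ddbar (KahlerJ.velocity γ t))) x) =
      mixedIntegral w i (KahlerJ.velocity γ t) (γ t) -
        mixedIntegral w (i + 1) (KahlerJ.velocity γ t) (γ t) := by
    intro l hl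
    have hil : i ≤ (l : ℕ) := not_lt.1 (Finset.mem_filter.1 hl).2
    rw [formIntegral_smul_wedge_ddbar_comm hsc (isTypeOneOne_mixedFactors hw i hsγ) l hsγ hsv]
    simp only [wedgeForm_update_ddbar_eq_sub w (γ t) hil, smul_sub]
    exact formIntegral_sub (hpow i) (hpow (i + 1))
  have hcard : ((Finset.univ.filter (fun l : Fin n => ¬ (l : ℕ) < i)).card : ℝ) = n - i := by
    have h1 := Finset.card_filter_add_card_filter_not (s := (Finset.univ : Finset (Fin n)))
      (fun l : Fin n => (l : ℕ) < i)
    rw [Fin.card_filter_val_lt, min_eq_right hi, Finset.card_univ, Fintype.card_fin] at h1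
    have h2 : (i : ℝ) + (Finset.univ.filter (fun l : Fin n => ¬ (l : ℕ) < i)).card = n := by
      exact_mod_cast h1
    linarith
  rw [Finset.sum_congr rfl hterm, Finset.sum_const, nsmul_eq_mul, hcard]
  change mixedIntegral w i (KahlerJ.velocity γ t) (γ t) + _ = _
  push_cast
  ring

theorem SmoothFamily.continuous_mixedIntegral_velocity {γ : ℝ → M → ℝ} (hγ : SmoothFamily n γ)
    {w : TwoForm n M} (hw : IsKahlerForm w) (i : ℕ) :
    Continuous fun t => mixedIntegral w i (KahlerJ.velocity γ t) (γ t) :=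
  continuous_formIntegral fun c =>
    (contDiffOn_coef_smul_wedgePow hγ.velocity hγ hw.isSmoothClosed.smoothTwo i c).continuousOn

/-- Along a path from `0`, the integral of `∫ γ' w ^ k ∧ w_γ ^ (n - k)` depends on the end point
only. -/
theorem integral_mixedIntegral_velocity {γ : ℝ → M → ℝ} (hγ : SmoothFamily n γ) (h0 : γ 0 = 0)
    {w : TwoForm n M} (hw : IsKahlerForm w) {k : ℕ} (hk : k ≤ n) :
    ((n : ℝ) + 1 - k) * ∫ t in (0 : ℝ)..1, mixedIntegral w k (KahlerJ.velocity γ t) (γ t) =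
      ∑ i ∈ Finset.range (n + 1 - k), mixedIntegral w (k + i) (γ 1) (γ 1) := by
  have hd : ∀ t, HasDerivAt
      (fun s => ∑ i ∈ Finset.range (n + 1 - k), mixedIntegral w (k + i) (γ s) (γ s))
      (((n : ℝ) + 1 - k) * mixedIntegral w k (KahlerJ.velocity γ t) (γ t)) t := by
    intro t
    have h1 := HasDerivAt.fun_sum (u := Finset.range (n + 1 - k)) fun i hi =>
      hγ.hasDerivAt_mixedIntegral hw (i := k + i)
        (by have := Finset.mem_range.1 hi; omega) t
    refine h1.congr_deriv ?_
    refine (Finset.sum_range_sub' (fun i => ((n : ℝ) + 1 - (k + i : ℕ)) *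
      mixedIntegral w (k + i) (KahlerJ.velocity γ t) (γ t)) (n + 1 - k)).trans ?_
    -- The far end of the telescope has index n + 1 and hence coefficient zero.
    have h2 : k + (n + 1 - k) = n + 1 := by omega
    simp only [h2, add_zero]
    push_cast
    ring
  have hz : ∀ i, mixedIntegral w i (γ 0) (γ 0) = 0 := fun i => by
    rw [h0]
    have := formIntegral_smul (0 : ℝ) (wedgePow i w (deform w (0 : M → ℝ)))
    rw [zero_mul] at this
    exact this
  rw [← intervalIntegral.integral_const_mul, intervalIntegral.integral_eq_sub_of_hasDerivAt
    (fun t _ => hd t)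
    ((continuous_const.mul (hγ.continuous_mixedIntegral_velocity hw k)).intervalIntegrable 0 1)]
  simp only [hz, Finset.sum_const_zero, sub_zero]

/-- The difference of the two sides is ∫ φ √-1∂∂̄φ ∧ w^i ∧ w_φ^(n-i-1), with w and w_φ both
positive. -/
theorem mixedIntegral_mono {w : TwoForm n M} (hw : IsKahlerForm w) {φ : M → ℝ}
    (hφ : φ ∈ KahlerPotentials w) {i : ℕ} (hi : i < n) :
    mixedIntegral w i φ φ ≤ mixedIntegral w (i + 1) φ φ := by
  have h := formIntegral_smul_wedge_ddbar_self_nonpos (isSmoothClosed_mixedFactors hw i hφ.1)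
    (isTypeOneOne_mixedFactors hw i hφ.1) (fun l => by
      unfold mixedFactors
      split_ifs
      · exact hw.positive
      · exact hφ.2) ⟨i, hi⟩ hφ.1
  have hpow : ∀ m, ContinuousTop fun x => φ x • wedgePow m w (deform w φ) x := fun m =>
    (continuousTop_wedgePow hw m hφ.1).smul hφ.1.continuous
  simp only [wedgeForm_update_ddbar_eq_sub w φ (l := ⟨i, hi⟩) le_rfl, smul_sub] at h
  rw [formIntegral_sub (hpow i) (hpow (i + 1))] at h
  exact sub_nonpos.1 h

/-- Numerator and denominator are the same integral; positivity of the volume, for nonempty `M`,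
rules out 0 / 0. -/
theorem cConst_self [Nonempty M] {w : TwoForm n M} (hw : IsKahlerForm w) (k : ℕ) :
    cConst w w k = 1 := by
  have hΩ : wedgePow n w w = wedgeForm fun _ : Fin n => w := by
    funext x
    simp [wedgePow, wedgeForm]
  have hpos : 0 < formIntegral (wedgePow n w w) := by
    rw [hΩ]
    exact formIntegral_pos (continuousTop_wedgeForm fun _ => hw.isSmoothClosed.smoothTwo)
      fun x => wedge_const_stdFrame_pos (hw.type_one_one x) (hw.positive x)
  rw [cConst, wedgePow_self_left w k, div_self hpos.ne']

theorem jVariation_eq {w : TwoForm n M} (hw : IsKahlerForm w) (k : ℕ) {f ψ : M → ℝ}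
    (hf : ContMDiff 𝓘(ℝ, Fin n → ℂ) 𝓘(ℝ, ℝ) ∞ f) (hψ : ContMDiff 𝓘(ℝ, Fin n → ℂ) 𝓘(ℝ, ℝ) ∞ ψ) :
    jVariation w w k ψ f = mixedIntegral w k f ψ - mixedIntegral w 0 f ψ := by
  have h : (fun x => f x • (wedgePow k w (deform w ψ) x -
      cConst w w k • wedgePow n (deform w ψ) (deform w ψ) x)) =
      fun x => f x • wedgePow k w (deform w ψ) x - f x • wedgePow 0 w (deform w ψ) x := by
    funext x
    -- The forms are compared pointwise, so a point is at hand and empty `M` needs no separate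
    -- treatment.
    have : Nonempty M := ⟨x⟩
    rw [cConst_self hw, one_smul, wedgePow_top_right w, smul_sub]
  rw [jVariation, h]
  exact formIntegral_sub ((continuousTop_wedgePow hw k hψ).smul hf.continuous)
    ((continuousTop_wedgePow hw 0 hψ).smul hf.continuous)

/-- The variation is b_k - b_0 with b_i = ∫ γ' w^i ∧ w_γ^(n-i), and the time integral of each b_i is
an average of mixed integrals of the end point. The result involves `φ` alone, hence path
independence. -/
theorem jAlong_eq {w : TwoForm n M} (hw : IsKahlerForm w) {φ : M → ℝ} {γ : ℝ → M → ℝ}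
    (hγ : IsPotentialPath w φ γ) {k : ℕ} (hk : k ≤ n) :
    jAlong w w k γ =
      (∑ i ∈ Finset.range (n + 1 - k), mixedIntegral w (k + i) φ φ) / ((n : ℝ) + 1 - k) -
      (∑ i ∈ Finset.range (n + 1), mixedIntegral w i φ φ) / ((n : ℝ) + 1) := by
  have hs := smoothFamily_of_contMDiff hγ.smooth
  have hk' : (n : ℝ) + 1 - k ≠ 0 := by
    have : (k : ℝ) ≤ n := by exact_mod_cast hk
    linarith
  have hn' : (n : ℝ) + 1 ≠ 0 := by positivity
  have h1 := integral_mixedIntegral_velocity hs hγ.zero hw hk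
  have h2 := integral_mixedIntegral_velocity hs hγ.zero hw (Nat.zero_le n)
  rw [hγ.one] at h1 h2
  simp only [Nat.cast_zero, sub_zero, Nat.sub_zero, zero_add] at h2
  rw [← h1, ← h2, mul_div_cancel_left₀ _ hk', mul_div_cancel_left₀ _ hn',
    ← intervalIntegral.integral_sub
      ((hs.continuous_mixedIntegral_velocity hw k).intervalIntegrable 0 1)
      ((hs.continuous_mixedIntegral_velocity hw 0).intervalIntegrable 0 1)]
  unfold jAlong
  congr 1
  funext t
  exact jVariation_eq hw k (hs.velocity.contMDiff t) (hs.contMDiff t)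

theorem jFunctional_eq {w : TwoForm n M} (hw : IsKahlerForm w) {φ : M → ℝ}
    (hφ : ContMDiff 𝓘(ℝ, Fin n → ℂ) 𝓘(ℝ, ℝ) ∞ φ) :
    jFunctional w φ = mixedIntegral w n φ φ - mixedIntegral w 0 φ φ := by
  have h : (fun x => φ x • (wedgePow n w w x - wedgePow n (deform w φ) (deform w φ) x)) =
      fun x => φ x • wedgePow n w (deform w φ) x - φ x • wedgePow 0 w (deform w φ) x := by
    funext x
    have h1 : wedgePow n w w x = wedgePow n w (deform w φ) x := by simp [wedgePow]
    rw [wedgePow_top_right w (deform w φ), h1, smul_sub]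
  rw [jFunctional, h]
  exact formIntegral_sub ((continuousTop_wedgePow hw n hφ).smul hφ.continuous)
    ((continuousTop_wedgePow hw 0 hφ).smul hφ.continuous)

end Families

/-! ### Averages of increasing sequences, and the conclusion -/

theorem sum_range_succ_div_le {a : ℕ → ℝ} {m : ℕ} (hm : 1 ≤ m)
    (ha : ∀ i < m, a i ≤ a (i + 1)) :
    (∑ i ∈ Finset.range (m + 1), a i) / ((m : ℝ) + 1) ≤
      (∑ i ∈ Finset.range m, a (i + 1)) / m := by
  have hmono : ∀ i ≤ m, a 0 ≤ a i := fun i => by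
    induction i with
    | zero => exact fun _ => le_rfl
    | succ i ih => exact fun hi => (ih (by omega)).trans (ha i (by omega))
  have h1 : (m : ℝ) * a 0 ≤ ∑ i ∈ Finset.range m, a (i + 1) := by
    have := Finset.card_nsmul_le_sum (Finset.range m) (fun i => a (i + 1)) (a 0)
      fun i hi => hmono _ (Finset.mem_range.1 hi)
    simpa using this
  have hm' : (0 : ℝ) < m := by exact_mod_cast hm
  -- Removing the smallest term `a 0` from an average does not decrease it; after clearing
  -- denominators this is `h1`.
  rw [Finset.sum_range_succ', div_le_div_iff₀ (by positivity) hm']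
  nlinarith

/-- The right-hand side is exactly 1/(m(m+1)) times the sum of the a_i - a_0 for 1 ≤ i ≤ m. These
are all nonnegative, and one of them is a_m - a_0. -/
theorem sub_le_sum_range_sub {a : ℕ → ℝ} {m : ℕ} (hm : 1 ≤ m) (ha : ∀ i < m, a i ≤ a (i + 1)) :
    1 / ((m : ℝ) * ((m : ℝ) + 1)) * (a m - a 0) ≤
      (∑ i ∈ Finset.range m, a (i + 1)) / m - (∑ i ∈ Finset.range (m + 1), a i) / ((m : ℝ) + 1) := by
  have hmono : ∀ i ≤ m, a 0 ≤ a i := fun i => by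
    induction i with
    | zero => exact fun _ => le_rfl
    | succ i ih => exact fun hi => (ih (by omega)).trans (ha i (by omega))
  -- Only the last summand, i = m - 1, is kept.
  have h1 : a m - a 0 ≤ ∑ i ∈ Finset.range m, (a (i + 1) - a 0) := by
    have := Finset.single_le_sum (f := fun i => a (i + 1) - a 0) (s := Finset.range m)
      (fun i hi => sub_nonneg.2 (hmono _ (Finset.mem_range.1 hi)))
      (Finset.mem_range.2 (show m - 1 < m by omega))
    simpa [Nat.sub_add_cancel hm] using this
  have hm' : (0 : ℝ) < m := by exact_mod_cast hm
  rw [Finset.sum_sub_distrib, Finset.sum_const, Finset.card_range, nsmul_eq_mul] at h1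
  rw [Finset.sum_range_succ']
  have h2 : (∑ i ∈ Finset.range m, a (i + 1)) / (m : ℝ) -
      (∑ i ∈ Finset.range m, a (i + 1) + a 0) / ((m : ℝ) + 1) =
      1 / ((m : ℝ) * ((m : ℝ) + 1)) * (∑ i ∈ Finset.range m, a (i + 1) - m * a 0) := by
    field_simp
    ring
  rw [h2]
  exact mul_le_mul_of_nonneg_left h1 (by positivity)

end

end KahlerJ

theorem proposition6p1 (n : ℕ) (hn : 1 ≤ n) {M : Type*} [TopologicalSpace M] [T2Space M]
    [CompactSpace M] [ChartedSpace (Fin n → ℂ) M] [IsManifold 𝓘(ℂ, Fin n → ℂ) ∞ M]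
    (w₀ : KahlerJ.TwoForm n M) (hw₀ : KahlerJ.IsKahlerForm w₀)
    (φ : M → ℝ) (hφ : φ ∈ KahlerJ.KahlerPotentials w₀)
    (γ : ℕ → ℝ → M → ℝ)
    (hγ : ∀ k, 1 ≤ k → k ≤ n → KahlerJ.IsPotentialPath w₀ φ (γ k)) :
    (∀ k, 1 ≤ k → k < n →
      KahlerJ.jAlong w₀ w₀ k (γ k) ≤ KahlerJ.jAlong w₀ w₀ (k + 1) (γ (k + 1))) ∧
    1 / ((n : ℝ) * ((n : ℝ) + 1)) * KahlerJ.jFunctional w₀ φ ≤ KahlerJ.jAlong w₀ w₀ 1 (γ 1) := by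
  have hmono : ∀ i < n, KahlerJ.mixedIntegral w₀ i φ φ ≤ KahlerJ.mixedIntegral w₀ (i + 1) φ φ :=
    fun i hi => KahlerJ.mixedIntegral_mono hw₀ hφ hi
  refine ⟨fun k hk1 hkn => ?_, ?_⟩
  · rw [KahlerJ.jAlong_eq hw₀ (hγ k hk1 hkn.le) hkn.le,
      KahlerJ.jAlong_eq hw₀ (hγ (k + 1) (by omega) hkn) hkn]
    -- The subtracted average over all indices is the same for `k` and `k + 1`, so only the tails
    -- a_k, …, a_n and a_{k+1}, …, a_n are compared.
    have h := KahlerJ.sum_range_succ_div_le (m := n - k)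
      (a := fun i => KahlerJ.mixedIntegral w₀ (k + i) φ φ) (by omega)
      fun i hi => hmono (k + i) (by omega)
    have h1 : n + 1 - k = n - k + 1 := by omega
    have h2 : n + 1 - (k + 1) = n - k := by omega
    have h3 : (n : ℝ) + 1 - k = ((n - k : ℕ) : ℝ) + 1 := by
      rw [Nat.cast_sub hkn.le]; ring
    have h4 : (n : ℝ) + 1 - ((k + 1 : ℕ) : ℝ) = ((n - k : ℕ) : ℝ) := by
      rw [Nat.cast_sub hkn.le]; push_cast; ring
    have h5 : ∀ i, k + 1 + i = k + (i + 1) := fun i => by omega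
    rw [h1, h2, h3, h4]
    simp only [h5]
    exact sub_le_sub_right h _
  · rw [KahlerJ.jAlong_eq hw₀ (hγ 1 le_rfl hn) hn, KahlerJ.jFunctional_eq hw₀ hφ.1]
    -- For k = 1 the tail is the full sequence without a_0, and J is a_n - a_0.
    have h := KahlerJ.sub_le_sum_range_sub
      (a := fun i => KahlerJ.mixedIntegral w₀ i φ φ) hn hmono
    have h4 : (n : ℝ) + 1 - ((1 : ℕ) : ℝ) = n := by push_cast; ring
    have h5 : ∀ i, 1 + i = i + 1 := fun i => by omega
    rw [h4, Nat.add_sub_cancel]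
    simp only [h5]
    exact h
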